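/- **Setting.** Let $m\ge 1$, $\mathcal X_i=\mathbb R^{n_i}$ with the Euclidean norm ($i=1,\dots,m$), $\mathcal X=\prod_i\mathcal X_i$, and let $\mathcal Y$ be a finite dimensional real normed space; dual norms are used on $\mathcal X_i^*$ and $\mathcal Y^*$. Let $f_i:\mathcal X_i\to\mathbb R\cup\{+\infty\}$ be proper, closed, convex with convexity modulus $\mu_i\ge 0$, let $h:\mathcal Y\to\mathbb R\cup\{+\infty\}$ be proper, closed, convex, and let $\Phi:\mathcal X\times\mathcal Y\to\mathbb R$ be convex and differentiable in $x$, concave and differentiable in $y$, such that for constants $L_{x_ix_i}\ge 0$, $L_{yy}\ge 0$, $L_{yx_i}>0$ and all $x\in\mathcal X$, $v\in\mathcal X_i$, $y,y'\in\mathcal Y$, with $U_iv\in\mathcal X$ the vector with $v$ in block $i$ and zeros elsewhere, $$\|\nabla_{x_i}\Phi(x+U_iv,y)-\nabla_{x_i}\Phi(x,y)\|\le L_{x_ix_i}\|v\|,\qquad \|\nabla_y\Phi(x+U_iv,y')-\nabla_y\Phi(x,y)\|\le L_{yy}\|y-y'\|+L_{yx_i}\|v\|.$$ Let $\mathcal L(x,y)=\sum_i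 f_i(x_i)+\Phi(x,y)-h(y)$ and let $(x^*,y^*)$ be a saddle point of $\min_x\max_y\mathcal L$. Let $\varphi:\mathcal Y\to\mathbb R$ be 1-strongly convex and differentiable on an open set $U\supseteq\mathrm{dom}\,h$, with Bregman distance $D(y,z)=\varphi(y)-\varphi(z)-\langle\nabla\varphi(z),y-z\rangle$. For $d\in\mathbb R_{\ge0}^m$ put $\|x\|_d^2=\sum_i d_i\|x_i\|^2$, and put $T^k=(1/\tau_i^k)_i$, $\mu=(\mu_i)_i$. **Method (RAPD).** Given $x^0\in\prod_i\mathrm{dom} f_i$, $y^0\in U$ and $(x^{-1},y^{-1})=(x^0,y^0)$, for $k\ge0$: $s^k=\nabla_y\Phi(x^k,y^k)+m\theta^k(\nabla_y\Phi(x^k,y^k)-\nabla_y\Phi(x^{k-1},y^{k-1}))$; $y^{k+1}=\operatorname{argmin}_y\{h(y)-\langle s^k,y-y^k\rangle+\frac1{\sigma^k}D(y,y^k)\}$; $i_k$ is drawn uniformly from $\{1,\dots,m\}$, independently of the past; $x_{i_k}^{k+1}=\operatorname{argmin}_{v}\{f_{i_k}(v)+\langle\nabla_{x_{i_k}}\Phi(x^k,y^{k+1}),v\rangle+\frac{1}{2\tau_{i_k}^k}\|v-x^k_{i_k}\|^2\}$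 and $x_i^{k+1}=x_i^k$ for $i\ne i_k$. Let $\bar x^K=\frac1K\sum_{k=0}^{K-1}x^{k+1}$, $\bar y^K=\frac1K\sum_{k=0}^{K-1}y^{k+1}$. **Step-size condition with moduli $\nu\in\mathbb R_{\ge0}^m$.** $\tau_i^k,\sigma^k>0$, $\theta^k\in[1-\frac1m,1]$, $\theta^0=t^0=1$, and there are $\alpha^k>0$, $\beta^k\ge0$ such that for all $k\ge0$ and all $i$ $$\tfrac1{\tau_i^k}\ge L_{x_ix_i}+\tfrac{L_{yx_i}^2}{\alpha^{k+1}},\qquad \tfrac1{\sigma^k}\ge m\theta^k(\alpha^k+\beta^k)+\tfrac{mL_{yy}^2}{\beta^{k+1}},$$ $$t^k\big(\tfrac1{\tau_i^k}+\nu_i\big)\ge t^{k+1}\big(\tfrac1{\tau_i^{k+1}}+(1-\tfrac1m)\nu_i\big),\qquad \tfrac{t^k}{\sigma^k}\ge\tfrac{t^{k+1}}{\sigma^{k+1}},\qquad t^{k+1}\theta^{k+1}=t^k$$ (with $0^2/0=0$ and $c/0=+\infty$ for $c>0$). Put $$\Delta_\nu=\tfrac12\|x^*-x^0\|^2_{T^0+(1-\frac1m)\nu}+\big(\tfrac1{m\sigma^0}+(1-\tfrac1m)L_{yy}\big)D(y^*,y^0)+(1-\tfrac1m)\big(\mathcal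 L(x^0,y^*)-\mathcal L(x^*,y^*)\big).$$ **Part I.** (a) Let $0\le\nu_i\le\mu_i$ for all $i$, and suppose that the step-size condition with moduli $\nu$ holds with $t^k=\theta^k=1$ for all $k$. Then for all $K\ge1$, $$0\le\mathbf E[\mathcal L(\bar x^K,y^*)-\mathcal L(x^*,\bar y^K)]\le\tfrac mK\Delta_\nu .$$ In particular ($\nu=0$, mere convexity) this holds with $\Delta_1=\Delta_0$, which contains only $\|x^*-x^0\|_{T^0}^2$. (b) Let $\alpha>0$, $c_\tau,c_\sigma\in(0,1]$, $\theta^k=1$, $\tau_i^k=c_\tau(L_{x_ix_i}+L_{yx_i}^2/\alpha)^{-1}$ and $\sigma^k=c_\sigma(m(\alpha+2L_{yy}))^{-1}$ for all $k$. Then the bound of (a) holds with $\Delta_1=\Delta_0$. If $c_\tau,c_\sigma<1$, then $(x^k,y^k)$ converges almost surely to a random saddle point $(x^\infty,y^\infty)$, which has finite second moments, and there is a constant $C$ such that for all $K\ge1$ $$0\le\mathbf E[\mathcal L(\bar x^K,y^\infty)-\mathcal L(x^\infty,\bar y^K)]\le C\,\tfrac mK\,\big(1+\mathbf E[D(y^\infty,y^0)]\big).$$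 If $c_\sigma<1$, then $\mathbf E[D(y^*,y^K)]\le\frac{c_\sigma}{1-c_\sigma}\cdot\frac{\Delta_1}{\alpha+2L_{yy}}$ for all $K\ge1$. **Part II.** Suppose $\mu_i>0$ for all $i$ and $L_{yy}=0$ (so $\Phi$ is affine in $y$), and let $\Delta_2=\Delta_\mu$. (a) If the step-size condition with moduli $\mu$ holds, then for all $K\ge1$ $$\mathbf E\big[\tfrac12\|x^{K+1}-x^*\|^2_{T^K+(1-\frac1m)\mu}\big]\le\tfrac m{t^K}\Delta_2 .$$ (b) Let $\alpha>0$, $c_\sigma\in(0,1]$, $\theta^0=t^0=1$, $\sigma^0=c_\sigma/(m\alpha)$, $\tilde\tau^0=\min_i\frac{\mu_i}m\big(L_{x_ix_i}+L_{yx_i}^2/\alpha+(1-\frac1m)\mu_i\big)^{-1}$ and, for $k\ge0$, $\tau_i^k=\big(\frac{\mu_i}m(1+\frac1{\tilde\tau^k})-\mu_i\big)^{-1}$, $\theta^{k+1}=(1+\tilde\tau^k)^{-1/2}$, $\sigma^{k+1}=\sigma^k/\theta^{k+1}$, $\tilde\tau^{k+1}=\theta^{k+1}\tilde\tau^k$,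 $t^{k+1}=t^k/\theta^{k+1}$. Then the bound of (a) holds; there are constants $c,C>0$, independent of the starting point, with $c/K^2\le\tau_i^K/t^K\le C/K^2$ and $\mathbf E\|x^K-x^*\|^2\le C\frac m{K^2}\Delta_2$ for all $K\ge1$ and all $i$; and if $c_\sigma<1$, then $\mathbf E[D(y^*,y^K)]\le\frac{c_\sigma}{1-c_\sigma}\cdot\frac{\Delta_2}{\alpha}$ for all $K\ge1$. -/

import Mathlib

open Set Filter Topology MeasureTheory ProbabilityTheory
open scoped ENNReal

namespace RAPD

noncomputable section

/-- The primal space `ℝ^{n_1} × ⋯ × ℝ^{n_m}`; each block carries the Euclidean norm. (The norm of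
the product as a Lean type is only used through its topology; the Euclidean norms of vectors of the
product are written out with `wsq`.) -/
abbrev Primal {m : ℕ} (n : Fin m → ℕ) : Type := (i : Fin m) → EuclideanSpace ℝ (Fin (n i))

/-- `‖x‖²_D = ∑ i, d_i ‖x_i‖²` for the diagonal matrix `D = diag(d)`. -/
def wsq {m : ℕ} {n : Fin m → ℕ} (d : Fin m → ℝ) (x : Primal n) : ℝ :=
  ∑ i, d i * ‖x i‖ ^ 2

/-- A proper closed convex function with values in `ℝ ∪ {+∞}` and convexity modulus `μ`
(for `μ = 0`: a proper closed convex function). -/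
structure ClosedConvex {E : Type*} [NormedAddCommGroup E] [NormedSpace ℝ E]
    (μ : ℝ) (f : E → EReal) : Prop where
  ne_bot : ∀ x, f x ≠ ⊥
  proper : ∃ x, f x ≠ ⊤
  closed : LowerSemicontinuous f
  convex : ∀ x y : E, ∀ a b : ℝ, 0 ≤ a → 0 ≤ b → a + b = 1 →
    f (a • x + b • y) + ((μ / 2 * (a * b) * ‖x - y‖ ^ 2 : ℝ) : EReal)
      ≤ (a : EReal) * f x + (b : EReal) * f y

/-- `L(x, y) = ∑ i, f_i(x_i) + Φ(x, y) - h(y)`. -/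
def lagr {m : ℕ} {n : Fin m → ℕ} {Y : Type*}
    (f : (i : Fin m) → EuclideanSpace ℝ (Fin (n i)) → EReal) (Φ : Primal n → Y → ℝ)
    (h : Y → EReal) (x : Primal n) (y : Y) : EReal :=
  (∑ i, f i (x i)) + (Φ x y : EReal) - h y

/-- `(xs, ys)` is a saddle point of `min_x max_y L(x, y)`. -/
def IsSaddle {m : ℕ} {n : Fin m → ℕ} {Y : Type*}
    (f : (i : Fin m) → EuclideanSpace ℝ (Fin (n i)) → EReal) (Φ : Primal n → Y → ℝ)
    (h : Y → EReal) (xs : Primal n) (ys : Y) : Prop :=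
  (∀ y, lagr f Φ h xs y ≤ lagr f Φ h xs ys) ∧ (∀ x, lagr f Φ h xs ys ≤ lagr f Φ h x ys)

/-- The partial gradient `∇_{x_i} Φ(x, y)`, an element of the dual of the `i`-th block.
`Pi.single i v` is the vector `U_i v`, with `v` in block `i` and zeros elsewhere. -/
def gradX {m : ℕ} {n : Fin m → ℕ} {Y : Type*} (Φ : Primal n → Y → ℝ) (i : Fin m)
    (x : Primal n) (y : Y) : EuclideanSpace ℝ (Fin (n i)) →L[ℝ] ℝ :=
  fderiv ℝ (fun v : EuclideanSpace ℝ (Fin (n i)) => Φ (x + Pi.single i v) y) 0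

/-- The partial gradient `∇_y Φ(x, y)`, an element of the dual of `Y` (with the dual norm). -/
def gradY {m : ℕ} {n : Fin m → ℕ} {Y : Type*} [NormedAddCommGroup Y] [NormedSpace ℝ Y]
    (Φ : Primal n → Y → ℝ) (x : Primal n) (y : Y) : Y →L[ℝ] ℝ :=
  fderiv ℝ (fun w : Y => Φ x w) y

/-- The Bregman distance of `φ`. -/
def breg {Y : Type*} [NormedAddCommGroup Y] [NormedSpace ℝ Y] (φ : Y → ℝ) (y z : Y) : ℝ :=
  φ y - φ z - fderiv ℝ φ z (y - z)

/-- Standing assumptions on the saddle point problem and on the distance generating function `φ`,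
which is differentiable on the open set `U` containing the domain of `h`. -/
structure Problem {m : ℕ} {n : Fin m → ℕ} {Y : Type*} [NormedAddCommGroup Y] [NormedSpace ℝ Y]
    (f : (i : Fin m) → EuclideanSpace ℝ (Fin (n i)) → EReal) (Φ : Primal n → Y → ℝ)
    (h : Y → EReal) (φ : Y → ℝ) (U : Set Y)
    (μ Lxx Lyx : Fin m → ℝ) (Lyy : ℝ) : Prop where
  μ_nonneg : ∀ i, 0 ≤ μ i
  f_convex : ∀ i, ClosedConvex (μ i) (f i)
  h_convex : ClosedConvex 0 h
  Lxx_nonneg : ∀ i, 0 ≤ Lxx i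
  Lyy_nonneg : 0 ≤ Lyy
  Lyx_pos : ∀ i, 0 < Lyx i
  Φ_convex : ∀ y, ConvexOn ℝ univ fun x => Φ x y
  Φ_diff_x : ∀ y, Differentiable ℝ fun x => Φ x y
  Φ_lip_x : ∀ (y : Y) (i : Fin m) (x : Primal n) (v : EuclideanSpace ℝ (Fin (n i))),
    ‖gradX Φ i (x + Pi.single i v) y - gradX Φ i x y‖ ≤ Lxx i * ‖v‖
  Φ_concave : ∀ x, ConcaveOn ℝ univ fun y => Φ x y
  Φ_diff_y : ∀ x, Differentiable ℝ fun y => Φ x y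
  Φ_lip_y : ∀ (x : Primal n) (i : Fin m) (v : EuclideanSpace ℝ (Fin (n i))) (y y' : Y),
    ‖gradY Φ (x + Pi.single i v) y' - gradY Φ x y‖ ≤ Lyy * ‖y - y'‖ + Lyx i * ‖v‖
  U_open : IsOpen U
  dom_h : ∀ y, h y ≠ ⊤ → y ∈ U
  φ_diff : DifferentiableOn ℝ φ U
  φ_convex : StrongConvexOn univ 1 φ

/-- The random block indices: independent and uniform on `{1, …, m}`. -/
structure UniformBlocks {m : ℕ} {Ω : Type*} [MeasurableSpace Ω] (P : Measure Ω)
    (I : ℕ → Ω → Fin m) : Prop where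
  meas : ∀ k, Measurable (I k)
  indep : iIndepFun I P
  unif : ∀ k i, P {ω | I k ω = i} = (m : ℝ≥0∞)⁻¹

/-- The direction
`s^k = ∇_yΦ(x^k, y^k) + m θ^k (∇_yΦ(x^k, y^k) - ∇_yΦ(x^{k-1}, y^{k-1}))`
as a function of the current and the previous iterates. -/
def momentum {m : ℕ} {n : Fin m → ℕ} {Y : Type*} [NormedAddCommGroup Y] [NormedSpace ℝ Y]
    (Φ : Primal n → Y → ℝ) (θ : ℝ) (x : Primal n) (y : Y) (xp : Primal n) (yp : Y) :
    Y →L[ℝ] ℝ :=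
  gradY Φ x y + ((m : ℝ) * θ) • (gradY Φ x y - gradY Φ xp yp)

/-- `(x^k, y^k)` is generated by the randomized accelerated primal-dual method from `(x0, y0)`, with
step sizes `τ_i^k`, `σ^k`, momentum parameters `θ^k` and block choices `I^k`. For `k = 0` the
truncated index `k - 1` is `0`, which is the initialization `(x^{-1}, y^{-1}) = (x^0, y^0)`. -/
structure Generated {m : ℕ} {n : Fin m → ℕ} {Y : Type*} [NormedAddCommGroup Y] [NormedSpace ℝ Y]
    {Ω : Type*}
    (f : (i : Fin m) → EuclideanSpace ℝ (Fin (n i)) → EReal) (Φ : Primal n → Y → ℝ)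
    (h : Y → EReal) (φ : Y → ℝ) (τ : ℕ → Fin m → ℝ) (σ θ : ℕ → ℝ)
    (I : ℕ → Ω → Fin m) (x0 : Primal n) (y0 : Y)
    (x : ℕ → Ω → Primal n) (y : ℕ → Ω → Y) : Prop where
  init_x : ∀ ω, x 0 ω = x0
  init_y : ∀ ω, y 0 ω = y0
  step_y : ∀ k ω, IsMinOn
    (fun w : Y => h w +
      ((-(momentum Φ (θ k) (x k ω) (y k ω) (x (k - 1) ω) (y (k - 1) ω)) (w - y k ω)
        + 1 / σ k * breg φ w (y k ω) : ℝ) : EReal)) univ (y (k + 1) ω)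
  step_x : ∀ k ω, IsMinOn
    (fun v : EuclideanSpace ℝ (Fin (n (I k ω))) => f (I k ω) v +
      ((gradX Φ (I k ω) (x k ω) (y (k + 1) ω) v
        + 1 / τ k (I k ω) * (1 / 2 * ‖v - x k ω (I k ω)‖ ^ 2) : ℝ) : EReal))
    univ (x (k + 1) ω (I k ω))
  keep_x : ∀ k ω i, i ≠ I k ω → x (k + 1) ω i = x k ω i

/-- The step-size condition, for convexity moduli `ν`. The convention `0² / 0 = 0`, and
`c / 0 = +∞` for `c > 0`, is the requirement that `β^{k+1} = 0` only if `Lyy = 0`. -/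
def StepCond {m : ℕ} (ν Lxx Lyx : Fin m → ℝ) (Lyy : ℝ)
    (τ : ℕ → Fin m → ℝ) (σ θ t : ℕ → ℝ) : Prop :=
  (∀ k i, 0 < τ k i) ∧ (∀ k, 0 < σ k) ∧ (∀ k, θ k ∈ Icc (1 - 1 / (m : ℝ)) 1) ∧
  θ 0 = 1 ∧ t 0 = 1 ∧
  (∃ α β : ℕ → ℝ, (∀ k, 0 < α k) ∧ (∀ k, 0 ≤ β k) ∧ (∀ k, β (k + 1) = 0 → Lyy = 0) ∧
    (∀ k i, Lxx i + Lyx i ^ 2 / α (k + 1) ≤ 1 / τ k i) ∧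
    (∀ k, (m : ℝ) * θ k * (α k + β k) + (m : ℝ) * Lyy ^ 2 / β (k + 1) ≤ 1 / σ k)) ∧
  (∀ k i, t (k + 1) * (1 / τ (k + 1) i + (1 - 1 / (m : ℝ)) * ν i) ≤ t k * (1 / τ k i + ν i)) ∧
  (∀ k, t (k + 1) / σ (k + 1) ≤ t k / σ k) ∧
  (∀ k, t (k + 1) * θ (k + 1) = t k)

/-- The constant step sizes with parameters `α, cτ, cσ` (used with `θ^k = 1`). -/
def ConstSteps {m : ℕ} (Lxx Lyx : Fin m → ℝ) (Lyy α cτ cσ : ℝ)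
    (τ : ℕ → Fin m → ℝ) (σ : ℕ → ℝ) : Prop :=
  (∀ k i, τ k i = cτ * (Lxx i + Lyx i ^ 2 / α)⁻¹) ∧
  (∀ k, σ k = cσ * ((m : ℝ) * (α + 2 * Lyy))⁻¹)

/-- The adaptive step sizes with parameters `α, cσ`; `r` is the auxiliary sequence `τ̃^k` and
`t^{k+1} = t^k / θ^{k+1}`. -/
structure AdaptiveSteps {m : ℕ} (μ Lxx Lyx : Fin m → ℝ) (α cσ : ℝ)
    (r : ℕ → ℝ) (τ : ℕ → Fin m → ℝ) (σ θ t : ℕ → ℝ) : Prop where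
  r_zero : IsLeast
    (range fun i => μ i / m * (Lxx i + Lyx i ^ 2 / α + (1 - 1 / (m : ℝ)) * μ i)⁻¹) (r 0)
  σ_zero : σ 0 = cσ / ((m : ℝ) * α)
  θ_zero : θ 0 = 1
  t_zero : t 0 = 1
  τ_eq : ∀ k i, τ k i = (μ i / m * (1 + 1 / r k) - μ i)⁻¹
  θ_succ : ∀ k, θ (k + 1) = 1 / √(1 + r k)
  σ_succ : ∀ k, σ (k + 1) = σ k / θ (k + 1)
  r_succ : ∀ k, r (k + 1) = θ (k + 1) * r k
  t_succ : ∀ k, t (k + 1) = t k / θ (k + 1)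

/-- The ergodic average `(1/K) ∑_{k<K} z^{k+1}`. -/
def ergodic {E : Type*} [AddCommGroup E] [Module ℝ E] (z : ℕ → E) (K : ℕ) : E :=
  (1 / (K : ℝ)) • ∑ k ∈ Finset.range K, z (k + 1)

/-- The random variable `g` with extended real values is almost surely finite and integrable, with
expectation `e`. -/
def HasExpectation {Ω : Type*} [MeasurableSpace Ω] (P : Measure Ω) (g : Ω → EReal) (e : ℝ) :
    Prop :=
  ∃ r : Ω → ℝ, (∀ᵐ ω ∂P, g ω = (r ω : EReal)) ∧ Integrable r P ∧ ∫ ω, r ω ∂P = e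

/-- `½‖x* - x⁰‖²_{T⁰ + (1 - 1/m) diag(ν)} + (1/(m σ⁰) + (1 - 1/m) Lyy) D(y*, y⁰)
+ (1 - 1/m) (L(x⁰, y*) - L(x*, y*))`. With `ν = 0` this is the constant of the merely convex case,
with `ν = μ` and `Lyy = 0` that of the strongly convex case. -/
def Delta {m : ℕ} {n : Fin m → ℕ} {Y : Type*} [NormedAddCommGroup Y] [NormedSpace ℝ Y]
    (f : (i : Fin m) → EuclideanSpace ℝ (Fin (n i)) → EReal) (Φ : Primal n → Y → ℝ)
    (h : Y → EReal) (φ : Y → ℝ) (ν : Fin m → ℝ) (Lyy : ℝ) (τ0 : Fin m → ℝ) (σ0 : ℝ)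
    (xs : Primal n) (ys : Y) (x0 : Primal n) (y0 : Y) : ℝ :=
  1 / 2 * wsq (fun i => 1 / τ0 i + (1 - 1 / (m : ℝ)) * ν i) (xs - x0)
    + (1 / ((m : ℝ) * σ0) + (1 - 1 / (m : ℝ)) * Lyy) * breg φ ys y0
    + (1 - 1 / (m : ℝ)) * (lagr f Φ h x0 ys - lagr f Φ h xs ys).toReal

end

end RAPD

open RAPD

namespace RAPD

/-! ### First order inequalities -/

section FirstOrder

variable {E : Type*} [NormedAddCommGroup E] [NormedSpace ℝ E]

/-! Everything rests on one Lyapunov function, `pot`, taken relative to a reference point (u, w). It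
adds a weighted squared distance of x to u, the term D(w, y)/σ, the primal gap L(x, w) - L(u, w)
with weight m - 1, and mθ times a momentum part. The momentum part consists of the last gradient
difference applied to y - w, the concavity gap `defect` of Φ in y, and the energy `inertia` of the
last move, which keeps the sign-indefinite product under control.

Since one block out of m moves, summing a separable function over the m possible moves gives its
value at the full proximal point once and its old value m - 1 times (`sum_sum_update`); this is the
origin of the weight m - 1. Φ is not separable, but block-wise smoothness together with convexity
plays the same role (`Problem.primal_step`). The dual step contributes a Bregman three-point
inequality. The extrapolation factor mθ makes the cross terms telescope: the new gradient difference
appears m times in the sum over blocks, and t'θ' = t matches it with the old one. The remaining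
cross term, applied to y⁺ - y, is split by Young's inequality with α for the primal and β for the
dual move, and the step-size condition says exactly that the quadratic terms of the two proximal
steps pay for it. The outcome is the deterministic inequality `Problem.potential_decrease`, a sum
over all blocks.

The probability is finite: the k-th iterate is a function of the first k indices. Independence turns
the sum over blocks into an expectation (`Run.expected_decrease`), even against nonnegative weights
known before the draw, which is the supermartingale property. Summation yields all the rates at a
fixed saddle point. For the adaptive steps, the squares of t satisfy t'² = t² + r⁰t, so t grows
linearly while τ decays like 1/t.

Almost sure convergence is an Opial argument. With strict step sizes the moves vanish and cluster
points are saddle points (`IsSaddleR.of_tendsto`); the distances to a countable dense set of saddle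
points converge, hence the whole path does.

At the random limit the expectation argument fails, because the limit depends on all the draws.
Instead the inequality is used along a path with an explicit error `noise`. The reference point
enters this error only linearly through u (`noise_sub`), so it separates into the mean-zero error at
a fixed saddle point and the product of u with a sum of uncorrelated vectors, whose second moment is
bounded by the total dissipation. -/

lemma tendsto_slope_of_fderiv {φ : E → ℝ} {z : E} (hd : DifferentiableAt ℝ φ z) (v : E) :
    Tendsto (fun t : ℝ => t⁻¹ * (φ (z + t • v) - φ z)) (𝓝[>] 0) (𝓝 (fderiv ℝ φ z v)) := by
  have := (hd.hasFDerivAt.hasLineDerivAt v).tendsto_slope_zero_right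
  simpa [smul_eq_mul] using this

/-- On the segment from z to w, strong convexity bounds the difference quotient at z by the
increment minus (1 - t) times the quadratic term; then t → 0. The case c = 0 is the tangent
inequality. -/
lemma add_fderiv_add_le_of_strongConvex {φ : E → ℝ} {c : ℝ} {z w : E}
    (hφ : ∀ a b : ℝ, 0 ≤ a → 0 ≤ b → a + b = 1 →
      φ (a • z + b • w) ≤ a * φ z + b * φ w - a * b * (c / 2 * ‖z - w‖ ^ 2))
    (hd : DifferentiableAt ℝ φ z) :
    φ z + fderiv ℝ φ z (w - z) + c / 2 * ‖w - z‖ ^ 2 ≤ φ w := by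
  have h1 := tendsto_slope_of_fderiv hd (w - z)
  have h2 : Tendsto (fun t : ℝ => φ w - φ z - (1 - t) * (c / 2 * ‖z - w‖ ^ 2)) (𝓝[>] 0)
      (𝓝 (φ w - φ z - (1 - 0) * (c / 2 * ‖z - w‖ ^ 2))) := by
    apply Tendsto.mono_left _ nhdsWithin_le_nhds
    apply Continuous.tendsto
    fun_prop
  have h3 := le_of_tendsto_of_tendsto h1 h2 (by
    filter_upwards [Ioo_mem_nhdsGT (show (0 : ℝ) < 1 by norm_num)] with t ht
    have := hφ (1 - t) t (by linarith [ht.2]) ht.1.le (by ring)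
    have e : z + t • (w - z) = (1 - t) • z + t • w := by
      simp only [smul_sub, sub_smul, one_smul]; abel
    rw [e, inv_mul_le_iff₀ ht.1]
    linarith)
  rw [norm_sub_rev] at h3
  linarith

lemma ConvexOn.add_fderiv_le {φ : E → ℝ} (hφ : ConvexOn ℝ univ φ) {z : E}
    (hd : DifferentiableAt ℝ φ z) (w : E) : φ z + fderiv ℝ φ z (w - z) ≤ φ w := by
  have := add_fderiv_add_le_of_strongConvex (φ := φ) (c := 0) (z := z) (w := w) (by
    intro a b ha hb hab
    have := hφ.2 (mem_univ z) (mem_univ w) ha hb hab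
    simp only [smul_eq_mul] at this
    linarith) hd
  linarith

lemma ConcaveOn.le_add_fderiv {φ : E → ℝ} (hφ : ConcaveOn ℝ univ φ) {z : E}
    (hd : DifferentiableAt ℝ φ z) (w : E) : φ w ≤ φ z + fderiv ℝ φ z (w - z) := by
  have := ConvexOn.add_fderiv_le (φ := -φ) hφ.neg hd.neg w
  rw [fderiv_neg] at this
  simp only [Pi.neg_apply, neg_apply] at this
  linarith

/-- Along the segment the left side minus the right side has nonpositive derivative. Only the
derivative in the direction v is tested, which is all that a block-wise Lipschitz condition offers.
-/
lemma le_quadratic_of_fderiv_lipschitz {g : E → ℝ} (hg : Differentiable ℝ g) {u v : E} {L : ℝ}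
    (hL : ∀ s : ℝ, 0 ≤ s → s ≤ 1 →
      fderiv ℝ g (u + s • v) v - fderiv ℝ g u v ≤ L * s * ‖v‖ ^ 2) :
    g (u + v) ≤ g u + fderiv ℝ g u v + L / 2 * ‖v‖ ^ 2 := by
  have hder : ∀ s : ℝ, HasDerivAt
      (fun s : ℝ => g (u + s • v) - s * fderiv ℝ g u v - L / 2 * s ^ 2 * ‖v‖ ^ 2)
      (fderiv ℝ g (u + s • v) v - fderiv ℝ g u v - L * s * ‖v‖ ^ 2) s := by
    intro s
    have hc : HasDerivAt (fun s : ℝ => u + s • v) v s := by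
      simpa using ((hasDerivAt_id s).smul_const v).const_add u
    have h1 := (hg (u + s • v)).hasFDerivAt.comp_hasDerivAt s hc
    have h2 := (hasDerivAt_id s).mul_const (fderiv ℝ g u v)
    have h3 := (((hasDerivAt_id s).pow 2).const_mul (L / 2)).mul_const (‖v‖ ^ 2)
    refine ((h1.sub h2).sub h3).congr_deriv ?_
    simp
    left
    ring
  have hanti := antitoneOn_of_deriv_nonpos (convex_Icc (0 : ℝ) 1)
    (fun s _ => (hder s).continuousAt.continuousWithinAt)
    (fun s _ => (hder s).differentiableAt.differentiableWithinAt)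
    (fun s hs => by
      rw [interior_Icc] at hs
      rw [(hder s).deriv]
      linarith [hL s hs.1.le hs.2.le])
  have := hanti (left_mem_Icc.2 zero_le_one) (right_mem_Icc.2 zero_le_one) zero_le_one
  simp at this
  linarith

end FirstOrder

/-! ### Closed convex functions with extended values -/

section Convex

variable {E : Type*} [NormedAddCommGroup E] [NormedSpace ℝ E] {μ : ℝ} {f : E → EReal}

lemma ClosedConvex.coe_toReal (hf : ClosedConvex μ f) {x : E} (hx : f x ≠ ⊤) :
    ((f x).toReal : EReal) = f x := EReal.coe_toReal hx (hf.ne_bot x)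

lemma ClosedConvex.combo (hf : ClosedConvex μ f) {x y : E} (hx : f x ≠ ⊤) (hy : f y ≠ ⊤)
    {a b : ℝ} (ha : 0 ≤ a) (hb : 0 ≤ b) (hab : a + b = 1) :
    f (a • x + b • y) ≠ ⊤ ∧
    (f (a • x + b • y)).toReal + μ / 2 * (a * b) * ‖x - y‖ ^ 2
      ≤ a * (f x).toReal + b * (f y).toReal := by
  have h := hf.convex x y a b ha hb hab
  rw [← hf.coe_toReal hx, ← hf.coe_toReal hy] at h
  have hne : f (a • x + b • y) ≠ ⊤ := by
    intro htop
    rw [htop] at h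
    rw [EReal.top_add_coe] at h
    exact absurd (top_le_iff.1 h) (by
      rw [← EReal.coe_mul, ← EReal.coe_mul, ← EReal.coe_add]; exact EReal.coe_ne_top _)
  refine ⟨hne, ?_⟩
  rw [← hf.coe_toReal hne] at h
  exact_mod_cast h

lemma ClosedConvex.toReal_convexOn (hf : ClosedConvex μ f) (hμ : 0 ≤ μ) :
    ConvexOn ℝ {x | f x ≠ ⊤} fun x => (f x).toReal := by
  refine ⟨fun x hx y hy a b ha hb hab => (hf.combo hx hy ha hb hab).1,
    fun x hx y hy a b ha hb hab => ?_⟩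
  have := (hf.combo hx hy ha hb hab).2
  have h2 : 0 ≤ μ / 2 * (a * b) * ‖x - y‖ ^ 2 := by positivity
  simp only [smul_eq_mul]
  linarith

/-- A minimizer of the sum of a proper function and a finite function lies in the domain. -/
lemma ClosedConvex.isMinOn_add (hf : ClosedConvex μ f) {q : E → ℝ} {p : E}
    (hp : IsMinOn (fun v => f v + (q v : EReal)) univ p) :
    f p ≠ ⊤ ∧ ∀ w, f w ≠ ⊤ → (f p).toReal + q p ≤ (f w).toReal + q w := by
  have hp' : ∀ w, f p + (q p : EReal) ≤ f w + (q w : EReal) := fun w => hp (mem_univ w)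
  have hne : f p ≠ ⊤ := by
    intro htop
    obtain ⟨w, hw⟩ := hf.proper
    have := hp' w
    rw [htop, EReal.top_add_coe, ← hf.coe_toReal hw, ← EReal.coe_add] at this
    exact EReal.coe_ne_top _ (top_le_iff.1 this)
  refine ⟨hne, fun w hw => ?_⟩
  have := hp' w
  rw [← hf.coe_toReal hw, ← hf.coe_toReal hne] at this
  exact_mod_cast this

/-- Removes the factor 1 - t that strong convexity leaves behind after division by t. -/
lemma le_of_forall_mem_Ioo {A B : ℝ} (h : ∀ t ∈ Ioo (0 : ℝ) 1, (1 - t) * A ≤ B) : A ≤ B := by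
  have h1 : Tendsto (fun t : ℝ => (1 - t) * A) (𝓝[>] 0) (𝓝 ((1 - 0) * A)) := by
    apply Tendsto.mono_left _ nhdsWithin_le_nhds
    apply Continuous.tendsto
    fun_prop
  have := le_of_tendsto h1 (by
    filter_upwards [Ioo_mem_nhdsGT (show (0 : ℝ) < 1 by norm_num)] with t ht using h t ht)
  simpa using this

end Convex

/-- The objective of a proximal step. -/
noncomputable def proxObj {E : Type*} [NormedAddCommGroup E] [NormedSpace ℝ E]
    (f : E → EReal) (g : E →L[ℝ] ℝ) (τ : ℝ) (x : E) (v : E) : EReal :=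
  f v + ((g v + 1 / τ * (1 / 2 * ‖v - x‖ ^ 2) : ℝ) : EReal)

section Prox

variable {E : Type*} [NormedAddCommGroup E] [InnerProductSpace ℝ E] {μ : ℝ} {f : E → EReal}

lemma norm_combo_sq (a b : E) (t : ℝ) : ‖(1 - t) • a + t • b‖ ^ 2
    = (1 - t) * ‖a‖ ^ 2 + t * ‖b‖ ^ 2 - t * (1 - t) * ‖a - b‖ ^ 2 := by
  rw [norm_add_sq_real, norm_sub_sq_real, norm_smul, norm_smul, inner_smul_left, inner_smul_right,
    mul_pow, mul_pow, Real.norm_eq_abs, Real.norm_eq_abs, sq_abs, sq_abs]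
  simp
  ring

/-- Minimality is tested at (1 - t)p + tw. The modulus μ of f and the modulus 1/τ of the quadratic
add up, and division by t followed by t → 0 gives the claim without subgradients. -/
lemma prox_inequality (hf : ClosedConvex μ f) {g : E →L[ℝ] ℝ} {τ : ℝ}
    {x p : E} (hp : IsMinOn (proxObj f g τ x) univ p) :
    f p ≠ ⊤ ∧ ∀ w, f w ≠ ⊤ →
      (f p).toReal + g p + 1 / (2 * τ) * ‖p - x‖ ^ 2 + (1 / (2 * τ) + μ / 2) * ‖w - p‖ ^ 2
        ≤ (f w).toReal + g w + 1 / (2 * τ) * ‖w - x‖ ^ 2 := by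
  obtain ⟨h1, h2⟩ := hf.isMinOn_add hp
  refine ⟨h1, fun w hw => ?_⟩
  suffices hs : (1 / (2 * τ) + μ / 2) * ‖w - p‖ ^ 2 ≤ (f w).toReal + g w
      + 1 / (2 * τ) * ‖w - x‖ ^ 2 - ((f p).toReal + g p + 1 / (2 * τ) * ‖p - x‖ ^ 2) by linarith
  apply le_of_forall_mem_Ioo
  intro t ht
  obtain ⟨h3, h4⟩ := hf.combo h1 hw (a := 1 - t) (b := t) (by linarith [ht.2]) ht.1.le (by ring)
  have h5 := h2 _ h3
  have h6 : (1 - t) • p + t • w - x = (1 - t) • (p - x) + t • (w - x) := by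
    simp only [smul_sub, sub_smul, one_smul]; abel
  rw [h6, norm_combo_sq, show p - x - (w - x) = p - w by abel, map_add, map_smul, map_smul] at h5
  simp only [smul_eq_mul] at h5
  rw [norm_sub_rev w p]
  have h7 : 1 / (2 * τ) = 1 / τ * (1 / 2) := by rw [one_div_mul_one_div, mul_comm]
  rw [h7]
  have h8 : t * ((1 - t) * ((1 / τ * (1 / 2) + μ / 2) * ‖p - w‖ ^ 2)) ≤ t * ((f w).toReal + g w
      + 1 / τ * (1 / 2) * ‖w - x‖ ^ 2 - ((f p).toReal + g p + 1 / τ * (1 / 2) * ‖p - x‖ ^ 2)) := by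
    linarith
  exact le_of_mul_le_mul_left h8 ht.1

/-- Uniqueness, here and for the Bregman step, is what makes the iterates functions of the drawn
indices. -/
lemma prox_unique (hf : ClosedConvex μ f) (hμ : 0 ≤ μ) {g : E →L[ℝ] ℝ} {τ : ℝ} (hτ : 0 < τ)
    {x p p' : E} (hp : IsMinOn (proxObj f g τ x) univ p)
    (hp' : IsMinOn (proxObj f g τ x) univ p') : p = p' := by
  obtain ⟨h1, h2⟩ := prox_inequality hf hp
  obtain ⟨h3, h4⟩ := prox_inequality hf hp'
  have h5 := h2 p' h3
  have h6 := h4 p h1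
  rw [norm_sub_rev p p'] at h6
  have hc : 0 < 1 / (2 * τ) + μ / 2 := by positivity
  have h7 : (1 / (2 * τ) + μ / 2) * ‖p' - p‖ ^ 2 ≤ 0 := by linarith
  have h8 : ‖p' - p‖ ^ 2 ≤ 0 := by
    by_contra hcon
    push Not at hcon
    nlinarith [mul_pos hc hcon]
  have h9 : ‖p' - p‖ = 0 := by nlinarith [norm_nonneg (p' - p)]
  exact (sub_eq_zero.1 (norm_eq_zero.1 h9)).symm

end Prox

/-! ### Bregman distances -/

section Bregman

variable {Y : Type*} [NormedAddCommGroup Y] [NormedSpace ℝ Y] {φ : Y → ℝ} {U : Set Y}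

/-- The objective of a Bregman proximal step. -/
noncomputable def bregObj (h : Y → EReal) (φ : Y → ℝ) (s : Y →L[ℝ] ℝ) (σ : ℝ) (z : Y) (w : Y) :
    EReal :=
  h w + ((-s (w - z) + 1 / σ * breg φ w z : ℝ) : EReal)

@[simp] lemma breg_self (z : Y) : breg φ z z = 0 := by simp [breg]

lemma half_sq_le_breg (hφ : StrongConvexOn univ 1 φ) {z : Y} (hd : DifferentiableAt ℝ φ z)
    (w : Y) : 1 / 2 * ‖w - z‖ ^ 2 ≤ breg φ w z := by
  have := add_fderiv_add_le_of_strongConvex (c := 1) (w := w) (fun a b ha hb hab => by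
    have := hφ.2 (mem_univ z) (mem_univ w) ha hb hab
    simpa [smul_eq_mul] using this) hd
  unfold breg
  linarith

lemma breg_nonneg (hφ : StrongConvexOn univ 1 φ) {z : Y} (hd : DifferentiableAt ℝ φ z)
    (w : Y) : 0 ≤ breg φ w z := le_trans (by positivity) (half_sq_le_breg hφ hd w)

/-- Minimality of p is compared with points of the segment towards w, and the slope of φ at p
appears in the limit. Differentiability is needed at p only; the derivative at z enters as a fixed
linear functional. -/
lemma bregman_prox_inequality {h : Y → EReal} (hh : ClosedConvex 0 h) {s : Y →L[ℝ] ℝ}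
    {σ : ℝ} {z p : Y} (hp : IsMinOn (bregObj h φ s σ z) univ p)
    (hd : h p ≠ ⊤ → DifferentiableAt ℝ φ p) :
    h p ≠ ⊤ ∧ ∀ w, h w ≠ ⊤ →
      (h p).toReal + s (w - p) + 1 / σ * (breg φ p z + breg φ w p - breg φ w z)
        ≤ (h w).toReal := by
  obtain ⟨h1, h2⟩ := hh.isMinOn_add hp
  refine ⟨h1, fun w hw => ?_⟩
  have hd := hd h1
  -- The three-point identity: all values of φ cancel.
  have key : breg φ p z + breg φ w p - breg φ w z
      = fderiv ℝ φ z (w - p) - fderiv ℝ φ p (w - p) := by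
    unfold breg
    have : fderiv ℝ φ z (w - z) = fderiv ℝ φ z (w - p) + fderiv ℝ φ z (p - z) := by
      rw [← map_add]; congr 1; abel
    linarith
  rw [key]
  have hl : Tendsto (fun t : ℝ => (h w).toReal - (h p).toReal - s (w - p)
      + 1 / σ * (t⁻¹ * (φ (p + t • (w - p)) - φ p) - fderiv ℝ φ z (w - p))) (𝓝[>] 0)
      (𝓝 ((h w).toReal - (h p).toReal - s (w - p)
      + 1 / σ * (fderiv ℝ φ p (w - p) - fderiv ℝ φ z (w - p)))) :=
    (((tendsto_slope_of_fderiv hd (w - p)).sub_const _).const_mul _).const_add _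
  have := ge_of_tendsto hl (b := 0) (by
    filter_upwards [Ioo_mem_nhdsGT (show (0 : ℝ) < 1 by norm_num)] with t ht
    have e : (1 - t) • p + t • w = p + t • (w - p) := by
      simp only [smul_sub, sub_smul, one_smul]; abel
    obtain ⟨h3, h4⟩ := hh.combo h1 hw (a := 1 - t) (b := t) (by linarith [ht.2]) ht.1.le (by ring)
    have h5 := h2 _ h3
    rw [e] at h4 h5
    simp only [breg] at h5
    have e2 : p + t • (w - p) - z = (p - z) + t • (w - p) := by abel
    rw [e2, map_add, map_smul, map_add, map_smul] at h5
    simp only [smul_eq_mul] at h5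
    have h6 : 0 ≤ t * ((h w).toReal - (h p).toReal - s (w - p)
      + 1 / σ * (t⁻¹ * (φ (p + t • (w - p)) - φ p) - fderiv ℝ φ z (w - p))) := by
      have : t * (1 / σ * (t⁻¹ * (φ (p + t • (w - p)) - φ p) - fderiv ℝ φ z (w - p)))
          = 1 / σ * ((φ (p + t • (w - p)) - φ p) - t * fderiv ℝ φ z (w - p)) := by
        have := ht.1.ne'
        field_simp
      rw [mul_add, this]
      linarith
    exact (mul_nonneg_iff_of_pos_left ht.1).1 h6)
  linarith

lemma bregman_prox_unique {h : Y → EReal} (hh : ClosedConvex 0 h) (hφ : StrongConvexOn univ 1 φ)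
    {s : Y →L[ℝ] ℝ} {σ : ℝ} (hσ : 0 < σ) {z p p' : Y}
    (hd : ∀ y, h y ≠ ⊤ → DifferentiableAt ℝ φ y)
    (hp : IsMinOn (bregObj h φ s σ z) univ p) (hp' : IsMinOn (bregObj h φ s σ z) univ p') :
    p = p' := by
  obtain ⟨h1, h2⟩ := bregman_prox_inequality hh hp (hd _)
  obtain ⟨h3, h4⟩ := bregman_prox_inequality hh hp' (hd _)
  have h5 := h2 p' h3
  have h6 := h4 p h1
  have h7 : s (p' - p) = - s (p - p') := by rw [← map_neg]; congr 1; abel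
  have hb := half_sq_le_breg hφ (hd _ h1) p'
  have hb' := half_sq_le_breg hφ (hd _ h3) p
  have h8 : 1 / σ * (breg φ p' p + breg φ p p') ≤ 0 := by
    rw [h7] at h5
    have : 1 / σ * (breg φ p' p + breg φ p p') = 1 / σ * (breg φ p z + breg φ p' p - breg φ p' z)
      + 1 / σ * (breg φ p' z + breg φ p p' - breg φ p z) := by ring
    linarith
  have h9 : breg φ p' p + breg φ p p' ≤ 0 := by
    by_contra hcon
    push Not at hcon
    have : 0 < 1 / σ * (breg φ p' p + breg φ p p') := by positivity
    linarith
  have h10 : ‖p' - p‖ ^ 2 ≤ 0 := by nlinarith [sq_nonneg ‖p - p'‖]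
  have h11 : ‖p' - p‖ = 0 := by nlinarith [norm_nonneg (p' - p)]
  exact (sub_eq_zero.1 (norm_eq_zero.1 h11)).symm

/-- The Bregman distance of a finite convex function is continuous in its second argument along
sequences of points of differentiability. -/
lemma tendsto_breg [FiniteDimensional ℝ Y] (hφ : ConvexOn ℝ univ φ) {z : ℕ → Y} {a : Y}
    (hz : Tendsto z atTop (𝓝 a)) (hzd : ∀ k, DifferentiableAt ℝ φ (z k))
    (had : DifferentiableAt ℝ φ a) (w : Y) :
    Tendsto (fun k => breg φ w (z k)) atTop (𝓝 (breg φ w a)) := by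
  have hcont : Continuous φ := hφ.locallyLipschitz.continuous
  -- Upper semicontinuity of the derivative: it lies below the slope over a fixed step t, and slopes
  -- over a fixed step are continuous in the base point and the direction.
  have hup : ∀ (v : ℕ → Y) (b : Y), Tendsto v atTop (𝓝 b) → ∀ ε > 0,
      ∀ᶠ k in atTop, fderiv ℝ φ (z k) (v k) < fderiv ℝ φ a b + ε := by
    intro v b hv ε hε
    have h1 := (tendsto_slope_of_fderiv had b).eventually
      (gt_mem_nhds (show fderiv ℝ φ a b < fderiv ℝ φ a b + ε by linarith))
    obtain ⟨t, ht, ht0⟩ := (h1.and self_mem_nhdsWithin).exists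
    have ht0 : 0 < t := ht0
    have h2 : Tendsto (fun k => t⁻¹ * (φ (z k + t • v k) - φ (z k))) atTop
        (𝓝 (t⁻¹ * (φ (a + t • b) - φ a))) := by
      apply Tendsto.const_mul
      apply Tendsto.sub
      · exact (hcont.tendsto _).comp (hz.add (hv.const_smul t))
      · exact (hcont.tendsto _).comp hz
    filter_upwards [h2.eventually (gt_mem_nhds ht)] with k hk
    refine lt_of_le_of_lt ?_ hk
    have := ConvexOn.add_fderiv_le hφ (hzd k) (z k + t • v k)
    rw [add_sub_cancel_left, map_smul, smul_eq_mul] at this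
    rw [le_inv_mul_iff₀ ht0]
    linarith
  have hlim : Tendsto (fun k => fderiv ℝ φ (z k) (w - z k)) atTop
      (𝓝 (fderiv ℝ φ a (w - a))) := by
    rw [Metric.tendsto_atTop']
    intro ε hε
    have hwz : Tendsto (fun k => w - z k) atTop (𝓝 (w - a)) := hz.const_sub w
    have h1 := hup _ _ hwz ε hε
    -- The opposite direction turns the upper bound into a lower one.
    have h2 := hup _ _ hwz.neg ε hε
    obtain ⟨N, hN⟩ := eventually_atTop.1 (h1.and h2)
    refine ⟨N, fun k hk => ?_⟩
    obtain ⟨h3, h4⟩ := hN k hk.le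
    rw [map_neg, map_neg] at h4
    rw [Real.dist_eq, abs_lt]
    constructor <;> linarith
  unfold breg
  exact (tendsto_const_nhds.sub ((hcont.tendsto _).comp hz)).sub hlim

end Bregman

/-! ### The coupling function -/

section Coupling

variable {m : ℕ} {n : Fin m → ℕ} {Y : Type*} [NormedAddCommGroup Y] [NormedSpace ℝ Y]
  {f : (i : Fin m) → EuclideanSpace ℝ (Fin (n i)) → EReal} {Φ : Primal n → Y → ℝ}
  {h : Y → EReal} {φ : Y → ℝ} {U : Set Y} {μ Lxx Lyx : Fin m → ℝ} {Lyy : ℝ}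

lemma update_eq_add_single (x : Primal n) (i : Fin m) (z : EuclideanSpace ℝ (Fin (n i))) :
    Function.update x i z = x + Pi.single i (z - x i) := by
  funext j
  rcases eq_or_ne j i with rfl | hj
  · simp
  · simp [hj]

lemma hasFDerivAt_block {g : Primal n → ℝ} (hg : Differentiable ℝ g) (x : Primal n) (i : Fin m)
    (a : EuclideanSpace ℝ (Fin (n i))) :
    HasFDerivAt (fun v : EuclideanSpace ℝ (Fin (n i)) => g (x + Pi.single i v))
      ((fderiv ℝ g (x + Pi.single i a)).comp
        (ContinuousLinearMap.single ℝ (fun j => EuclideanSpace ℝ (Fin (n j))) i)) a := by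
  have h1 : HasFDerivAt (fun v : EuclideanSpace ℝ (Fin (n i)) => x + (Pi.single i v : Primal n))
      (ContinuousLinearMap.single ℝ (fun j => EuclideanSpace ℝ (Fin (n j))) i) a :=
    (ContinuousLinearMap.single ℝ (fun j => EuclideanSpace ℝ (Fin (n j))) i).hasFDerivAt.const_add x
  exact (hg _).hasFDerivAt.comp a h1

lemma gradX_apply {y : Y} (hΦ : Differentiable ℝ fun x => Φ x y) (x : Primal n) (i : Fin m)
    (v : EuclideanSpace ℝ (Fin (n i))) :
    gradX Φ i x y v = fderiv ℝ (fun x => Φ x y) x (Pi.single i v) := by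
  unfold gradX
  rw [(hasFDerivAt_block hΦ x i 0).fderiv]
  simp

lemma Problem.φ_diffAt (hp : Problem f Φ h φ U μ Lxx Lyx Lyy) {y : Y} (hy : y ∈ U) :
    DifferentiableAt ℝ φ y := (hp.φ_diff y hy).differentiableAt (hp.U_open.mem_nhds hy)

lemma Problem.φ_convexOn (hp : Problem f Φ h φ U μ Lxx Lyx Lyy) : ConvexOn ℝ univ φ := by
  refine ⟨convex_univ, fun x hx y hy a b ha hb hab => ?_⟩
  have := hp.φ_convex.2 hx hy ha hb hab
  have h2 : 0 ≤ a * b * (1 / 2 * ‖x - y‖ ^ 2) := by positivity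
  exact this.trans (by linarith)

lemma Problem.half_sq_le_breg (hp : Problem f Φ h φ U μ Lxx Lyx Lyy) {y : Y} (hy : y ∈ U) (w : Y) :
    1 / 2 * ‖w - y‖ ^ 2 ≤ breg φ w y := RAPD.half_sq_le_breg hp.φ_convex (hp.φ_diffAt hy) w

lemma Problem.breg_nonneg (hp : Problem f Φ h φ U μ Lxx Lyx Lyy) {y : Y} (hy : y ∈ U) (w : Y) :
    0 ≤ breg φ w y := RAPD.breg_nonneg hp.φ_convex (hp.φ_diffAt hy) w

lemma Problem.add_gradX_le (hp : Problem f Φ h φ U μ Lxx Lyx Lyy) (x u : Primal n) (y : Y) :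
    Φ x y + ∑ i, gradX Φ i x y (u i - x i) ≤ Φ u y := by
  have h1 := ConvexOn.add_fderiv_le (hp.Φ_convex y) (hp.Φ_diff_x y x) u
  have h2 : u - x = ∑ i, Pi.single i (u i - x i) := (Finset.univ_sum_single (u - x)).symm
  rw [h2, map_sum] at h1
  simpa only [gradX_apply (hp.Φ_diff_x y)] using h1

lemma fderiv_block_eq_gradX {y : Y} (hΦ : Differentiable ℝ fun x => Φ x y) (x : Primal n)
    (i : Fin m) (a : EuclideanSpace ℝ (Fin (n i))) :
    fderiv ℝ (fun v : EuclideanSpace ℝ (Fin (n i)) => Φ (x + Pi.single i v) y) a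
      = gradX Φ i (x + Pi.single i a) y := by
  ext w
  rw [gradX_apply hΦ, (hasFDerivAt_block hΦ x i a).fderiv]
  rfl

lemma Problem.gradX_sub_le (hp : Problem f Φ h φ U μ Lxx Lyx Lyy) (x : Primal n) (y : Y)
    (i : Fin m) (v : EuclideanSpace ℝ (Fin (n i))) {s : ℝ} (hs : 0 ≤ s) :
    gradX Φ i (x + Pi.single i (s • v)) y v - gradX Φ i x y v ≤ Lxx i * s * ‖v‖ ^ 2 := by
  have h1 := ContinuousLinearMap.le_of_opNorm_le _ (hp.Φ_lip_x y i x (s • v)) v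
  rw [norm_smul, Real.norm_of_nonneg hs, sub_apply] at h1
  have h2 := (Real.le_norm_self _).trans h1
  linarith

lemma Problem.update_le (hp : Problem f Φ h φ U μ Lxx Lyx Lyy) (x : Primal n) (y : Y) (i : Fin m)
    (z : EuclideanSpace ℝ (Fin (n i))) :
    Φ (Function.update x i z) y
      ≤ Φ x y + gradX Φ i x y (z - x i) + Lxx i / 2 * ‖z - x i‖ ^ 2 := by
  rw [update_eq_add_single]
  generalize z - x i = v
  have hg : Differentiable ℝ fun v : EuclideanSpace ℝ (Fin (n i)) => Φ (x + Pi.single i v) y :=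
    fun a => (hasFDerivAt_block (hp.Φ_diff_x y) x i a).differentiableAt
  have := le_quadratic_of_fderiv_lipschitz hg (u := 0) (v := v) (L := Lxx i) (by
    intro s hs0 hs1
    rw [fderiv_block_eq_gradX (hp.Φ_diff_x y), fderiv_block_eq_gradX (hp.Φ_diff_x y), zero_add,
      Pi.single_zero, add_zero]
    exact hp.gradX_sub_le x y i v hs0)
  rw [fderiv_block_eq_gradX (hp.Φ_diff_x y), zero_add, Pi.single_zero, add_zero] at this
  exact this

lemma Problem.le_add_gradY (hp : Problem f Φ h φ U μ Lxx Lyx Lyy) (x : Primal n) (y w : Y) :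
    Φ x w ≤ Φ x y + gradY Φ x y (w - y) :=
  ConcaveOn.le_add_fderiv (hp.Φ_concave x) (hp.Φ_diff_y x y) w

lemma Problem.gradY_update (hp : Problem f Φ h φ U μ Lxx Lyx Lyy) (x : Primal n) (y y' : Y)
    (i : Fin m) (z : EuclideanSpace ℝ (Fin (n i))) :
    ‖gradY Φ (Function.update x i z) y' - gradY Φ x y‖
      ≤ Lyy * ‖y - y'‖ + Lyx i * ‖z - x i‖ := by
  rw [update_eq_add_single]
  exact hp.Φ_lip_y x i _ y y'

lemma Problem.gradY_lip_right [NeZero m] (hp : Problem f Φ h φ U μ Lxx Lyx Lyy) (x : Primal n)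
    (y y' : Y) : ‖gradY Φ x y' - gradY Φ x y‖ ≤ Lyy * ‖y - y'‖ := by
  -- A block move of length zero; a block exists because m ≠ 0.
  have := hp.gradY_update x y y' 0 (x 0)
  simpa using this

/-- Blocks are exchanged one at a time, since the hypothesis allows a move of a single block. The
change of y is made in the base case, so `Lyy` is paid once. -/
lemma Problem.gradY_lip [NeZero m] (hp : Problem f Φ h φ U μ Lxx Lyx Lyy) (x x' : Primal n)
    (y y' : Y) : ‖gradY Φ x' y' - gradY Φ x y‖ ≤ Lyy * ‖y - y'‖ + ∑ i, Lyx i * ‖x' i - x i‖ := by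
  classical
  have key : ∀ s : Finset (Fin m), ‖gradY Φ (fun i => if i ∈ s then x' i else x i) y'
      - gradY Φ x y‖ ≤ Lyy * ‖y - y'‖ + ∑ i ∈ s, Lyx i * ‖x' i - x i‖ := by
    intro s
    induction s using Finset.induction_on with
    | empty => simpa using hp.gradY_lip_right x y y'
    | insert a s ha ih =>
      rw [Finset.sum_insert ha]
      set X : Primal n := fun i => if i ∈ s then x' i else x i with hX
      have e : (fun i => if i ∈ insert a s then x' i else x i) = Function.update X a (x' a) := by
        funext j
        rcases eq_or_ne j a with rfl | hj
        · simp
        · simp [hj, hX]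
      rw [e]
      have h1 := hp.gradY_update X y' y' a (x' a)
      have h2 : X a = x a := by simp [hX, ha]
      rw [h2, sub_self, norm_zero, mul_zero, zero_add] at h1
      calc _ = ‖(gradY Φ (Function.update X a (x' a)) y' - gradY Φ X y')
            + (gradY Φ X y' - gradY Φ x y)‖ := by congr 1; abel
        _ ≤ _ := norm_add_le _ _
        _ ≤ _ := by linarith
  simpa using key Finset.univ

lemma Problem.sub_quadratic_le [NeZero m] (hp : Problem f Φ h φ U μ Lxx Lyx Lyy) (x : Primal n)
    (y w : Y) : Φ x y + gradY Φ x y (w - y) - Lyy / 2 * ‖w - y‖ ^ 2 ≤ Φ x w := by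
  have hg : Differentiable ℝ fun y => -Φ x y := (hp.Φ_diff_y x).neg
  have hf : ∀ a, fderiv ℝ (fun y => -Φ x y) a = - gradY Φ x a := fun a => by
    unfold gradY
    exact fderiv_fun_neg
  have := le_quadratic_of_fderiv_lipschitz hg (u := y) (v := w - y) (L := Lyy) (by
    intro s hs0 hs1
    rw [hf, hf]
    have h1 := hp.gradY_lip_right x (y + s • (w - y)) y
    rw [add_sub_cancel_left, norm_smul, Real.norm_of_nonneg hs0] at h1
    calc _ = (gradY Φ x y - gradY Φ x (y + s • (w - y))) (w - y) := by
          simp only [neg_apply, sub_apply]; ring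
      _ ≤ ‖(gradY Φ x y - gradY Φ x (y + s • (w - y))) (w - y)‖ := Real.le_norm_self _
      _ ≤ ‖gradY Φ x y - gradY Φ x (y + s • (w - y))‖ * ‖w - y‖ :=
        ContinuousLinearMap.le_opNorm _ _
      _ ≤ (Lyy * (s * ‖w - y‖)) * ‖w - y‖ := by gcongr
      _ = _ := by ring)
  rw [hf] at this
  simp only [neg_apply, add_sub_cancel] at this
  linarith

lemma Problem.continuous_gradY [NeZero m] (hp : Problem f Φ h φ U μ Lxx Lyx Lyy) :
    Continuous fun p : Primal n × Y => gradY Φ p.1 p.2 := by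
  rw [continuous_iff_continuousAt]
  rintro ⟨x, y⟩
  rw [ContinuousAt, tendsto_iff_norm_sub_tendsto_zero]
  have hb : Tendsto (fun p : Primal n × Y => Lyy * ‖y - p.2‖ + ∑ i, Lyx i * ‖p.1 i - x i‖)
      (𝓝 (x, y)) (𝓝 (Lyy * ‖y - y‖ + ∑ i, Lyx i * ‖x i - x i‖)) := by
    have : Continuous (fun p : Primal n × Y => Lyy * ‖y - p.2‖ + ∑ i, Lyx i * ‖p.1 i - x i‖) := by
      fun_prop
    exact this.tendsto (x, y)
  simp only [sub_self, norm_zero, mul_zero, Finset.sum_const_zero, add_zero] at hb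
  exact squeeze_zero (fun _ => norm_nonneg _) (fun p => hp.gradY_lip x p.1 y p.2) hb

/-- Concavity in y squeezes Φ(p₁, p₂) between Φ(p₁, y) plus two linear corrections, with the
gradient taken at p₂ and at y; both corrections vanish because the gradient is jointly continuous.
-/
lemma Problem.continuous_coupling [NeZero m] (hp : Problem f Φ h φ U μ Lxx Lyx Lyy) :
    Continuous fun p : Primal n × Y => Φ p.1 p.2 := by
  rw [continuous_iff_continuousAt]
  rintro ⟨x, y⟩
  have hg := hp.continuous_gradY
  have h0 : Tendsto (fun p : Primal n × Y => Φ p.1 y) (𝓝 (x, y)) (𝓝 (Φ x y)) :=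
    (((hp.Φ_diff_x y).continuous).comp continuous_fst).tendsto (x, y)
  have h1 : Tendsto (fun p : Primal n × Y => Φ p.1 y + gradY Φ p.1 p.2 (p.2 - y)) (𝓝 (x, y))
      (𝓝 (Φ x y)) := by
    have : Tendsto (fun p : Primal n × Y => gradY Φ p.1 p.2 (p.2 - y)) (𝓝 (x, y))
        (𝓝 (gradY Φ x y (y - y))) :=
      (hg.clm_apply (continuous_snd.sub continuous_const)).tendsto (x, y)
    simpa using h0.add this
  have h2 : Tendsto (fun p : Primal n × Y => Φ p.1 y + gradY Φ p.1 y (p.2 - y)) (𝓝 (x, y))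
      (𝓝 (Φ x y)) := by
    have hg' : Continuous fun p : Primal n × Y => gradY Φ p.1 y :=
      hg.comp (continuous_fst.prodMk continuous_const)
    have : Tendsto (fun p : Primal n × Y => gradY Φ p.1 y (p.2 - y)) (𝓝 (x, y))
        (𝓝 (gradY Φ x y (y - y))) :=
      (hg'.clm_apply (continuous_snd.sub continuous_const)).tendsto (x, y)
    simpa using h0.add this
  refine tendsto_of_tendsto_of_tendsto_of_le_of_le h1 h2 (fun p => ?_)
    (fun p => hp.le_add_gradY p.1 y p.2)
  have := hp.le_add_gradY p.1 p.2 y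
  have e : gradY Φ p.1 p.2 (y - p.2) = - gradY Φ p.1 p.2 (p.2 - y) := by
    rw [← map_neg, neg_sub]
  dsimp only
  linarith

end Coupling

/-! ### The Lagrangian as a real function -/

/-- The Lagrangian, with real values on the product of the domains. -/
noncomputable def lagrR {m : ℕ} {n : Fin m → ℕ} {Y : Type*}
    (f : (i : Fin m) → EuclideanSpace ℝ (Fin (n i)) → EReal) (Φ : Primal n → Y → ℝ)
    (h : Y → EReal) (x : Primal n) (y : Y) : ℝ :=
  (∑ i, (f i (x i)).toReal) + Φ x y - (h y).toReal

/-- Saddle points of the Lagrangian in terms of its real values. -/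
structure IsSaddleR {m : ℕ} {n : Fin m → ℕ} {Y : Type*}
    (f : (i : Fin m) → EuclideanSpace ℝ (Fin (n i)) → EReal) (Φ : Primal n → Y → ℝ)
    (h : Y → EReal) (u : Primal n) (w : Y) : Prop where
  dom_x : ∀ i, f i (u i) ≠ ⊤
  dom_y : h w ≠ ⊤
  le_left : ∀ y, h y ≠ ⊤ → lagrR f Φ h u y ≤ lagrR f Φ h u w
  le_right : ∀ x : Primal n, (∀ i, f i (x i) ≠ ⊤) → lagrR f Φ h u w ≤ lagrR f Φ h x w

section Lagrangian

variable {m : ℕ} {n : Fin m → ℕ} {Y : Type*} [NormedAddCommGroup Y] [NormedSpace ℝ Y]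
  {f : (i : Fin m) → EuclideanSpace ℝ (Fin (n i)) → EReal} {Φ : Primal n → Y → ℝ}
  {h : Y → EReal} {φ : Y → ℝ} {U : Set Y} {μ Lxx Lyx : Fin m → ℝ} {Lyy : ℝ}

lemma sum_ne_bot {ι : Type*} (s : Finset ι) {g : ι → EReal} (hg : ∀ i, g i ≠ ⊥) :
    ∑ i ∈ s, g i ≠ ⊥ := by
  classical
  induction s using Finset.induction_on with
  | empty => simp
  | insert a s ha ih =>
    rw [Finset.sum_insert ha]
    simp [EReal.add_eq_bot_iff, hg a, ih]

lemma sum_eq_top {ι : Type*} (s : Finset ι) {g : ι → EReal} (hg : ∀ i, g i ≠ ⊥) {a : ι}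
    (ha : a ∈ s) (hga : g a = ⊤) : ∑ i ∈ s, g i = ⊤ := by
  classical
  rw [← Finset.add_sum_erase s g ha, hga]
  exact EReal.top_add_of_ne_bot (sum_ne_bot _ hg)

lemma coe_sum_toReal {ι : Type*} (s : Finset ι) {g : ι → EReal} (hg : ∀ i, g i ≠ ⊥)
    (hg' : ∀ i, g i ≠ ⊤) : ((∑ i ∈ s, (g i).toReal : ℝ) : EReal) = ∑ i ∈ s, g i := by
  classical
  induction s using Finset.induction_on with
  | empty => simp
  | insert a s ha ih =>
    rw [Finset.sum_insert ha, Finset.sum_insert ha, EReal.coe_add, ih,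
      EReal.coe_toReal (hg' a) (hg a)]

lemma Problem.lagr_eq (hp : Problem f Φ h φ U μ Lxx Lyx Lyy) {x : Primal n} {y : Y}
    (hx : ∀ i, f i (x i) ≠ ⊤) (hy : h y ≠ ⊤) : lagr f Φ h x y = (lagrR f Φ h x y : EReal) := by
  unfold lagr lagrR
  rw [EReal.coe_sub, EReal.coe_add, coe_sum_toReal _ (fun i => (hp.f_convex i).ne_bot _) hx,
    hp.h_convex.coe_toReal hy]

lemma Problem.lagr_eq_top (hp : Problem f Φ h φ U μ Lxx Lyx Lyy) {x : Primal n} {y : Y}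
    {i : Fin m} (hx : f i (x i) = ⊤) (hy : h y ≠ ⊤) : lagr f Φ h x y = ⊤ := by
  unfold lagr
  rw [sum_eq_top _ (fun i => (hp.f_convex i).ne_bot _) (Finset.mem_univ i) hx, EReal.top_add_coe,
    ← hp.h_convex.coe_toReal hy, EReal.top_sub_coe]

/-- No condition on x is needed, because ⊤ - ⊤ = ⊥ in `EReal`. -/
lemma lagr_eq_bot {x : Primal n} {y : Y} (hy : h y = ⊤) : lagr f Φ h x y = ⊥ := by
  unfold lagr
  rw [hy, EReal.sub_top]

lemma Problem.isSaddleR_of_isSaddle (hp : Problem f Φ h φ U μ Lxx Lyx Lyy) {u : Primal n} {w : Y}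
    (hs : IsSaddle f Φ h u w) : IsSaddleR f Φ h u w := by
  choose a ha using fun i => (hp.f_convex i).proper
  obtain ⟨b, hb⟩ := hp.h_convex.proper
  have hw : h w ≠ ⊤ := by
    intro htop
    have h1 := hs.1 b
    rw [lagr_eq_bot htop, le_bot_iff] at h1
    by_cases hu : ∃ i, f i (u i) = ⊤
    · obtain ⟨i, hi⟩ := hu
      rw [hp.lagr_eq_top hi hb] at h1
      exact absurd h1 (by simp)
    · push Not at hu
      rw [hp.lagr_eq hu hb] at h1
      exact EReal.coe_ne_bot _ h1
  have hu : ∀ i, f i (u i) ≠ ⊤ := by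
    intro i hi
    have h1 := hs.2 a
    rw [hp.lagr_eq_top hi hw, hp.lagr_eq ha hw] at h1
    exact EReal.coe_ne_top _ (top_le_iff.1 h1)
  refine ⟨hu, hw, fun y hy => ?_, fun x hx => ?_⟩
  · have := hs.1 y
    rw [hp.lagr_eq hu hy, hp.lagr_eq hu hw] at this
    exact_mod_cast this
  · have := hs.2 x
    rw [hp.lagr_eq hu hw, hp.lagr_eq hx hw] at this
    exact_mod_cast this

lemma Problem.isSaddle_of_isSaddleR (hp : Problem f Φ h φ U μ Lxx Lyx Lyy) {u : Primal n} {w : Y}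
    (hs : IsSaddleR f Φ h u w) : IsSaddle f Φ h u w := by
  refine ⟨fun y => ?_, fun x => ?_⟩
  · by_cases hy : h y = ⊤
    · rw [lagr_eq_bot hy]; exact bot_le
    · rw [hp.lagr_eq hs.dom_x hy, hp.lagr_eq hs.dom_x hs.dom_y]
      exact_mod_cast hs.le_left y hy
  · by_cases hx : ∃ i, f i (x i) = ⊤
    · obtain ⟨i, hi⟩ := hx
      rw [hp.lagr_eq_top hi hs.dom_y]; exact le_top
    · push Not at hx
      rw [hp.lagr_eq hx hs.dom_y, hp.lagr_eq hs.dom_x hs.dom_y]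
      exact_mod_cast hs.le_right x hx

lemma IsSaddleR.value_eq {u u' : Primal n} {w w' : Y} (hs : IsSaddleR f Φ h u w)
    (hs' : IsSaddleR f Φ h u' w') : lagrR f Φ h u w = lagrR f Φ h u' w' :=
  le_antisymm ((hs.le_right _ hs'.dom_x).trans (hs'.le_left _ hs.dom_y))
    ((hs'.le_right _ hs.dom_x).trans (hs.le_left _ hs'.dom_y))

/-- Saddle points are interchangeable. This later trades the values of f and h at a random saddle
point for those at a fixed one. -/
lemma IsSaddleR.value_eq_left {u u' : Primal n} {w w' : Y} (hs : IsSaddleR f Φ h u w)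
    (hs' : IsSaddleR f Φ h u' w') : lagrR f Φ h u w = lagrR f Φ h u w' :=
  le_antisymm ((hs.value_eq hs').le.trans (hs'.le_right _ hs.dom_x)) (hs.le_left _ hs'.dom_y)

/-- The concavity gap of the coupling function in its second argument. -/
noncomputable def defect (Φ : Primal n → Y → ℝ) (x : Primal n) (y w : Y) : ℝ :=
  Φ x y - Φ x w - gradY Φ x y (y - w)

lemma Problem.defect_nonneg (hp : Problem f Φ h φ U μ Lxx Lyx Lyy) (x : Primal n) (y w : Y) :
    0 ≤ defect Φ x y w := by
  have := hp.le_add_gradY x y w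
  have e : gradY Φ x y (y - w) = - gradY Φ x y (w - y) := by rw [← map_neg, neg_sub]
  unfold defect
  linarith

lemma Problem.defect_le [NeZero m] (hp : Problem f Φ h φ U μ Lxx Lyx Lyy) (x : Primal n) (y w : Y) :
    defect Φ x y w ≤ Lyy / 2 * ‖w - y‖ ^ 2 := by
  have := hp.sub_quadratic_le x y w
  have e : gradY Φ x y (y - w) = - gradY Φ x y (w - y) := by rw [← map_neg, neg_sub]
  unfold defect
  linarith

end Lagrangian

/-! ### The one-step inequality -/

section OneStep

variable {m : ℕ} {n : Fin m → ℕ} {Y : Type*} [NormedAddCommGroup Y] [NormedSpace ℝ Y]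
  {f : (i : Fin m) → EuclideanSpace ℝ (Fin (n i)) → EReal} {Φ : Primal n → Y → ℝ}
  {h : Y → EReal} {φ : Y → ℝ} {U : Set Y} {μ Lxx Lyx : Fin m → ℝ} {Lyy : ℝ}

/-- The energy of the last move that controls the momentum term. -/
noncomputable def inertia (Lyx : Fin m → ℝ) (Lyy α β : ℝ) (x x' : Primal n) (y y' : Y) : ℝ :=
  ∑ i, Lyx i ^ 2 / (2 * α) * ‖x i - x' i‖ ^ 2 + Lyy ^ 2 / (2 * β) * ‖y - y'‖ ^ 2

/-- The Lyapunov function of the method relative to the point `(u, w)`, at the current iterate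
`(x, y)` with previous iterate `(x', y')`. -/
noncomputable def pot (f : (i : Fin m) → EuclideanSpace ℝ (Fin (n i)) → EReal)
    (Φ : Primal n → Y → ℝ) (h : Y → EReal) (φ : Y → ℝ) (ν Lyx : Fin m → ℝ) (Lyy : ℝ)
    (τ : Fin m → ℝ) (σ θ α β : ℝ) (x x' : Primal n) (y y' : Y) (u : Primal n) (w : Y) : ℝ :=
  1 / 2 * wsq (fun i => m / τ i + (m - 1) * ν i) (u - x) + 1 / σ * breg φ w y
    + m * θ * (defect Φ x y w + (gradY Φ x y - gradY Φ x' y') (y - w)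
      + inertia Lyx Lyy α β x x' y y')
    + (m - 1) * (lagrR f Φ h x w - lagrR f Φ h u w)

lemma sum_update {x z : Primal n} (s : (j : Fin m) → EuclideanSpace ℝ (Fin (n j)) → ℝ)
    (i : Fin m) : ∑ j, s j (Function.update x i (z i) j)
      = ∑ j, s j (x j) + (s i (z i) - s i (x i)) := by
  rw [← Finset.add_sum_erase _ _ (Finset.mem_univ i),
    ← Finset.add_sum_erase Finset.univ (fun j => s j (x j)) (Finset.mem_univ i)]
  have : ∑ j ∈ Finset.univ.erase i, s j (Function.update x i (z i) j)
      = ∑ j ∈ Finset.univ.erase i, s j (x j) := by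
    refine Finset.sum_congr rfl fun j hj => ?_
    rw [Function.update_of_ne (Finset.ne_of_mem_erase hj)]
  rw [this, Function.update_self]
  ring

/-- Each block is replaced in exactly one of the m updates and kept in the other m - 1. -/
lemma sum_sum_update {x z : Primal n} (s : (j : Fin m) → EuclideanSpace ℝ (Fin (n j)) → ℝ) :
    ∑ i, ∑ j, s j (Function.update x i (z i) j)
      = ∑ j, s j (z j) + (m - 1) * ∑ j, s j (x j) := by
  simp_rw [sum_update s]
  rw [Finset.sum_add_distrib, Finset.sum_const, Finset.sum_sub_distrib, Finset.card_univ,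
    Fintype.card_fin, nsmul_eq_mul]
  ring

lemma update_dom {x z : Primal n} (hx : ∀ i, f i (x i) ≠ ⊤) (hz : ∀ i, f i (z i) ≠ ⊤) (i : Fin m) :
    ∀ j, f j (Function.update x i (z i) j) ≠ ⊤ := by
  intro j
  rcases eq_or_ne j i with rfl | hj
  · simpa using hz j
  · simpa [hj] using hx j

/-- The proximal inequalities of all blocks are added; the linear terms become values of Φ through
the descent inequality at each single update and convexity at u. Φ is never evaluated at z, because
`Lxx` controls one block at a time. No gradient survives, so the result also passes to limits. -/
lemma Problem.blockwise_inequality (hp : Problem f Φ h φ U μ Lxx Lyx Lyy)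
    {τ : Fin m → ℝ} {x z u : Primal n} {yp : Y}
    (hz : ∀ i, IsMinOn (proxObj (f i) (gradX Φ i x yp) (τ i) (x i)) univ (z i))
    (hu : ∀ i, f i (u i) ≠ ⊤) :
    ∑ i, (f i (z i)).toReal + ∑ i, (Φ (Function.update x i (z i)) yp - Φ x yp) + Φ x yp
      + ∑ i, (1 / (2 * τ i) - Lxx i / 2) * ‖z i - x i‖ ^ 2
      + ∑ i, (1 / (2 * τ i) + μ i / 2) * ‖u i - z i‖ ^ 2
      ≤ ∑ i, (f i (u i)).toReal + Φ u yp + ∑ i, 1 / (2 * τ i) * ‖u i - x i‖ ^ 2 := by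
  have h1 := hp.add_gradX_le x u yp
  have h2 : ∑ i, ((f i (z i)).toReal + (Φ (Function.update x i (z i)) yp - Φ x yp)
      + (1 / (2 * τ i) - Lxx i / 2) * ‖z i - x i‖ ^ 2
      + (1 / (2 * τ i) + μ i / 2) * ‖u i - z i‖ ^ 2)
      ≤ ∑ i, ((f i (u i)).toReal + gradX Φ i x yp (u i - x i)
        + 1 / (2 * τ i) * ‖u i - x i‖ ^ 2) := by
    refine Finset.sum_le_sum fun i _ => ?_
    have h3 := (prox_inequality (hp.f_convex i) (hz i)).2 (u i) (hu i)
    have h4 := hp.update_le x yp i (z i)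
    rw [map_sub] at h4 ⊢
    linarith
  simp only [Finset.sum_add_distrib] at h2
  linarith

/-- Adding m - 1 copies of the old values and old distances to the block-wise inequality completes
every separable sum to its value at the m possible next iterates. -/
lemma Problem.primal_step (hp : Problem f Φ h φ U μ Lxx Lyx Lyy) {ν : Fin m → ℝ}
    (hν : ∀ i, ν i ≤ μ i) {τ : Fin m → ℝ} {x z u : Primal n} {yp : Y}
    (hz : ∀ i, IsMinOn (proxObj (f i) (gradX Φ i x yp) (τ i) (x i)) univ (z i))
    (hu : ∀ i, f i (u i) ≠ ⊤) :
    ∑ i, (∑ j, (f j (Function.update x i (z i) j)).toReal + Φ (Function.update x i (z i)) yp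
      + (1 / (2 * τ i) - Lxx i / 2) * ‖z i - x i‖ ^ 2
      + 1 / 2 * wsq (fun j => 1 / τ j + ν j) (u - Function.update x i (z i)))
    ≤ (m - 1) * (∑ i, (f i (x i)).toReal + Φ x yp) + ∑ i, (f i (u i)).toReal + Φ u yp
      + 1 / 2 * wsq (fun i => m / τ i + (m - 1) * ν i) (u - x) := by
  have h1 := hp.blockwise_inequality hz hu
  have h2 : ∑ i, ∑ j, (f j (Function.update x i (z i) j)).toReal = _ :=
    sum_sum_update (x := x) (z := z) (fun j v => (f j v).toReal)
  have h3 : ∑ i, 1 / 2 * wsq (fun j => 1 / τ j + ν j) (u - Function.update x i (z i)) = _ :=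
    (Finset.mul_sum _ _ _).symm.trans (congrArg _
      (sum_sum_update (x := x) (z := z) (fun j v => (1 / τ j + ν j) * ‖u j - v‖ ^ 2)))
  simp only [Finset.sum_add_distrib]
  rw [h2, h3]
  have h4 : ∑ i, (Φ (Function.update x i (z i)) yp - Φ x yp)
      = ∑ i, Φ (Function.update x i (z i)) yp - m * Φ x yp := by
    rw [Finset.sum_sub_distrib, Finset.sum_const, Finset.card_univ, Fintype.card_fin,
      nsmul_eq_mul]
  rw [h4] at h1
  have h5 : 1 / 2 * ∑ j, (1 / τ j + ν j) * ‖u j - z j‖ ^ 2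
      ≤ ∑ i, (1 / (2 * τ i) + μ i / 2) * ‖u i - z i‖ ^ 2 := by
    rw [Finset.mul_sum]
    refine Finset.sum_le_sum fun i _ => ?_
    have e : 1 / (2 * τ i) = 1 / 2 * (1 / τ i) := by rw [one_div_mul_one_div]
    rw [e, ← mul_assoc]
    exact mul_le_mul_of_nonneg_right (by linarith [hν i]) (sq_nonneg _)
  have h6 : 1 / 2 * wsq (fun i => m / τ i + (m - 1) * ν i) (u - x)
      = ∑ i, 1 / (2 * τ i) * ‖u i - x i‖ ^ 2
        + 1 / 2 * ((m - 1) * ∑ j, (1 / τ j + ν j) * ‖u j - x j‖ ^ 2) := by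
    unfold wsq
    rw [Finset.mul_sum, Finset.mul_sum, Finset.mul_sum, ← Finset.sum_add_distrib]
    refine Finset.sum_congr rfl fun i _ => ?_
    have e : 1 / (2 * τ i) = 1 / 2 * (1 / τ i) := by rw [one_div_mul_one_div]
    rw [e, Pi.sub_apply]
    ring
  rw [h6]
  linarith

lemma young {a c α : ℝ} (hα : 0 < α) : a * c ≤ a ^ 2 / (2 * α) + α / 2 * c ^ 2 := by
  have : 0 ≤ (a - α * c) ^ 2 / (2 * α) := by positivity
  have e : (a - α * c) ^ 2 / (2 * α) = a ^ 2 / (2 * α) + α / 2 * c ^ 2 - a * c := by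
    field_simp; ring
  linarith

lemma inertia_update {x : Primal n} (i : Fin m) (z : EuclideanSpace ℝ (Fin (n i))) (y y' : Y)
    (α β : ℝ) : inertia Lyx Lyy α β (Function.update x i z) x y y'
      = Lyx i ^ 2 / (2 * α) * ‖z - x i‖ ^ 2 + Lyy ^ 2 / (2 * β) * ‖y - y'‖ ^ 2 := by
  unfold inertia
  congr 1
  rw [Finset.sum_eq_single i]
  · simp
  · intro j _ hj
    simp [hj]
  · simp

/-- Young's inequality, with parameter α for the primal and β for the dual part. If β = 0 then `Lyy
= 0`, and the term with division by zero is 0. -/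
lemma Problem.momentum_bound (hp : Problem f Φ h φ U μ Lxx Lyx Lyy) {x : Primal n} (i : Fin m)
    (z : EuclideanSpace ℝ (Fin (n i))) (y y' d : Y) {α β : ℝ} (hα : 0 < α) (hβ : 0 ≤ β)
    (hβ' : β = 0 → Lyy = 0) :
    |(gradY Φ (Function.update x i z) y - gradY Φ x y') d|
      ≤ inertia Lyx Lyy α β (Function.update x i z) x y y' + (α + β) / 2 * ‖d‖ ^ 2 := by
  rw [inertia_update]
  have h1 := ContinuousLinearMap.le_of_opNorm_le _ (hp.gradY_update x y' y i z) d
  rw [Real.norm_eq_abs, norm_sub_rev y'] at h1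
  have h2 := young (a := Lyx i * ‖z - x i‖) (c := ‖d‖) hα
  have h3 : Lyy * ‖y - y'‖ * ‖d‖ ≤ Lyy ^ 2 / (2 * β) * ‖y - y'‖ ^ 2 + β / 2 * ‖d‖ ^ 2 := by
    rcases hβ.eq_or_lt with h0 | h0
    · rw [hβ' h0.symm, ← h0]; simp
    · have := young (a := Lyy * ‖y - y'‖) (c := ‖d‖) h0
      rw [mul_pow, mul_div_right_comm] at this
      exact this
  rw [mul_pow, mul_div_right_comm] at h2
  linarith

/-- With g the gradient at (x, y), the sum over blocks produces g(yp - w) with factor m. One copy is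
cancelled by the extrapolated direction in the dual inequality, the other m - 1 by concavity, which
moves the m - 1 old values Φ(x, yp) to Φ(x, w). -/
lemma Problem.full_step [NeZero m] (hp : Problem f Φ h φ U μ Lxx Lyx Lyy) {ν : Fin m → ℝ}
    (hν : ∀ i, ν i ≤ μ i) {τ : Fin m → ℝ} {σ θ : ℝ} {x x' z u : Primal n} {y y' yp w : Y}
    (hz : ∀ i, IsMinOn (proxObj (f i) (gradX Φ i x yp) (τ i) (x i)) univ (z i))
    (hy : IsMinOn (bregObj h φ (momentum Φ θ x y x' y') σ y) univ yp)
    (hu : ∀ i, f i (u i) ≠ ⊤) (hw : h w ≠ ⊤) :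
    ∑ i, (lagrR f Φ h (Function.update x i (z i)) w + defect Φ (Function.update x i (z i)) yp w
      + (gradY Φ (Function.update x i (z i)) yp - gradY Φ x y) (yp - w)
      + (1 / (2 * τ i) - Lxx i / 2) * ‖z i - x i‖ ^ 2
      + 1 / 2 * wsq (fun j => 1 / τ j + ν j) (u - Function.update x i (z i)))
    + 1 / σ * (breg φ yp y + breg φ w yp)
    ≤ (m - 1) * (lagrR f Φ h x w + defect Φ x y w) + lagrR f Φ h u yp
      + m * θ * ((gradY Φ x y - gradY Φ x' y') (y - w) + (gradY Φ x y - gradY Φ x' y') (yp - y))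
      + 1 / 2 * wsq (fun i => m / τ i + (m - 1) * ν i) (u - x) + 1 / σ * breg φ w y := by
  have h1 := hp.primal_step hν hz hu
  obtain ⟨hyp, h2⟩ := bregman_prox_inequality hp.h_convex hy (fun hh => hp.φ_diffAt (hp.dom_h _ hh))
  have h2 := h2 w hw
  set g := gradY Φ x y with hg
  set q := g - gradY Φ x' y' with hq
  have h3 : momentum Φ θ x y x' y' (w - yp) = - g (yp - w) - m * θ * (q (y - w) + q (yp - y)) := by
    have e1 : w - yp = -(yp - w) := by abel
    have e2 : q (y - w) + q (yp - y) = q (yp - w) := by rw [← map_add]; congr 1; abel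
    rw [e2, e1, map_neg]
    simp only [momentum, add_apply, smul_apply, smul_eq_mul]
    rw [← hg, ← hq]
    ring
  rw [h3] at h2
  have h4 : ∀ i, lagrR f Φ h (Function.update x i (z i)) w
      + defect Φ (Function.update x i (z i)) yp w
      + (gradY Φ (Function.update x i (z i)) yp - g) (yp - w)
      + (1 / (2 * τ i) - Lxx i / 2) * ‖z i - x i‖ ^ 2
      + 1 / 2 * wsq (fun j => 1 / τ j + ν j) (u - Function.update x i (z i))
      = (∑ j, (f j (Function.update x i (z i) j)).toReal + Φ (Function.update x i (z i)) yp
      + (1 / (2 * τ i) - Lxx i / 2) * ‖z i - x i‖ ^ 2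
      + 1 / 2 * wsq (fun j => 1 / τ j + ν j) (u - Function.update x i (z i)))
      - (g (yp - w) + (h w).toReal) := by
    intro i
    unfold lagrR defect
    rw [sub_apply]
    ring
  rw [Finset.sum_congr rfl fun i _ => h4 i, Finset.sum_sub_distrib, Finset.sum_const,
    Finset.card_univ, Fintype.card_fin, nsmul_eq_mul]
  have hm : (1 : ℝ) ≤ m := by exact_mod_cast NeZero.one_le
  have h5 : Φ x yp ≤ Φ x w + defect Φ x y w + g (yp - w) := by
    have := hp.le_add_gradY x y yp
    unfold defect
    have e : g (yp - w) = g (yp - y) + g (y - w) := by rw [← map_add]; congr 1; abel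
    rw [e]
    linarith
  have h6 := mul_le_mul_of_nonneg_left h5 (show (0 : ℝ) ≤ m - 1 by linarith)
  have h7 : 1 / σ * (breg φ yp y + breg φ w yp - breg φ w y)
      = 1 / σ * (breg φ yp y + breg φ w yp) - 1 / σ * breg φ w y := by ring
  rw [h7] at h2
  unfold lagrR
  linarith

/-- The step-size condition for one iteration, with the parameters of the next iteration primed. -/
structure StepOK (ν Lxx Lyx : Fin m → ℝ) (Lyy : ℝ) (τ : Fin m → ℝ) (σ θ t α β : ℝ)
    (τ' : Fin m → ℝ) (σ' θ' t' α' β' : ℝ) : Prop where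
  σ_pos : 0 < σ
  θ_ge : (m : ℝ) - 1 ≤ m * θ
  θ_nonneg : 0 ≤ θ
  t_pos : 0 < t
  α'_pos : 0 < α'
  β'_nonneg : 0 ≤ β'
  primal : ∀ i, Lxx i + Lyx i ^ 2 / α' ≤ 1 / τ i
  dual : m * θ * (α + β) + m * Lyy ^ 2 / β' ≤ 1 / σ
  t_mul : t' * θ' = t
  t_primal : ∀ i, t' * (1 / τ' i + (1 - 1 / (m : ℝ)) * ν i) ≤ t * (1 / τ i + ν i)
  t_dual : t' / σ' ≤ t / σ

/-- The unused part of the primal step sizes. -/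
noncomputable def slackX (Lxx Lyx : Fin m → ℝ) (τ : Fin m → ℝ) (α' : ℝ) (i : Fin m) : ℝ :=
  1 / 2 * (1 / τ i - Lxx i - Lyx i ^ 2 / α')

/-- The unused part of the dual step size. -/
noncomputable def slackY (m : ℕ) (Lyy σ θ α β β' : ℝ) : ℝ :=
  1 / 2 * (1 / σ - m * θ * (α + β) - m * Lyy ^ 2 / β')

/-- This is `Problem.full_step` multiplied by t m. On the left, t = t'θ' and the monotone weights
produce the new potential, and its inertia is taken from the quadratic terms in z - x and yp - y. On
the right, the cross term at yp - y is bounded by the old inertia and by (α + β)/2 ‖yp - y‖², which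
D(yp, y)/σ pays for. Everything unused is kept: the slacks, both gaps, and the defect with factor mθ
- (m - 1). -/
theorem Problem.potential_decrease [NeZero m] (hp : Problem f Φ h φ U μ Lxx Lyx Lyy)
    {ν : Fin m → ℝ} (hν : ∀ i, ν i ≤ μ i) {τ τ' : Fin m → ℝ}
    {σ θ t α β σ' θ' t' α' β' : ℝ}
    (hs : StepOK ν Lxx Lyx Lyy τ σ θ t α β τ' σ' θ' t' α' β')
    {x x' z u : Primal n} {y y' yp w : Y} (hyU : y ∈ U)
    (hz : ∀ i, IsMinOn (proxObj (f i) (gradX Φ i x yp) (τ i) (x i)) univ (z i))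
    (hy : IsMinOn (bregObj h φ (momentum Φ θ x y x' y') σ y) univ yp)
    (hu : ∀ i, f i (u i) ≠ ⊤) (hw : h w ≠ ⊤)
    (hq : ∀ d, |(gradY Φ x y - gradY Φ x' y') d|
      ≤ inertia Lyx Lyy α β x x' y y' + (α + β) / 2 * ‖d‖ ^ 2) :
    ∑ i, (t' * pot f Φ h φ ν Lyx Lyy τ' σ' θ' α' β' (Function.update x i (z i)) x yp y u w
        + (t * m - t' * (m - 1)) * (lagrR f Φ h (Function.update x i (z i)) w - lagrR f Φ h u w)
        + t * m * (slackX Lxx Lyx τ α' i * ‖z i - x i‖ ^ 2))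
      + m * (t * (lagrR f Φ h u w - lagrR f Φ h u yp)
        + t * (slackY m Lyy σ θ α β β' * ‖yp - y‖ ^ 2)
        + t * (m * θ - (m - 1)) * defect Φ x y w)
    ≤ m * (t * pot f Φ h φ ν Lyx Lyy τ σ θ α β x x' y y' u w) := by
  have hm : (1 : ℝ) ≤ m := by exact_mod_cast NeZero.one_le
  have h1 := hp.full_step hν hz hy hu hw
  have hyp : yp ∈ U := hp.dom_h _ (hp.h_convex.isMinOn_add hy).1
  set v := lagrR f Φ h u w
  have h2 : ∀ i, t' * pot f Φ h φ ν Lyx Lyy τ' σ' θ' α' β' (Function.update x i (z i)) x yp y u w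
        + (t * m - t' * (m - 1)) * (lagrR f Φ h (Function.update x i (z i)) w - v)
        + t * m * (slackX Lxx Lyx τ α' i * ‖z i - x i‖ ^ 2)
      ≤ t * m * (lagrR f Φ h (Function.update x i (z i)) w
        + defect Φ (Function.update x i (z i)) yp w
      + (gradY Φ (Function.update x i (z i)) yp - gradY Φ x y) (yp - w)
      + (1 / (2 * τ i) - Lxx i / 2) * ‖z i - x i‖ ^ 2
      + 1 / 2 * wsq (fun j => 1 / τ j + ν j) (u - Function.update x i (z i)))
      + (t * (1 / σ * breg φ w yp) - t * m * v
        + t * m * (Lyy ^ 2 / (2 * β') * ‖yp - y‖ ^ 2)) := by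
    intro i
    have e1 : t' * (1 / 2 * wsq (fun i => m / τ' i + (m - 1) * ν i)
        (u - Function.update x i (z i)))
        ≤ t * m * (1 / 2 * wsq (fun j => 1 / τ j + ν j) (u - Function.update x i (z i))) := by
      unfold wsq
      rw [Finset.mul_sum, Finset.mul_sum, Finset.mul_sum, Finset.mul_sum]
      refine Finset.sum_le_sum fun j _ => ?_
      have hj := mul_le_mul_of_nonneg_left (hs.t_primal j) (show (0 : ℝ) ≤ m / 2 by positivity)
      have hj := mul_le_mul_of_nonneg_right hj (sq_nonneg ‖(u - Function.update x i (z i)) j‖)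
      refine le_trans (le_of_eq ?_) (hj.trans (le_of_eq ?_))
      · have hm0 : (m : ℝ) ≠ 0 := by positivity
        have : (m : ℝ) * (1 / m) = 1 := by field_simp
        linear_combination (t' * ν j * ‖(u - Function.update x i (z i)) j‖ ^ 2 / 2) * this
      · ring
    have e2 : t' * (1 / σ' * breg φ w yp) ≤ t * (1 / σ * breg φ w yp) := by
      have := mul_le_mul_of_nonneg_right hs.t_dual (hp.breg_nonneg hyp w)
      rw [← mul_assoc, ← mul_assoc, ← div_eq_mul_one_div, ← div_eq_mul_one_div]
      exact this
    have e3 : 1 / (2 * τ i) = 1 / 2 * (1 / τ i) := by rw [one_div_mul_one_div]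
    have e4 : Lyx i ^ 2 / (2 * α') = 1 / 2 * (Lyx i ^ 2 / α') := by
      rw [mul_comm (2 : ℝ), ← div_div]; ring
    unfold pot slackX
    rw [inertia_update, e3, e4, ← hs.t_mul]
    rw [← hs.t_mul] at e1 e2
    linarith
  refine le_trans (add_le_add_left (Finset.sum_le_sum fun i _ => h2 i) _) ?_
  rw [Finset.sum_add_distrib, ← Finset.mul_sum, Finset.sum_const, Finset.card_univ,
    Fintype.card_fin, nsmul_eq_mul]
  have htm : 0 ≤ t * m := by have := hs.t_pos; positivity
  have h4 := mul_le_mul_of_nonneg_left h1 htm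
  have h5 := (le_abs_self _).trans (hq (yp - y))
  have h6 := mul_le_mul_of_nonneg_left h5 (show 0 ≤ t * m * (m * θ) by
    have := hs.θ_nonneg; positivity)
  have h7 := mul_le_mul_of_nonneg_left (hp.half_sq_le_breg hyU yp)
    (show 0 ≤ t * m * (1 / σ) by have := hs.σ_pos; positivity)
  have e5 : Lyy ^ 2 / (2 * β') = 1 / 2 * (Lyy ^ 2 / β') := by
    rw [mul_comm (2 : ℝ), ← div_div]; ring
  have e6 : (m : ℝ) * Lyy ^ 2 / β' = m * (Lyy ^ 2 / β') := by rw [mul_div_assoc]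
  unfold pot slackY
  rw [e6, e5]
  linarith

/-- The momentum bound is used at d = y - w: the inertia cancels, and the cross term costs at most
mθ(α + β) D(w, y). -/
lemma Problem.pot_lower (hp : Problem f Φ h φ U μ Lxx Lyx Lyy) {ν : Fin m → ℝ}
    {τ : Fin m → ℝ} {σ θ α β : ℝ} {x x' u : Primal n} {y y' w : Y} (hyU : y ∈ U)
    (hθ : 0 ≤ θ) (hαβ : 0 ≤ α + β)
    (hq : ∀ d, |(gradY Φ x y - gradY Φ x' y') d|
      ≤ inertia Lyx Lyy α β x x' y y' + (α + β) / 2 * ‖d‖ ^ 2) :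
    1 / 2 * wsq (fun i => m / τ i + (m - 1) * ν i) (u - x)
      + (1 / σ - m * θ * (α + β)) * breg φ w y + m * θ * defect Φ x y w
      + (m - 1) * (lagrR f Φ h x w - lagrR f Φ h u w)
    ≤ pot f Φ h φ ν Lyx Lyy τ σ θ α β x x' y y' u w := by
  have h1 := neg_le_of_abs_le (hq (y - w))
  have h2 := mul_le_mul_of_nonneg_left (hp.half_sq_le_breg hyU w) hαβ
  rw [norm_sub_rev w y] at h2
  have h3 : 0 ≤ m * θ * ((gradY Φ x y - gradY Φ x' y') (y - w)
      + inertia Lyx Lyy α β x x' y y' + (α + β) * breg φ w y) := by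
    apply mul_nonneg (by positivity)
    linarith
  unfold pot
  linarith

/-- At the start θ = 1 and the defect has weight m. One copy is set aside, because step 0 dissipates
exactly that amount; the other m - 1 are at most `Lyy` D(w, y) each. Hence the factor 1 - 1/m in
front of `Lyy` in `Delta`. -/
lemma Problem.pot_init [NeZero m] (hp : Problem f Φ h φ U μ Lxx Lyx Lyy) {ν : Fin m → ℝ}
    {τ : Fin m → ℝ} {σ α β : ℝ} {x u : Primal n} {y w : Y} (hyU : y ∈ U)
    (hx : ∀ i, f i (x i) ≠ ⊤) (hu : ∀ i, f i (u i) ≠ ⊤) (hw : h w ≠ ⊤) :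
    pot f Φ h φ ν Lyx Lyy τ σ 1 α β x x y y u w - defect Φ x y w
      ≤ m * Delta f Φ h φ ν Lyy τ σ u w x y := by
  have hm : (1 : ℝ) ≤ m := by exact_mod_cast NeZero.one_le
  have h1 := hp.defect_le x y w
  have h2 := mul_le_mul_of_nonneg_left (hp.half_sq_le_breg hyU w) hp.Lyy_nonneg
  have h3 : inertia Lyx Lyy α β x x y y = 0 := by simp [inertia]
  have h4 : (lagr f Φ h x w - lagr f Φ h u w).toReal = lagrR f Φ h x w - lagrR f Φ h u w := by
    rw [hp.lagr_eq hx hw, hp.lagr_eq hu hw, ← EReal.coe_sub, EReal.toReal_coe]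
  have h5 : m * (1 / 2 * wsq (fun i => 1 / τ i + (1 - 1 / (m : ℝ)) * ν i) (u - x))
      = 1 / 2 * wsq (fun i => m / τ i + (m - 1) * ν i) (u - x) := by
    unfold wsq
    rw [Finset.mul_sum, Finset.mul_sum, Finset.mul_sum]
    refine Finset.sum_congr rfl fun i _ => ?_
    field_simp
  have h6 : (m : ℝ) * (1 / (m * σ)) = 1 / σ := by field_simp
  have h7 : (m : ℝ) * (1 - 1 / m) = m - 1 := by field_simp
  have h8 := mul_le_mul_of_nonneg_left (h1.trans (show _ ≤ Lyy * breg φ w y by linarith))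
    (show (0 : ℝ) ≤ m - 1 by linarith)
  unfold pot Delta
  rw [h4, h3, sub_self, zero_apply]
  have h9 : m * (1 / 2 * wsq (fun i => 1 / τ i + (1 - 1 / (m : ℝ)) * ν i) (u - x)
      + (1 / (m * σ) + (1 - 1 / m) * Lyy) * breg φ w y
      + (1 - 1 / m) * (lagrR f Φ h x w - lagrR f Φ h u w))
    = 1 / 2 * wsq (fun i => m / τ i + (m - 1) * ν i) (u - x)
      + (1 / σ + (m - 1) * Lyy) * breg φ w y
      + (m - 1) * (lagrR f Φ h x w - lagrR f Φ h u w) := by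
    rw [← h5, ← h6, ← h7]; ring
  rw [h9]
  linarith

end OneStep

/-! ### Functions of the first random indices -/

section Determined

variable {m : ℕ} {Ω : Type*}

/-- `g` depends only on the indices drawn before step `k`. -/
def Determined {β : Type*} (I : ℕ → Ω → Fin m) (k : ℕ) (g : Ω → β) : Prop :=
  ∀ ω ω', (∀ j < k, I j ω = I j ω') → g ω = g ω'

/-- The indices drawn before step `k`. -/
def past (I : ℕ → Ω → Fin m) (k : ℕ) (ω : Ω) : Fin k → Fin m := fun j => I j ω

variable {I : ℕ → Ω → Fin m} {k l : ℕ} {β : Type*} {g : Ω → β}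

lemma Determined.mono (hg : Determined I k g) (hkl : k ≤ l) : Determined I l g :=
  fun ω ω' hω => hg ω ω' fun j hj => hω j (hj.trans_le hkl)

lemma Determined.const (b : β) : Determined I k fun _ : Ω => b := fun _ _ _ => rfl

lemma Determined.comp (hg : Determined I k g) {γ : Type*} (F : β → γ) :
    Determined I k fun ω => F (g ω) := fun ω ω' hω => congrArg F (hg ω ω' hω)

lemma Determined.comp₂ {γ δ : Type*} {g' : Ω → γ} (hg : Determined I k g)
    (hg' : Determined I k g') (F : β → γ → δ) : Determined I k fun ω => F (g ω) (g' ω) :=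
  fun ω ω' hω => congrArg₂ F (hg ω ω' hω) (hg' ω ω' hω)

lemma Determined.sum {ι M : Type*} [AddCommMonoid M] {s : Finset ι} {W : ι → Ω → M}
    (hW : ∀ i ∈ s, Determined I k (W i)) : Determined I k fun ω => ∑ i ∈ s, W i ω :=
  fun ω ω' hω => Finset.sum_congr rfl fun i hi => hW i hi ω ω' hω

lemma Determined.select {W : Fin m → Ω → β} (hW : ∀ i, Determined I k (W i)) :
    Determined I (k + 1) fun ω => W (I k ω) ω := by
  intro ω ω' hω
  have h1 := hω k (Nat.lt_succ_self k)
  have h2 := hW (I k ω) ω ω' fun j hj => hω j (hj.trans (Nat.lt_succ_self k))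
  simp only
  rw [h2, h1]

/-- There are finitely many pasts, so such a quantity takes finitely many values; boundedness,
measurability and integrability then need no property of the function itself. -/
lemma Determined.exists_factor [Nonempty β] (hg : Determined I k g) :
    ∃ G : (Fin k → Fin m) → β, g = G ∘ past I k := by
  have : Function.FactorsThrough g (past I k) := fun ω ω' hω =>
    hg ω ω' fun j hj => congrFun hω ⟨j, hj⟩
  exact (Function.factorsThrough_iff g).1 this

lemma Determined.bounded {g : Ω → ℝ} (hg : Determined I k g) : ∃ C, 0 ≤ C ∧ ∀ ω, |g ω| ≤ C := by
  obtain ⟨G, rfl⟩ := hg.exists_factor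
  refine ⟨∑ p, |G p|, Finset.sum_nonneg fun _ _ => abs_nonneg _, fun ω => ?_⟩
  exact Finset.single_le_sum (f := fun p => |G p|) (fun _ _ => abs_nonneg _)
    (Finset.mem_univ (past I k ω))

variable [MeasurableSpace Ω]

lemma measurable_past (hI : ∀ k, Measurable (I k)) (k : ℕ) : Measurable (past I k) :=
  measurable_pi_lambda _ fun _ => hI _

lemma Determined.measurable [Nonempty β] [MeasurableSpace β] (hI : ∀ k, Measurable (I k))
    (hg : Determined I k g) : Measurable g := by
  obtain ⟨G, rfl⟩ := hg.exists_factor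
  exact (measurable_of_finite G).comp (measurable_past hI k)

lemma Determined.integrable {P : Measure Ω} [IsFiniteMeasure P] (hI : ∀ k, Measurable (I k))
    {g : Ω → ℝ} (hg : Determined I k g) : Integrable g P := by
  obtain ⟨C, -, hC⟩ := hg.bounded
  exact Integrable.of_bound (hg.measurable hI).aestronglyMeasurable C
    (Eventually.of_forall fun ω => by simpa using hC ω)

/-- The filtration generated by the random indices. -/
def pastFiltration (hI : ∀ k, Measurable (I k)) :
    Filtration ℕ (inferInstance : MeasurableSpace Ω) where
  seq k := MeasurableSpace.comap (past I k) inferInstance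
  mono' := by
    intro k l hkl
    have : past I k = (fun (p : Fin l → Fin m) (j : Fin k) => p (Fin.castLE hkl j)) ∘ past I l :=
      rfl
    simp only
    rw [this, ← MeasurableSpace.comap_comp]
    exact MeasurableSpace.comap_mono (measurable_of_finite _).comap_le
  le' k := (measurable_past hI k).comap_le

lemma Determined.stronglyMeasurable (hI : ∀ k, Measurable (I k)) {g : Ω → ℝ}
    (hg : Determined I k g) : StronglyMeasurable[pastFiltration hI k] g := by
  obtain ⟨G, rfl⟩ := hg.exists_factor
  have h1 : Measurable[pastFiltration hI k] (past I k) := comap_measurable (past I k)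
  exact ((measurable_of_finite G).comp h1).stronglyMeasurable

variable {P : Measure Ω}

/-- The event that the first k indices follow p has positive probability, hence contains an outcome.
-/
lemma UniformBlocks.exists_path (hI : UniformBlocks P I) (k : ℕ) (p : ℕ → Fin m) :
    ∃ ω, ∀ j < k, I j ω = p j := by
  have h1 := hI.indep.measure_inter_preimage_eq_mul (Finset.range k)
    (sets := fun j => {p j}) (fun _ _ => measurableSet_singleton _)
  have h2 : ∏ j ∈ Finset.range k, P (I j ⁻¹' {p j}) ≠ 0 := by
    refine Finset.prod_ne_zero_iff.2 fun j _ => ?_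
    have := hI.unif j (p j)
    change P (I j ⁻¹' {p j}) = _ at this
    rw [this]
    simp
  rw [← h1] at h2
  obtain ⟨ω, hω⟩ := nonempty_of_measure_ne_zero h2
  refine ⟨ω, fun j hj => ?_⟩
  simpa using mem_iInter₂.1 hω j (Finset.mem_range.2 hj)

/-- The index of step k is independent of the tuple of earlier indices, on which g depends. -/
lemma UniformBlocks.integral_indicator (hI : UniformBlocks P I) {g : Ω → ℝ}
    (hg : Determined I k g) (i : Fin m) :
    ∫ ω, (if I k ω = i then (1 : ℝ) else 0) * g ω ∂P = 1 / m * ∫ ω, g ω ∂P := by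
  obtain ⟨G, rfl⟩ := hg.exists_factor
  have h1 := hI.indep.indepFun_finset {k} (Finset.range k) (by simp) hI.meas
  have h2 := h1.comp (φ := fun p : ((({k} : Finset ℕ) : Type) → Fin m) =>
      if p ⟨k, by simp⟩ = i then (1 : ℝ) else 0)
    (ψ := fun p : (Finset.range k → Fin m) => G fun j => p ⟨j, by simp⟩)
    (measurable_of_finite _) (measurable_of_finite _)
  have h3 := h2.integral_fun_mul_eq_mul_integral
    ((measurable_of_finite _).comp (measurable_pi_lambda _ fun _ => hI.meas _)).aestronglyMeasurable
    ((measurable_of_finite _).comp (measurable_pi_lambda _ fun _ => hI.meas _)).aestronglyMeasurable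
  have h4 : ∫ ω, (if I k ω = i then (1 : ℝ) else 0) ∂P = 1 / m := by
    have h5 : (fun ω => if I k ω = i then (1 : ℝ) else 0) = (I k ⁻¹' {i}).indicator 1 := by
      funext ω
      by_cases hω : I k ω = i
      · rw [if_pos hω, Set.indicator_of_mem (show ω ∈ I k ⁻¹' {i} from hω)]; rfl
      · rw [if_neg hω, Set.indicator_of_notMem (show ω ∉ I k ⁻¹' {i} from hω)]
    rw [h5, MeasureTheory.integral_indicator_one (hI.meas k (measurableSet_singleton i))]
    have := hI.unif k i
    change P (I k ⁻¹' {i}) = _ at this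
    rw [Measure.real, this]
    simp
  refine Eq.trans h3 ?_
  rw [← h4]
  rfl

/-- Averaging over the random index of step `k`. -/
lemma UniformBlocks.integral_select [IsProbabilityMeasure P] (hI : UniformBlocks P I)
    {W : Fin m → Ω → ℝ}
    (hW : ∀ i, Determined I k (W i)) :
    ∫ ω, W (I k ω) ω ∂P = 1 / m * ∑ i, ∫ ω, W i ω ∂P := by
  have h1 : (fun ω => W (I k ω) ω)
      = fun ω => ∑ i, (if I k ω = i then (1 : ℝ) else 0) * W i ω := by
    funext ω
    simp
  rw [h1, integral_finsetSum]
  · rw [Finset.mul_sum]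
    exact Finset.sum_congr rfl fun i _ => hI.integral_indicator (hW i) i
  · intro i _
    refine Determined.integrable (k := k + 1) hI.meas (Determined.comp₂ ?_
      ((hW i).mono (Nat.le_succ k)) fun a b => a * b)
    intro ω ω' hω
    simp only
    rw [hω k (Nat.lt_succ_self k)]

lemma UniformBlocks.integral_select_sum [IsProbabilityMeasure P] (hI : UniformBlocks P I)
    {W : Fin m → Ω → ℝ}
    (hW : ∀ i, Determined I k (W i)) :
    m * ∫ ω, W (I k ω) ω ∂P = ∫ ω, ∑ i, W i ω ∂P := by
  rw [hI.integral_select hW, integral_finsetSum _ fun i _ => (hW i).integrable hI.meas]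
  rcases Nat.eq_zero_or_pos m with rfl | hm
  · simp
  · field_simp

/-- By Tonelli the series has finite expectation, so it converges almost surely and its terms
vanish. -/
lemma tendsto_zero_of_sum_integral_le {a : ℕ → Ω → ℝ} {C : ℝ} (ha : ∀ k ω, 0 ≤ a k ω)
    (hm : ∀ k, Measurable (a k)) (hi : ∀ k, Integrable (a k) P)
    (hC : ∀ K, ∑ k ∈ Finset.range K, ∫ ω, a k ω ∂P ≤ C) :
    ∀ᵐ ω ∂P, Tendsto (fun k => a k ω) atTop (𝓝 0) := by
  have h1 : ∫⁻ ω, ∑' k, ENNReal.ofReal (a k ω) ∂P ≤ ENNReal.ofReal C := by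
    rw [lintegral_tsum fun k => (hm k).ennreal_ofReal.aemeasurable]
    refine ENNReal.tsum_le_of_sum_range_le fun K => ?_
    have h2 : ∀ k, ∫⁻ ω, ENNReal.ofReal (a k ω) ∂P = ENNReal.ofReal (∫ ω, a k ω ∂P) := fun k =>
      (ofReal_integral_eq_lintegral_ofReal (hi k) (Eventually.of_forall (ha k))).symm
    simp_rw [h2]
    rw [← ENNReal.ofReal_sum_of_nonneg fun k _ => integral_nonneg (ha k)]
    exact ENNReal.ofReal_le_ofReal (hC K)
  have h2 : ∀ᵐ ω ∂P, ∑' k, ENNReal.ofReal (a k ω) < ⊤ :=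
    ae_lt_top (Measurable.tsum fun k => (hm k).ennreal_ofReal)
      (ne_top_of_le_ne_top ENNReal.ofReal_ne_top h1)
  filter_upwards [h2] with ω hω
  have h3 := ENNReal.tendsto_atTop_zero_of_tsum_ne_top hω.ne
  have h4 := (ENNReal.tendsto_toReal ENNReal.zero_ne_top).comp h3
  simpa [Function.comp_def, ENNReal.toReal_ofReal (ha _ _)] using h4

/-- Almost sure convergence of nonnegative supermartingales of the index process. -/
lemma exists_tendsto_of_decrease [IsProbabilityMeasure P] (hI : ∀ k, Measurable (I k))
    {V : ℕ → Ω → ℝ}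
    (hV : ∀ k, Determined I k (V k)) (h0 : ∀ k ω, 0 ≤ V k ω)
    (hdec : ∀ k (A : Ω → ℝ), Determined I k A → (∀ ω, 0 ≤ A ω) →
      ∫ ω, A ω * V (k + 1) ω ∂P ≤ ∫ ω, A ω * V k ω ∂P) :
    ∀ᵐ ω ∂P, ∃ c, Tendsto (fun k => V k ω) atTop (𝓝 c) := by
  have hsup : Supermartingale V (pastFiltration hI) P := by
    refine supermartingale_of_setIntegral_succ_le (fun k => (hV k).stronglyMeasurable hI)
      (fun k => (hV k).integrable hI) fun k s hs => ?_
    obtain ⟨S, hS, rfl⟩ := hs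
    -- Indicators of past events are admissible weights A; testing with all of them is the
    -- supermartingale inequality.
    have hA : Determined I k ((past I k ⁻¹' S).indicator (1 : Ω → ℝ)) := by
      intro ω ω' hω
      have : past I k ω = past I k ω' := funext fun j => hω j j.2
      by_cases hmem : past I k ω ∈ S
      · rw [Set.indicator_of_mem (show ω ∈ past I k ⁻¹' S from hmem),
          Set.indicator_of_mem (by rw [mem_preimage, ← this]; exact hmem)]; rfl
      · rw [Set.indicator_of_notMem (show ω ∉ past I k ⁻¹' S from hmem),
          Set.indicator_of_notMem (by rw [mem_preimage, ← this]; exact hmem)]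
    have h1 := hdec k _ hA (fun ω => indicator_nonneg (fun _ _ => zero_le_one) ω)
    have h2 : ∀ g : Ω → ℝ, (fun ω => (past I k ⁻¹' S).indicator (1 : Ω → ℝ) ω * g ω)
        = (past I k ⁻¹' S).indicator g := fun g => by
      funext ω
      by_cases hω : ω ∈ past I k ⁻¹' S <;> simp [hω]
    rw [h2, h2, MeasureTheory.integral_indicator (measurable_past hI k hS),
      MeasureTheory.integral_indicator (measurable_past hI k hS)] at h1
    exact h1
  have hint : ∀ k, ∫ ω, V k ω ∂P ≤ ∫ ω, V 0 ω ∂P := by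
    intro k
    induction k with
    | zero => exact le_rfl
    | succ k ih =>
      refine le_trans ?_ ih
      simpa using hdec k (fun _ => 1) (Determined.const 1) (fun _ => zero_le_one)
  -- Since V is nonnegative, its L¹ norm is its mean, which never exceeds the initial one; so -V is
  -- an L¹-bounded submartingale.
  have hconv := hsup.neg.exists_ae_tendsto_of_bdd (R := (∫ ω, V 0 ω ∂P).toNNReal) (by
    intro k
    rw [show (-V) k = -(V k) from rfl, eLpNorm_neg, eLpNorm_one_eq_lintegral_enorm]
    have h1 : ∀ ω, ‖V k ω‖ₑ = ENNReal.ofReal (V k ω) := fun ω => by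
      rw [Real.enorm_of_nonneg (h0 k ω)]
    simp_rw [h1]
    rw [← ofReal_integral_eq_lintegral_ofReal ((hV k).integrable hI)
      (Eventually.of_forall (h0 k))]
    exact ENNReal.ofReal_le_ofReal (hint k))
  filter_upwards [hconv] with ω hω
  obtain ⟨c, hc⟩ := hω
  exact ⟨-c, by simpa using hc.neg⟩

end Determined

/-! ### The iterates as functions of the random indices -/

section Run

variable {m : ℕ} {n : Fin m → ℕ} {Y : Type*} [NormedAddCommGroup Y] [NormedSpace ℝ Y]
  {f : (i : Fin m) → EuclideanSpace ℝ (Fin (n i)) → EReal} {Φ : Primal n → Y → ℝ}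
  {h : Y → EReal} {φ : Y → ℝ} {U : Set Y} {μ Lxx Lyx : Fin m → ℝ} {Lyy : ℝ} {Ω : Type*}
  {τ : ℕ → Fin m → ℝ} {σ θ : ℕ → ℝ} {I : ℕ → Ω → Fin m} {x0 : Primal n} {y0 : Y}
  {x : ℕ → Ω → Primal n} {y : ℕ → Ω → Y}

/-- A run of the method, together with the proximal points `z k ω i` of all the blocks. -/
structure Run (f : (i : Fin m) → EuclideanSpace ℝ (Fin (n i)) → EReal) (Φ : Primal n → Y → ℝ)
    (h : Y → EReal) (φ : Y → ℝ) (U : Set Y) (τ : ℕ → Fin m → ℝ) (σ θ : ℕ → ℝ)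
    (I : ℕ → Ω → Fin m) (x0 : Primal n) (y0 : Y)
    (x : ℕ → Ω → Primal n) (y : ℕ → Ω → Y) (z : ℕ → Ω → Primal n) : Prop where
  init_x : ∀ ω, x 0 ω = x0
  init_y : ∀ ω, y 0 ω = y0
  x_det : ∀ k, Determined I k (x k)
  y_det : ∀ k, Determined I k (y k)
  y_det_succ : ∀ k, Determined I k (y (k + 1))
  z_det : ∀ k, Determined I k (z k)
  x_dom : ∀ k ω i, f i (x k ω i) ≠ ⊤
  y_dom : ∀ k ω, h (y (k + 1) ω) ≠ ⊤
  y_mem : ∀ k ω, y k ω ∈ U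
  y_min : ∀ k ω, IsMinOn (bregObj h φ
    (momentum Φ (θ k) (x k ω) (y k ω) (x (k - 1) ω) (y (k - 1) ω)) (σ k) (y k ω)) univ (y (k + 1) ω)
  z_min : ∀ k ω i, IsMinOn (proxObj (f i) (gradX Φ i (x k ω) (y (k + 1) ω)) (τ k i) (x k ω i))
    univ (z k ω i)
  x_succ : ∀ k ω, x (k + 1) ω = Function.update (x k ω) (I k ω) (z k ω (I k ω))

lemma Generated.dual_step (hp : Problem f Φ h φ U μ Lxx Lyx Lyy) (hσ : ∀ k, 0 < σ k)
    (hg : Generated f Φ h φ τ σ θ I x0 y0 x y) {k : ℕ} {ω ω' : Ω}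
    (hx : x k ω = x k ω') (hy : y k ω = y k ω') (hx' : x (k - 1) ω = x (k - 1) ω')
    (hy' : y (k - 1) ω = y (k - 1) ω') : y (k + 1) ω = y (k + 1) ω' := by
  have h1 := hg.step_y k ω
  have h2 := hg.step_y k ω'
  rw [hx, hy, hx', hy'] at h1
  exact bregman_prox_unique hp.h_convex hp.φ_convex (hσ k)
    (fun y hy => hp.φ_diffAt (hp.dom_h y hy)) h1 h2

/-- Strong induction, since the dual step looks back two iterates; each step is determined by
uniqueness of its minimizer. -/
lemma Generated.determined (hp : Problem f Φ h φ U μ Lxx Lyx Lyy) (hτ : ∀ k i, 0 < τ k i)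
    (hσ : ∀ k, 0 < σ k) (hg : Generated f Φ h φ τ σ θ I x0 y0 x y) (k : ℕ) :
    Determined I k (x k) ∧ Determined I k (y k) := by
  induction k using Nat.strong_induction_on with
  | _ k ih =>
    rcases k with _ | k
    · exact ⟨fun ω ω' _ => by rw [hg.init_x, hg.init_x], fun ω ω' _ => by rw [hg.init_y, hg.init_y]⟩
    have hk := ih k (Nat.lt_succ_self k)
    have hk' := ih (k - 1) (by omega)
    have hstep : ∀ ω ω', (∀ j < k + 1, I j ω = I j ω') →
        x (k + 1) ω = x (k + 1) ω' ∧ y (k + 1) ω = y (k + 1) ω' := by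
      intro ω ω' hω
      have hωk : ∀ j < k, I j ω = I j ω' := fun j hj => hω j (by omega)
      have hωk' : ∀ j < k - 1, I j ω = I j ω' := fun j hj => hω j (by omega)
      have hxk := hk.1 ω ω' hωk
      have hy1 : y (k + 1) ω = y (k + 1) ω' := hg.dual_step hp hσ hxk (hk.2 ω ω' hωk)
        (hk'.1 ω ω' hωk') (hk'.2 ω ω' hωk')
      refine ⟨?_, hy1⟩
      have hIk := hω k (Nat.lt_succ_self k)
      funext i
      by_cases hi : i = I k ω
      · subst hi
        have h1 := hg.step_x k ω
        have h2 := hg.step_x k ω'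
        rw [← hIk, ← hxk, ← hy1] at h2
        exact prox_unique (hp.f_convex _) (hp.μ_nonneg _) (hτ k _) h1 h2
      · rw [hg.keep_x k ω i hi, hg.keep_x k ω' i (by rw [← hIk]; exact hi), hxk]
    exact ⟨fun ω ω' hω => (hstep ω ω' hω).1, fun ω ω' hω => (hstep ω ω' hω).2⟩

/-- The method computes a proximal point only for the drawn block. For any other block i the
minimizer is read off from another outcome with the same past whose next index is i; such an outcome
exists by `UniformBlocks.exists_path`, so no separate existence argument is needed. -/
lemma Generated.exists_run [MeasurableSpace Ω] {P : Measure Ω} [IsProbabilityMeasure P]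
    (hI : UniformBlocks P I)
    (hp : Problem f Φ h φ U μ Lxx Lyx Lyy) (hτ : ∀ k i, 0 < τ k i)
    (hσ : ∀ k, 0 < σ k) (hx0 : ∀ i, f i (x0 i) ≠ ⊤) (hy0 : y0 ∈ U)
    (hg : Generated f Φ h φ τ σ θ I x0 y0 x y) :
    ∃ z, Run f Φ h φ U τ σ θ I x0 y0 x y z := by
  have hdet := hg.determined hp hτ hσ
  have hsel : ∀ k ω i, ∃ ω', (∀ j < k, I j ω' = I j ω) ∧ I k ω' = i := by
    intro k ω i
    obtain ⟨ω', hω'⟩ := hI.exists_path (k + 1) fun j => if j = k then i else I j ω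
    refine ⟨ω', fun j hj => ?_, ?_⟩
    · rw [hω' j (by omega), if_neg (by omega)]
    · rw [hω' k (by omega), if_pos rfl]
  choose sel hsel1 hsel2 using hsel
  have ydet : ∀ k, Determined I k (y (k + 1)) := fun k ω ω' hω =>
    hg.dual_step hp hσ ((hdet k).1 ω ω' hω) ((hdet k).2 ω ω' hω)
      ((hdet (k - 1)).1 ω ω' fun j hj => hω j (by omega))
      ((hdet (k - 1)).2 ω ω' fun j hj => hω j (by omega))
  have hydom : ∀ k ω, h (y (k + 1) ω) ≠ ⊤ := fun k ω =>
    (hp.h_convex.isMinOn_add (hg.step_y k ω)).1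
  let z : ℕ → Ω → Primal n := fun k ω i => x (k + 1) (sel k ω i) i
  have hzmin : ∀ k ω i, IsMinOn (proxObj (f i) (gradX Φ i (x k ω) (y (k + 1) ω)) (τ k i)
      (x k ω i)) univ (z k ω i) := by
    intro k ω i
    have h1 := hg.step_x k (sel k ω i)
    rw [hsel2 k ω i, (hdet k).1 _ _ (hsel1 k ω i), ydet k _ _ (hsel1 k ω i)] at h1
    exact h1
  have hzdom : ∀ k ω i, f i (z k ω i) ≠ ⊤ := fun k ω i =>
    (prox_inequality (hp.f_convex i) (hzmin k ω i)).1
  have hxs : ∀ k ω, x (k + 1) ω = Function.update (x k ω) (I k ω) (z k ω (I k ω)) := by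
    intro k ω
    funext i
    by_cases hi : i = I k ω
    · subst hi
      rw [Function.update_self]
      refine congrFun ((hdet (k + 1)).1 ω _ fun j hj => ?_) _
      rcases Nat.lt_succ_iff_lt_or_eq.1 hj with hj | rfl
      · exact (hsel1 k ω _ j hj).symm
      · exact (hsel2 j ω _).symm
    · rw [Function.update_of_ne hi, hg.keep_x k ω i hi]
  have hxdom : ∀ k ω i, f i (x k ω i) ≠ ⊤ := by
    intro k
    induction k with
    | zero => intro ω i; rw [hg.init_x]; exact hx0 i
    | succ k ih => intro ω; rw [hxs]; exact update_dom (ih ω) (hzdom k ω) _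
  refine ⟨z, hg.init_x, hg.init_y, fun k => (hdet k).1, fun k => (hdet k).2, ydet, ?_, hxdom,
    hydom, ?_, hg.step_y, hzmin, hxs⟩
  · intro k ω ω' hω
    funext i
    refine congrFun ((hdet (k + 1)).1 _ _ fun j hj => ?_) _
    rcases Nat.lt_succ_iff_lt_or_eq.1 hj with hj | rfl
    · rw [hsel1 k ω i j hj, hsel1 k ω' i j hj, hω j hj]
    · rw [hsel2, hsel2]
  · intro k ω
    rcases k with _ | k
    · rw [hg.init_y]; exact hy0
    · exact hp.dom_h _ (hydom k ω)

end Run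

/-! ### Expected decrease of the Lyapunov function -/

section Ergodic

variable {E : Type*} [AddCommGroup E] [Module ℝ E]

lemma ergodic_mem_and_le {s : Set E} {g : E → ℝ} (hg : ConvexOn ℝ s g) {z : ℕ → E}
    (hz : ∀ k, z (k + 1) ∈ s) {K : ℕ} (hK : 1 ≤ K) :
    ergodic z K ∈ s ∧ g (ergodic z K) ≤ 1 / K * ∑ k ∈ Finset.range K, g (z (k + 1)) := by
  have hK0 : (0 : ℝ) < K := by exact_mod_cast hK
  have h1 : ∑ _k ∈ Finset.range K, (1 / (K : ℝ)) = 1 := by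
    rw [Finset.sum_const, Finset.card_range, nsmul_eq_mul]; field_simp
  have e : ergodic z K = ∑ k ∈ Finset.range K, (1 / (K : ℝ)) • z (k + 1) := by
    rw [ergodic, Finset.smul_sum]
  rw [e]
  refine ⟨hg.1.sum_mem (fun _ _ => by positivity) h1 fun k _ => hz k, ?_⟩
  have := hg.map_sum_le (t := Finset.range K) (w := fun _ => 1 / (K : ℝ))
    (p := fun k => z (k + 1)) (fun _ _ => by positivity) h1 fun k _ => hz k
  rw [Finset.mul_sum]
  simpa using this

end Ergodic

section Expected

variable {m : ℕ} {n : Fin m → ℕ} {Y : Type*} [NormedAddCommGroup Y] [NormedSpace ℝ Y]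
  {f : (i : Fin m) → EuclideanSpace ℝ (Fin (n i)) → EReal} {Φ : Primal n → Y → ℝ}
  {h : Y → EReal} {φ : Y → ℝ} {U : Set Y} {μ Lxx Lyx : Fin m → ℝ} {Lyy : ℝ}

lemma Problem.lagrR_convexOn (hp : Problem f Φ h φ U μ Lxx Lyx Lyy) (w : Y) :
    ConvexOn ℝ {x : Primal n | ∀ i, f i (x i) ≠ ⊤} fun x => lagrR f Φ h x w := by
  have hc : Convex ℝ {x : Primal n | ∀ i, f i (x i) ≠ ⊤} := fun x hx y hy a b ha hb hab i =>
    ((hp.f_convex i).combo (hx i) (hy i) ha hb hab).1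
  refine ⟨hc, fun x hx y hy a b ha hb hab => ?_⟩
  have h1 := (hp.Φ_convex w).2 (mem_univ x) (mem_univ y) ha hb hab
  have h2 : ∑ i, (f i ((a • x + b • y) i)).toReal
      ≤ ∑ i, (a * (f i (x i)).toReal + b * (f i (y i)).toReal) :=
    Finset.sum_le_sum fun i _ =>
      ((hp.f_convex i).toReal_convexOn (hp.μ_nonneg i)).2 (hx i) (hy i) ha hb hab
  rw [Finset.sum_add_distrib, ← Finset.mul_sum, ← Finset.mul_sum] at h2
  unfold lagrR
  simp only [smul_eq_mul] at h1 ⊢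
  have h3 : (h w).toReal = a * (h w).toReal + b * (h w).toReal := by
    rw [← add_mul, hab, one_mul]
  linarith

lemma Problem.lagrR_concaveOn (hp : Problem f Φ h φ U μ Lxx Lyx Lyy) (u : Primal n) :
    ConcaveOn ℝ {y : Y | h y ≠ ⊤} fun y => lagrR f Φ h u y := by
  have h0 := hp.h_convex.toReal_convexOn le_rfl
  refine ⟨h0.1, fun x hx y hy a b ha hb hab => ?_⟩
  have h1 := (hp.Φ_concave u).2 (mem_univ x) (mem_univ y) ha hb hab
  have h2 := h0.2 hx hy ha hb hab
  unfold lagrR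
  simp only [smul_eq_mul] at h1 h2 ⊢
  have h3 : ∑ i, (f i (u i)).toReal
      = a * ∑ i, (f i (u i)).toReal + b * ∑ i, (f i (u i)).toReal := by
    rw [← add_mul, hab, one_mul]
  linarith

variable {Ω : Type*}
  {τ : ℕ → Fin m → ℝ} {σ θ : ℕ → ℝ} {I : ℕ → Ω → Fin m} {x0 : Primal n} {y0 : Y}
  {x : ℕ → Ω → Primal n} {y : ℕ → Ω → Y} {z : ℕ → Ω → Primal n}

lemma Problem.gap_ergodic (hp : Problem f Φ h φ U μ Lxx Lyx Lyy)
    (hr : Run f Φ h φ U τ σ θ I x0 y0 x y z) (ω : Ω) {K : ℕ} (hK : 1 ≤ K) :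
    (∀ i, f i (ergodic (fun k => x k ω) K i) ≠ ⊤) ∧ h (ergodic (fun k => y k ω) K) ≠ ⊤ ∧
    ∀ u w, lagrR f Φ h (ergodic (fun k => x k ω) K) w - lagrR f Φ h u (ergodic (fun k => y k ω) K)
      ≤ 1 / K * ∑ k ∈ Finset.range K,
        (lagrR f Φ h (x (k + 1) ω) w - lagrR f Φ h u (y (k + 1) ω)) := by
  refine ⟨(ergodic_mem_and_le (hp.lagrR_convexOn 0) (z := fun k => x k ω)
    (fun k => hr.x_dom _ ω) hK).1, (ergodic_mem_and_le (hp.lagrR_concaveOn x0).neg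
      (z := fun k => y k ω) (fun k => hr.y_dom _ ω) hK).1, fun u w => ?_⟩
  have h1 := (ergodic_mem_and_le (hp.lagrR_convexOn w) (z := fun k => x k ω)
    (fun k => hr.x_dom _ ω) hK).2
  have h2 := (ergodic_mem_and_le (hp.lagrR_concaveOn u).neg
      (z := fun k => y k ω) (fun k => hr.y_dom _ ω) hK).2
  simp only [Pi.neg_apply, Finset.sum_neg_distrib] at h2
  rw [Finset.sum_sub_distrib, mul_sub]
  linarith

lemma Run.ergodic_det (hr : Run f Φ h φ U τ σ θ I x0 y0 x y z) (K : ℕ) :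
    Determined I K (fun ω => ergodic (fun k => x k ω) K) ∧
    Determined I K (fun ω => ergodic (fun k => y k ω) K) := by
  constructor
  · exact (Determined.sum fun k hk => (hr.x_det (k + 1)).mono
      (Finset.mem_range.1 hk)).comp fun s => (1 / (K : ℝ)) • s
  · exact (Determined.sum fun k hk => (hr.y_det (k + 1)).mono
      (Finset.mem_range.1 hk)).comp fun s => (1 / (K : ℝ)) • s

lemma Run.momentum_bound (hr : Run f Φ h φ U τ σ θ I x0 y0 x y z)
    (hp : Problem f Φ h φ U μ Lxx Lyx Lyy) {α β : ℕ → ℝ} (hα : ∀ k, 0 < α k)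
    (hβ : ∀ k, 0 ≤ β k) (hβ' : ∀ k, β (k + 1) = 0 → Lyy = 0) (k : ℕ) (ω : Ω) (d : Y) :
    |(gradY Φ (x k ω) (y k ω) - gradY Φ (x (k - 1) ω) (y (k - 1) ω)) d|
      ≤ inertia Lyx Lyy (α k) (β k) (x k ω) (x (k - 1) ω) (y k ω) (y (k - 1) ω)
        + (α k + β k) / 2 * ‖d‖ ^ 2 := by
  rcases k with _ | k
  · have := hα 0
    have := hβ 0
    simp only [Nat.zero_sub, sub_self, zero_apply, abs_zero, inertia, norm_zero]
    simp only [ne_eq, OfNat.ofNat_ne_zero, not_false_eq_true, zero_pow, mul_zero,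
      Finset.sum_const_zero, add_zero, zero_add]
    positivity
  · rw [Nat.add_sub_cancel, hr.x_succ]
    exact hp.momentum_bound _ _ _ _ _ (hα _) (hβ _) (hβ' k)

/-- The quantity dissipated at step `k` that is known before the index of step `k` is drawn. -/
noncomputable def dissip (f : (i : Fin m) → EuclideanSpace ℝ (Fin (n i)) → EReal)
    (Φ : Primal n → Y → ℝ) (h : Y → EReal) (Lxx Lyx : Fin m → ℝ) (Lyy : ℝ)
    (τ : ℕ → Fin m → ℝ) (σ θ α β : ℕ → ℝ) (x : ℕ → Ω → Primal n) (y : ℕ → Ω → Y)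
    (z : ℕ → Ω → Primal n) (u : Primal n) (w : Y) (k : ℕ) (ω : Ω) : ℝ :=
  (lagrR f Φ h u w - lagrR f Φ h u (y (k + 1) ω))
    + slackY m Lyy (σ k) (θ k) (α k) (β k) (β (k + 1)) * ‖y (k + 1) ω - y k ω‖ ^ 2
    + (m * θ k - (m - 1)) * defect Φ (x k ω) (y k ω) w
    + ∑ i, slackX Lxx Lyx (τ k) (α (k + 1)) i * ‖z k ω i - x k ω i‖ ^ 2

lemma Run.dissip_det (hr : Run f Φ h φ U τ σ θ I x0 y0 x y z) (α β : ℕ → ℝ) (u : Primal n) (w : Y)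
    (k : ℕ) : Determined I k (dissip f Φ h Lxx Lyx Lyy τ σ θ α β x y z u w k) := by
  intro ω ω' hω
  unfold dissip
  rw [hr.x_det k ω ω' hω, hr.y_det k ω ω' hω, hr.y_det_succ k ω ω' hω, hr.z_det k ω ω' hω]

lemma Run.pot_det (hr : Run f Φ h φ U τ σ θ I x0 y0 x y z) (ν : Fin m → ℝ) (τ' : Fin m → ℝ)
    (σ' θ' α' β' : ℝ) (u : Primal n) (w : Y) (k : ℕ) :
    Determined I k fun ω => pot f Φ h φ ν Lyx Lyy τ' σ' θ' α' β'
      (x k ω) (x (k - 1) ω) (y k ω) (y (k - 1) ω) u w := by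
  intro ω ω' hω
  have hω' : ∀ j < k - 1, I j ω = I j ω' := fun j hj => hω j (by omega)
  simp only
  rw [hr.x_det k ω ω' hω, hr.y_det k ω ω' hω, hr.x_det _ ω ω' hω', hr.y_det _ ω ω' hω']

variable [MeasurableSpace Ω] {P : Measure Ω} [IsProbabilityMeasure P]

/-- The weight A, known before the draw, makes this a conditional statement. The next parameters τ',
σ', θ', t' are free, so that an artificial last step can be inserted later. -/
lemma Run.expected_decrease [NeZero m] (hI : UniformBlocks P I)
    (hr : Run f Φ h φ U τ σ θ I x0 y0 x y z)
    (hp : Problem f Φ h φ U μ Lxx Lyx Lyy) {ν : Fin m → ℝ} (hν : ∀ i, ν i ≤ μ i)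
    {α β : ℕ → ℝ} (hα : ∀ k, 0 < α k) (hβ : ∀ k, 0 ≤ β k) (hβ' : ∀ k, β (k + 1) = 0 → Lyy = 0)
    {k : ℕ} {t : ℝ} {τ' : Fin m → ℝ} {σ' θ' t' : ℝ}
    (hs : StepOK ν Lxx Lyx Lyy (τ k) (σ k) (θ k) t (α k) (β k) τ' σ' θ' t' (α (k + 1)) (β (k + 1)))
    {u : Primal n} {w : Y} (hu : ∀ i, f i (u i) ≠ ⊤) (hw : h w ≠ ⊤)
    {A : Ω → ℝ} (hA : Determined I k A) (hA0 : ∀ ω, 0 ≤ A ω) :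
    ∫ ω, A ω * (t' * pot f Φ h φ ν Lyx Lyy τ' σ' θ' (α (k + 1)) (β (k + 1))
        (x (k + 1) ω) (x k ω) (y (k + 1) ω) (y k ω) u w
      + (t * m - t' * (m - 1)) * (lagrR f Φ h (x (k + 1) ω) w - lagrR f Φ h u w)
      + t * dissip f Φ h Lxx Lyx Lyy τ σ θ α β x y z u w k ω) ∂P
    ≤ ∫ ω, A ω * (t * pot f Φ h φ ν Lyx Lyy (τ k) (σ k) (θ k) (α k) (β k)
        (x k ω) (x (k - 1) ω) (y k ω) (y (k - 1) ω) u w) ∂P := by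
  have hm : (0 : ℝ) < m := by exact_mod_cast NeZero.pos m
  let W : Fin m → Ω → ℝ := fun i ω =>
    A ω * (t' * pot f Φ h φ ν Lyx Lyy τ' σ' θ' (α (k + 1)) (β (k + 1))
        (Function.update (x k ω) i (z k ω i)) (x k ω) (y (k + 1) ω) (y k ω) u w
      + (t * m - t' * (m - 1))
        * (lagrR f Φ h (Function.update (x k ω) i (z k ω i)) w - lagrR f Φ h u w)
      + t * dissip f Φ h Lxx Lyx Lyy τ σ θ α β x y z u w k ω)
  have hW : ∀ i, Determined I k (W i) := by
    intro i ω ω' hω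
    simp only [W]
    rw [hA ω ω' hω, hr.x_det k ω ω' hω, hr.y_det k ω ω' hω, hr.y_det_succ k ω ω' hω,
      hr.z_det k ω ω' hω, hr.dissip_det α β u w k ω ω' hω]
  have h1 := hI.integral_select_sum hW
  have h2 : ∀ ω, ∑ i, W i ω ≤ m * (A ω * (t * pot f Φ h φ ν Lyx Lyy (τ k) (σ k) (θ k) (α k) (β k)
        (x k ω) (x (k - 1) ω) (y k ω) (y (k - 1) ω) u w)) := by
    intro ω
    have h3 := hp.potential_decrease hν hs (hr.y_mem k ω) (hr.z_min k ω) (hr.y_min k ω) hu hw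
      (hr.momentum_bound hp hα hβ hβ' k ω)
    refine le_trans (le_of_eq ?_) ((mul_le_mul_of_nonneg_left h3 (hA0 ω)).trans (le_of_eq ?_))
    · simp only [W]
      rw [← Finset.mul_sum]
      congr 1
      simp only [Finset.sum_add_distrib, Finset.sum_const, Finset.card_univ, Fintype.card_fin,
        nsmul_eq_mul, ← Finset.mul_sum]
      unfold dissip
      ring
    · ring
  have hpotdet := hr.pot_det (Lyx := Lyx) (Lyy := Lyy) ν (τ k) (σ k) (θ k) (α k) (β k) u w k
  have hR : Determined I k (fun ω => A ω * (t * pot f Φ h φ ν Lyx Lyy (τ k) (σ k) (θ k) (α k) (β k)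
        (x k ω) (x (k - 1) ω) (y k ω) (y (k - 1) ω) u w)) :=
    hA.comp₂ hpotdet fun a b => a * (t * b)
  have h4 : ∫ ω, ∑ i, W i ω ∂P ≤ ∫ ω, m * (A ω * (t * pot f Φ h φ ν Lyx Lyy (τ k) (σ k) (θ k)
      (α k) (β k) (x k ω) (x (k - 1) ω) (y k ω) (y (k - 1) ω) u w)) ∂P :=
    integral_mono ((Determined.sum fun i _ => hW i).integrable hI.meas)
      ((hR.comp fun a => m * a).integrable hI.meas) h2
  rw [← h1, integral_const_mul] at h4
  have h5 := le_of_mul_le_mul_left h4 hm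
  refine le_trans (le_of_eq ?_) h5
  refine integral_congr_ae (Eventually.of_forall fun ω => ?_)
  simp only [W]
  rw [hr.x_succ k ω]

end Expected

/-! ### Summation over the iterations -/

section Summation

variable {m : ℕ} {n : Fin m → ℕ} {Y : Type*} [NormedAddCommGroup Y] [NormedSpace ℝ Y]
  {f : (i : Fin m) → EuclideanSpace ℝ (Fin (n i)) → EReal} {Φ : Primal n → Y → ℝ}
  {h : Y → EReal} {φ : Y → ℝ} {U : Set Y} {ν μ Lxx Lyx : Fin m → ℝ} {Lyy : ℝ}
  {Ω : Type*}
  {τ : ℕ → Fin m → ℝ} {σ θ t α β : ℕ → ℝ} {I : ℕ → Ω → Fin m} {x0 : Primal n} {y0 : Y}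
  {x : ℕ → Ω → Primal n} {y : ℕ → Ω → Y} {z : ℕ → Ω → Primal n}

/-- The step-size condition with explicit auxiliary sequences `α` and `β`. -/
structure StepSeq (ν Lxx Lyx : Fin m → ℝ) (Lyy : ℝ) (τ : ℕ → Fin m → ℝ) (σ θ t α β : ℕ → ℝ) :
    Prop where
  τ_pos : ∀ k i, 0 < τ k i
  α_pos : ∀ k, 0 < α k
  β_nonneg : ∀ k, 0 ≤ β k
  β_zero : ∀ k, β (k + 1) = 0 → Lyy = 0
  θ_zero : θ 0 = 1
  t_zero : t 0 = 1
  step : ∀ k, StepOK ν Lxx Lyx Lyy (τ k) (σ k) (θ k) (t k) (α k) (β k)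
    (τ (k + 1)) (σ (k + 1)) (θ (k + 1)) (t (k + 1)) (α (k + 1)) (β (k + 1))

lemma StepCond.exists_stepSeq [NeZero m] (hs : StepCond ν Lxx Lyx Lyy τ σ θ t) :
    ∃ α β, StepSeq ν Lxx Lyx Lyy τ σ θ t α β := by
  obtain ⟨hτ, hσ, hθ, hθ0, ht0, ⟨α, β, hα, hβ, hβ', hx, hy⟩, h1, h2, h3⟩ := hs
  have hm : (1 : ℝ) ≤ m := by exact_mod_cast NeZero.one_le
  have hm1 : (1 : ℝ) / m ≤ 1 := by rw [div_le_one (by linarith)]; exact hm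
  have hθn : ∀ k, 0 ≤ θ k := fun k => by linarith [(hθ k).1]
  -- A nonpositive `t (k + 1)` would contradict `t (k + 1) * θ (k + 1) = t k` with θ nonnegative.
  have ht : ∀ k, 0 < t k := by
    intro k
    induction k with
    | zero => rw [ht0]; exact one_pos
    | succ k ih =>
      by_contra hcon
      push Not at hcon
      have := mul_nonpos_of_nonpos_of_nonneg hcon (hθn (k + 1))
      rw [h3] at this
      linarith
  refine ⟨α, β, hτ, hα, hβ, hβ', hθ0, ht0, fun k => ⟨hσ k, ?_, hθn k, ht k, hα _, hβ _, hx k, hy k,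
    h3 k, h1 k, h2 k⟩⟩
  have h4 := mul_le_mul_of_nonneg_left (hθ k).1 (show (0 : ℝ) ≤ m by linarith)
  have h5 : (m : ℝ) * (1 - 1 / m) = m - 1 := by field_simp
  linarith

/-- The weight equals `t (k + 1) * (m * θ (k + 1) - (m - 1))`; its sign is the purpose of θ ≥ 1 -
1/m. -/
lemma StepSeq.weight_nonneg (hs : StepSeq ν Lxx Lyx Lyy τ σ θ t α β) (k : ℕ) :
    0 ≤ t k * m - t (k + 1) * (m - 1) := by
  have h1 := (hs.step (k + 1)).θ_ge
  have h2 := mul_le_mul_of_nonneg_left h1 (hs.step (k + 1)).t_pos.le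
  rw [← (hs.step k).t_mul]
  linarith

lemma StepOK.slackX_nonneg {τ τ' : Fin m → ℝ} {σ θ t α β σ' θ' t' α' β' : ℝ}
    (hs : StepOK ν Lxx Lyx Lyy τ σ θ t α β τ' σ' θ' t' α' β') (i : Fin m) :
    0 ≤ slackX Lxx Lyx τ α' i := by
  have := hs.primal i
  unfold slackX
  linarith

lemma StepOK.slackY_nonneg {τ τ' : Fin m → ℝ} {σ θ t α β σ' θ' t' α' β' : ℝ}
    (hs : StepOK ν Lxx Lyx Lyy τ σ θ t α β τ' σ' θ' t' α' β') :
    0 ≤ slackY m Lyy σ θ α β β' := by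
  have := hs.dual
  unfold slackY
  linarith

lemma StepOK.dual_coeff_nonneg {τ τ' : Fin m → ℝ} {σ θ t α β σ' θ' t' α' β' : ℝ}
    (hs : StepOK ν Lxx Lyx Lyy τ σ θ t α β τ' σ' θ' t' α' β') :
    0 ≤ 1 / σ - m * θ * (α + β) := by
  have := hs.dual
  have h2 : 0 ≤ (m : ℝ) * Lyy ^ 2 / β' := by have := hs.β'_nonneg; positivity
  linarith

lemma wsq_nonneg {d : Fin m → ℝ} (hd : ∀ i, 0 ≤ d i) (v : Primal n) : 0 ≤ wsq d v :=
  Finset.sum_nonneg fun i _ => mul_nonneg (hd i) (sq_nonneg _)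

/-- The Lyapunov function along a run. -/
noncomputable def potAt (f : (i : Fin m) → EuclideanSpace ℝ (Fin (n i)) → EReal)
    (Φ : Primal n → Y → ℝ) (h : Y → EReal) (φ : Y → ℝ) (ν Lyx : Fin m → ℝ) (Lyy : ℝ)
    (τ : ℕ → Fin m → ℝ) (σ θ α β : ℕ → ℝ) (x : ℕ → Ω → Primal n) (y : ℕ → Ω → Y)
    (u : Primal n) (w : Y) (k : ℕ) (ω : Ω) : ℝ :=
  pot f Φ h φ ν Lyx Lyy (τ k) (σ k) (θ k) (α k) (β k) (x k ω) (x (k - 1) ω) (y k ω) (y (k - 1) ω)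
    u w

lemma Run.potAt_det (hr : Run f Φ h φ U τ σ θ I x0 y0 x y z) (ν : Fin m → ℝ) (α β : ℕ → ℝ)
    (u : Primal n) (w : Y) (k : ℕ) :
    Determined I k (potAt f Φ h φ ν Lyx Lyy τ σ θ α β x y u w k) :=
  hr.pot_det ν _ _ _ _ _ u w k

lemma Run.potAt_lower (hr : Run f Φ h φ U τ σ θ I x0 y0 x y z)
    (hp : Problem f Φ h φ U μ Lxx Lyx Lyy) (hs : StepSeq ν Lxx Lyx Lyy τ σ θ t α β)
    (u : Primal n) (w : Y) (k : ℕ) (ω : Ω) :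
    1 / 2 * wsq (fun i => m / τ k i + (m - 1) * ν i) (u - x k ω)
      + (1 / σ k - m * θ k * (α k + β k)) * breg φ w (y k ω)
      + m * θ k * defect Φ (x k ω) (y k ω) w
      + (m - 1) * (lagrR f Φ h (x k ω) w - lagrR f Φ h u w)
    ≤ potAt f Φ h φ ν Lyx Lyy τ σ θ α β x y u w k ω :=
  hp.pot_lower (hr.y_mem k ω) (hs.step k).θ_nonneg
    (add_nonneg (hs.α_pos k).le (hs.β_nonneg k))
    (hr.momentum_bound hp hs.α_pos hs.β_nonneg hs.β_zero k ω)

lemma IsSaddleR.lagr_sub_nonneg {u : Primal n} {w : Y} (hS : IsSaddleR f Φ h u w)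
    (hr : Run f Φ h φ U τ σ θ I x0 y0 x y z) (k : ℕ) (ω : Ω) :
    0 ≤ lagrR f Φ h (x k ω) w - lagrR f Φ h u w := by
  linarith [hS.le_right _ (hr.x_dom k ω)]

lemma IsSaddleR.sub_lagr_nonneg {u : Primal n} {w : Y} (hS : IsSaddleR f Φ h u w)
    (hr : Run f Φ h φ U τ σ θ I x0 y0 x y z) (k : ℕ) (ω : Ω) :
    0 ≤ lagrR f Φ h u w - lagrR f Φ h u (y (k + 1) ω) := by
  linarith [hS.le_left _ (hr.y_dom k ω)]

lemma Run.potAt_lower_saddle [NeZero m] (hr : Run f Φ h φ U τ σ θ I x0 y0 x y z)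
    (hp : Problem f Φ h φ U μ Lxx Lyx Lyy) (hs : StepSeq ν Lxx Lyx Lyy τ σ θ t α β)
    {u : Primal n} {w : Y} (hS : IsSaddleR f Φ h u w) (k : ℕ) (ω : Ω) :
    1 / 2 * wsq (fun i => m / τ k i + (m - 1) * ν i) (u - x k ω)
      + (1 / σ k - m * θ k * (α k + β k)) * breg φ w (y k ω)
    ≤ potAt f Φ h φ ν Lyx Lyy τ σ θ α β x y u w k ω := by
  have hm : (1 : ℝ) ≤ m := by exact_mod_cast NeZero.one_le
  refine le_trans ?_ (hr.potAt_lower hp hs u w k ω)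
  have h1 := mul_nonneg (show (0 : ℝ) ≤ m - 1 by linarith) (hS.lagr_sub_nonneg hr k ω)
  have h2 : 0 ≤ m * θ k * defect Φ (x k ω) (y k ω) w :=
    mul_nonneg (mul_nonneg (by linarith) (hs.step k).θ_nonneg) (hp.defect_nonneg _ _ _)
  linarith

lemma primal_weight_nonneg [NeZero m] {τ : Fin m → ℝ} (hτ : ∀ i, 0 < τ i) (hν : ∀ i, 0 ≤ ν i)
    (i : Fin m) : 0 ≤ m / τ i + (m - 1) * ν i := by
  have hm : (1 : ℝ) ≤ m := by exact_mod_cast NeZero.one_le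
  have := hτ i
  have := mul_nonneg (show (0 : ℝ) ≤ m - 1 by linarith) (hν i)
  positivity

lemma Run.potAt_nonneg [NeZero m] (hr : Run f Φ h φ U τ σ θ I x0 y0 x y z)
    (hp : Problem f Φ h φ U μ Lxx Lyx Lyy) (hν : ∀ i, 0 ≤ ν i)
    (hs : StepSeq ν Lxx Lyx Lyy τ σ θ t α β)
    {u : Primal n} {w : Y} (hS : IsSaddleR f Φ h u w) (k : ℕ) (ω : Ω) :
    0 ≤ potAt f Φ h φ ν Lyx Lyy τ σ θ α β x y u w k ω := by
  refine le_trans ?_ (hr.potAt_lower_saddle hp hs hS k ω)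
  have h1 := wsq_nonneg (primal_weight_nonneg (hs.τ_pos k) hν) (u - x k ω)
  have h2 := mul_nonneg (hs.step k).dual_coeff_nonneg (hp.breg_nonneg (hr.y_mem k ω) w)
  linarith

lemma Run.dissip_ge [NeZero m] (hr : Run f Φ h φ U τ σ θ I x0 y0 x y z)
    (hp : Problem f Φ h φ U μ Lxx Lyx Lyy)
    (hs : StepSeq ν Lxx Lyx Lyy τ σ θ t α β)
    {u : Primal n} {w : Y} (hS : IsSaddleR f Φ h u w) (k : ℕ) (ω : Ω) :
    lagrR f Φ h u w - lagrR f Φ h u (y (k + 1) ω)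
      ≤ dissip f Φ h Lxx Lyx Lyy τ σ θ α β x y z u w k ω
    ∧ slackY m Lyy (σ k) (θ k) (α k) (β k) (β (k + 1)) * ‖y (k + 1) ω - y k ω‖ ^ 2
      ≤ dissip f Φ h Lxx Lyx Lyy τ σ θ α β x y z u w k ω
    ∧ (m * θ k - (m - 1)) * defect Φ (x k ω) (y k ω) w
      + (lagrR f Φ h u w - lagrR f Φ h u (y (k + 1) ω))
      ≤ dissip f Φ h Lxx Lyx Lyy τ σ θ α β x y z u w k ω
    ∧ ∑ i, slackX Lxx Lyx (τ k) (α (k + 1)) i * ‖z k ω i - x k ω i‖ ^ 2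
      ≤ dissip f Φ h Lxx Lyx Lyy τ σ θ α β x y z u w k ω
    ∧ 0 ≤ dissip f Φ h Lxx Lyx Lyy τ σ θ α β x y z u w k ω := by
  have h1 := hS.sub_lagr_nonneg hr k ω
  have h2 := mul_nonneg (hs.step k).slackY_nonneg (sq_nonneg ‖y (k + 1) ω - y k ω‖)
  have h3 := mul_nonneg (show (0 : ℝ) ≤ m * θ k - (m - 1) by linarith [(hs.step k).θ_ge])
    (hp.defect_nonneg (x k ω) (y k ω) w)
  have h4 : 0 ≤ ∑ i, slackX Lxx Lyx (τ k) (α (k + 1)) i * ‖z k ω i - x k ω i‖ ^ 2 :=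
    Finset.sum_nonneg fun i _ => mul_nonneg ((hs.step k).slackX_nonneg i) (sq_nonneg _)
  unfold dissip
  refine ⟨?_, ?_, ?_, ?_, ?_⟩ <;> linarith

/-- The quantity dissipated at step `k`. -/
noncomputable def gain (f : (i : Fin m) → EuclideanSpace ℝ (Fin (n i)) → EReal)
    (Φ : Primal n → Y → ℝ) (h : Y → EReal) (Lxx Lyx : Fin m → ℝ) (Lyy : ℝ)
    (τ : ℕ → Fin m → ℝ) (σ θ t α β : ℕ → ℝ) (x : ℕ → Ω → Primal n) (y : ℕ → Ω → Y)
    (z : ℕ → Ω → Primal n) (u : Primal n) (w : Y) (k : ℕ) (ω : Ω) : ℝ :=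
  (t k * m - t (k + 1) * (m - 1)) * (lagrR f Φ h (x (k + 1) ω) w - lagrR f Φ h u w)
    + t k * dissip f Φ h Lxx Lyx Lyy τ σ θ α β x y z u w k ω

lemma Run.gain_det (hr : Run f Φ h φ U τ σ θ I x0 y0 x y z) (t α β : ℕ → ℝ) (u : Primal n) (w : Y)
    (k : ℕ) : Determined I (k + 1) (gain f Φ h Lxx Lyx Lyy τ σ θ t α β x y z u w k) := by
  intro ω ω' hω
  unfold gain
  rw [hr.x_det (k + 1) ω ω' hω, (hr.dissip_det α β u w k).mono (Nat.le_succ k) ω ω' hω]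

lemma Run.gain_ge [NeZero m] (hr : Run f Φ h φ U τ σ θ I x0 y0 x y z)
    (hp : Problem f Φ h φ U μ Lxx Lyx Lyy)
    (hs : StepSeq ν Lxx Lyx Lyy τ σ θ t α β)
    {u : Primal n} {w : Y} (hS : IsSaddleR f Φ h u w) (k : ℕ) (ω : Ω) :
    t k * dissip f Φ h Lxx Lyx Lyy τ σ θ α β x y z u w k ω
      ≤ gain f Φ h Lxx Lyx Lyy τ σ θ t α β x y z u w k ω ∧
    (t k * m - t (k + 1) * (m - 1)) * (lagrR f Φ h (x (k + 1) ω) w - lagrR f Φ h u w)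
      ≤ gain f Φ h Lxx Lyx Lyy τ σ θ t α β x y z u w k ω ∧
    0 ≤ gain f Φ h Lxx Lyx Lyy τ σ θ t α β x y z u w k ω := by
  have h1 := mul_nonneg (hs.weight_nonneg k) (hS.lagr_sub_nonneg hr (k + 1) ω)
  have h2 := mul_nonneg (hs.step k).t_pos.le (hr.dissip_ge hp hs hS k ω).2.2.2.2
  unfold gain
  refine ⟨?_, ?_, ?_⟩ <;> linarith

variable [MeasurableSpace Ω] {P : Measure Ω} [IsProbabilityMeasure P]

lemma Run.weighted_decrease [NeZero m] (hI : UniformBlocks P I)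
    (hr : Run f Φ h φ U τ σ θ I x0 y0 x y z)
    (hp : Problem f Φ h φ U μ Lxx Lyx Lyy) (hν : ∀ i, ν i ≤ μ i)
    (hs : StepSeq ν Lxx Lyx Lyy τ σ θ t α β)
    {u : Primal n} {w : Y} (hu : ∀ i, f i (u i) ≠ ⊤) (hw : h w ≠ ⊤) (k : ℕ)
    {A : Ω → ℝ} (hA : Determined I k A) (hA0 : ∀ ω, 0 ≤ A ω) :
    ∫ ω, A ω * (t (k + 1) * potAt f Φ h φ ν Lyx Lyy τ σ θ α β x y u w (k + 1) ω
      + gain f Φ h Lxx Lyx Lyy τ σ θ t α β x y z u w k ω) ∂P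
    ≤ ∫ ω, A ω * (t k * potAt f Φ h φ ν Lyx Lyy τ σ θ α β x y u w k ω) ∂P := by
  have := hr.expected_decrease hI hp hν hs.α_pos hs.β_nonneg hs.β_zero (hs.step k) hu hw hA hA0
  unfold gain potAt
  simp only [Nat.add_sub_cancel, ← add_assoc]
  exact this

lemma Run.sum_decrease [NeZero m] (hI : UniformBlocks P I)
    (hr : Run f Φ h φ U τ σ θ I x0 y0 x y z)
    (hp : Problem f Φ h φ U μ Lxx Lyx Lyy) (hν : ∀ i, ν i ≤ μ i)
    (hs : StepSeq ν Lxx Lyx Lyy τ σ θ t α β)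
    {u : Primal n} {w : Y} (hu : ∀ i, f i (u i) ≠ ⊤) (hw : h w ≠ ⊤) (K : ℕ) :
    t K * ∫ ω, potAt f Φ h φ ν Lyx Lyy τ σ θ α β x y u w K ω ∂P
      + ∑ k ∈ Finset.range K, ∫ ω, gain f Φ h Lxx Lyx Lyy τ σ θ t α β x y z u w k ω ∂P
    ≤ pot f Φ h φ ν Lyx Lyy (τ 0) (σ 0) 1 (α 0) (β 0) x0 x0 y0 y0 u w := by
  induction K with
  | zero =>
    simp only [Finset.range_zero, Finset.sum_empty, add_zero, hs.t_zero, one_mul]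
    unfold potAt
    simp [hr.init_x, hr.init_y, hs.θ_zero]
  | succ K ih =>
    refine le_trans ?_ ih
    have h1 := hr.weighted_decrease hI hp hν hs hu hw K (A := fun _ => 1) (Determined.const 1)
      fun _ => zero_le_one
    simp only [one_mul] at h1
    have hd := hr.potAt_det (Lyx := Lyx) (Lyy := Lyy) ν α β u w (K + 1)
    rw [integral_add ((hd.comp fun a => t (K + 1) * a).integrable hI.meas)
      ((hr.gain_det t α β u w K).integrable hI.meas), integral_const_mul, integral_const_mul] at h1
    rw [Finset.sum_range_succ]
    linarith

lemma Run.sum_gap_le [NeZero m] (hI : UniformBlocks P I)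
    (hr : Run f Φ h φ U τ σ θ I x0 y0 x y z)
    (hp : Problem f Φ h φ U μ Lxx Lyx Lyy) (hν : ∀ i, ν i ≤ μ i)
    (hs : StepSeq ν Lxx Lyx Lyy τ σ θ t α β)
    {u : Primal n} {w : Y} (hS : IsSaddleR f Φ h u w) {K : ℕ} (hK : 1 ≤ K) (hy0 : y0 ∈ U)
    (hx0 : ∀ i, f i (x0 i) ≠ ⊤) :
    t K * ∫ ω, potAt f Φ h φ ν Lyx Lyy τ σ θ α β x y u w K ω ∂P
      + ∑ k ∈ Finset.range K, ∫ ω, ((t k * m - t (k + 1) * (m - 1))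
          * (lagrR f Φ h (x (k + 1) ω) w - lagrR f Φ h u w)
        + t k * (lagrR f Φ h u w - lagrR f Φ h u (y (k + 1) ω))) ∂P
    ≤ m * Delta f Φ h φ ν Lyy (τ 0) (σ 0) u w x0 y0 := by
  have h1 := hr.sum_decrease hI hp hν hs hS.dom_x hS.dom_y K
  have h2 := hp.pot_init (ν := ν) (τ := τ 0) (σ := σ 0) (α := α 0) (β := β 0) hy0 hx0 hS.dom_x
    hS.dom_y
  have h3 : ∀ k ω, (t k * m - t (k + 1) * (m - 1))
          * (lagrR f Φ h (x (k + 1) ω) w - lagrR f Φ h u w)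
        + t k * (lagrR f Φ h u w - lagrR f Φ h u (y (k + 1) ω))
        + (if k = 0 then defect Φ x0 y0 w else 0)
      ≤ gain f Φ h Lxx Lyx Lyy τ σ θ t α β x y z u w k ω := by
    intro k ω
    have h4 := hr.dissip_ge hp hs hS k ω
    unfold gain
    rcases k with _ | k
    · have h5 := h4.2.2.1
      rw [hs.θ_zero, hr.init_x, hr.init_y] at h5
      rw [if_pos rfl, hs.t_zero]
      linarith
    · rw [if_neg (by omega), add_zero]
      have := mul_le_mul_of_nonneg_left h4.1 (hs.step (k + 1)).t_pos.le
      linarith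
  have h5 : ∀ k ∈ Finset.range K, ∫ ω, ((t k * m - t (k + 1) * (m - 1))
          * (lagrR f Φ h (x (k + 1) ω) w - lagrR f Φ h u w)
        + t k * (lagrR f Φ h u w - lagrR f Φ h u (y (k + 1) ω))) ∂P
        + (if k = 0 then defect Φ x0 y0 w else 0)
      ≤ ∫ ω, gain f Φ h Lxx Lyx Lyy τ σ θ t α β x y z u w k ω ∂P := by
    intro k _
    have hd : Determined I (k + 1) fun ω => (t k * m - t (k + 1) * (m - 1))
          * (lagrR f Φ h (x (k + 1) ω) w - lagrR f Φ h u w)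
        + t k * (lagrR f Φ h u w - lagrR f Φ h u (y (k + 1) ω)) :=
      (hr.x_det (k + 1)).comp₂ (hr.y_det (k + 1)) fun a b => (t k * m - t (k + 1) * (m - 1))
          * (lagrR f Φ h a w - lagrR f Φ h u w)
        + t k * (lagrR f Φ h u w - lagrR f Φ h u b)
    have h6 := integral_mono
      ((hd.comp fun a => a + (if k = 0 then defect Φ x0 y0 w else 0)).integrable hI.meas (P := P))
      ((hr.gain_det t α β u w k).integrable hI.meas) (h3 k)
    rw [integral_add (hd.integrable hI.meas) (integrable_const _)] at h6
    simpa using h6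
  have h7 := Finset.sum_le_sum h5
  rw [Finset.sum_add_distrib, Finset.sum_ite_eq' (Finset.range K) 0,
    if_pos (Finset.mem_range.2 hK)] at h7
  linarith

lemma Run.potAt_le [NeZero m] (hI : UniformBlocks P I)
    (hr : Run f Φ h φ U τ σ θ I x0 y0 x y z)
    (hp : Problem f Φ h φ U μ Lxx Lyx Lyy) (hν : ∀ i, ν i ≤ μ i)
    (hs : StepSeq ν Lxx Lyx Lyy τ σ θ t α β)
    {u : Primal n} {w : Y} (hS : IsSaddleR f Φ h u w) {K : ℕ} (hK : 1 ≤ K) (hy0 : y0 ∈ U)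
    (hx0 : ∀ i, f i (x0 i) ≠ ⊤) :
    t K * ∫ ω, potAt f Φ h φ ν Lyx Lyy τ σ θ α β x y u w K ω ∂P
    ≤ m * Delta f Φ h φ ν Lyy (τ 0) (σ 0) u w x0 y0 := by
  refine le_trans (le_add_of_nonneg_right ?_) (hr.sum_gap_le hI hp hν hs hS hK hy0 hx0)
  refine Finset.sum_nonneg fun k _ => integral_nonneg fun ω => ?_
  have h1 := mul_nonneg (hs.weight_nonneg k) (hS.lagr_sub_nonneg hr (k + 1) ω)
  have h2 := mul_nonneg (hs.step k).t_pos.le (hS.sub_lagr_nonneg hr k ω)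
  exact add_nonneg h1 h2

/-- The ergodic rate. -/
theorem Run.ergodic_rate [NeZero m] (hI : UniformBlocks P I)
    (hr : Run f Φ h φ U τ σ (fun _ => 1) I x0 y0 x y z)
    (hp : Problem f Φ h φ U μ Lxx Lyx Lyy) (hν : ∀ i, ν i ≤ μ i) (hν0 : ∀ i, 0 ≤ ν i)
    (hs : StepSeq ν Lxx Lyx Lyy τ σ (fun _ => 1) (fun _ => 1) α β)
    {u : Primal n} {w : Y} (hS : IsSaddleR f Φ h u w) {K : ℕ} (hK : 1 ≤ K) (hy0 : y0 ∈ U)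
    (hx0 : ∀ i, f i (x0 i) ≠ ⊤) :
    ∃ e : ℝ, HasExpectation P (fun ω => lagr f Φ h (ergodic (fun k => x k ω) K) w
          - lagr f Φ h u (ergodic (fun k => y k ω) K)) e ∧
        0 ≤ e ∧ e ≤ (m : ℝ) / K * Delta f Φ h φ ν Lyy (τ 0) (σ 0) u w x0 y0 := by
  have hK0 : (0 : ℝ) < K := by exact_mod_cast hK
  have hg := fun ω => hp.gap_ergodic hr ω hK
  set r : Ω → ℝ := fun ω => lagrR f Φ h (ergodic (fun k => x k ω) K) w
    - lagrR f Φ h u (ergodic (fun k => y k ω) K) with hrdef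
  have hdet : Determined I K r := (hr.ergodic_det K).1.comp₂ (hr.ergodic_det K).2
    fun a b => lagrR f Φ h a w - lagrR f Φ h u b
  refine ⟨∫ ω, r ω ∂P, ⟨r, Eventually.of_forall fun ω => ?_, hdet.integrable hI.meas, rfl⟩,
    integral_nonneg fun ω => ?_, ?_⟩
  · simp only
    rw [hp.lagr_eq (hg ω).1 hS.dom_y, hp.lagr_eq hS.dom_x (hg ω).2.1, ← EReal.coe_sub]
  · have h1 := hS.le_right _ (hg ω).1
    have h2 := hS.le_left _ (hg ω).2.1
    simp only [hrdef, Pi.zero_apply]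
    linarith
  · have h1 := hr.sum_gap_le hI hp hν hs hS hK hy0 hx0
    have h2 : 0 ≤ ∫ ω, potAt f Φ h φ ν Lyx Lyy τ σ (fun _ => 1) α β x y u w K ω ∂P :=
      integral_nonneg fun ω => hr.potAt_nonneg hp hν0 hs hS K ω
    have hd : ∀ k, Determined I (k + 1) fun ω =>
        lagrR f Φ h (x (k + 1) ω) w - lagrR f Φ h u (y (k + 1) ω) := fun k =>
      (hr.x_det (k + 1)).comp₂ (hr.y_det (k + 1)) fun a b => lagrR f Φ h a w - lagrR f Φ h u b
    have h3 : ∫ ω, r ω ∂P ≤ ∫ ω, 1 / K * ∑ k ∈ Finset.range K,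
        (lagrR f Φ h (x (k + 1) ω) w - lagrR f Φ h u (y (k + 1) ω)) ∂P :=
      integral_mono (hdet.integrable hI.meas)
        (((Determined.sum fun k hk => (hd k).mono (Finset.mem_range.1 hk)).comp
          fun s => 1 / (K : ℝ) * s).integrable hI.meas) fun ω => (hg ω).2.2 u w
    rw [integral_const_mul, integral_finsetSum _ fun k _ => (hd k).integrable hI.meas] at h3
    -- With t = 1 both gaps have weight one, and L(u, w) drops out.
    have h4 : ∀ k ω, (1 * (m : ℝ) - 1 * (m - 1))
          * (lagrR f Φ h (x (k + 1) ω) w - lagrR f Φ h u w)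
        + 1 * (lagrR f Φ h u w - lagrR f Φ h u (y (k + 1) ω))
        = lagrR f Φ h (x (k + 1) ω) w - lagrR f Φ h u (y (k + 1) ω) := fun k ω => by ring
    simp only [h4] at h1
    refine h3.trans ?_
    have e : (m : ℝ) / K * Delta f Φ h φ ν Lyy (τ 0) (σ 0) u w x0 y0
        = 1 / K * (m * Delta f Φ h φ ν Lyy (τ 0) (σ 0) u w x0 y0) := by ring
    rw [e]
    exact mul_le_mul_of_nonneg_left (by linarith) (by positivity)

/-- Bound on the Bregman distance to the dual iterates. -/
theorem Run.dual_bound [NeZero m] (hI : UniformBlocks P I)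
    (hr : Run f Φ h φ U τ σ θ I x0 y0 x y z)
    (hp : Problem f Φ h φ U μ Lxx Lyx Lyy) (hν : ∀ i, ν i ≤ μ i) (hν0 : ∀ i, 0 ≤ ν i)
    (hs : StepSeq ν Lxx Lyx Lyy τ σ θ t α β)
    {u : Primal n} {w : Y} (hS : IsSaddleR f Φ h u w) {K : ℕ} (hK : 1 ≤ K) (hy0 : y0 ∈ U)
    (hx0 : ∀ i, f i (x0 i) ≠ ⊤) :
    Integrable (fun ω => breg φ w (y K ω)) P ∧
    t K * (1 / σ K - m * θ K * (α K + β K)) * ∫ ω, breg φ w (y K ω) ∂P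
      ≤ m * Delta f Φ h φ ν Lyy (τ 0) (σ 0) u w x0 y0 := by
  have hd : Determined I K fun ω => breg φ w (y K ω) := (hr.y_det K).comp fun b => breg φ w b
  refine ⟨hd.integrable hI.meas, ?_⟩
  refine le_trans ?_ (hr.potAt_le hI hp hν hs hS hK hy0 hx0)
  rw [mul_assoc, ← integral_const_mul]
  refine mul_le_mul_of_nonneg_left ?_ (hs.step K).t_pos.le
  refine integral_mono ((hd.comp fun b => _ * b).integrable hI.meas)
    ((hr.potAt_det ν α β u w K).integrable hI.meas) fun ω => ?_
  have := hr.potAt_lower_saddle hp hs hS K ω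
  have h2 := wsq_nonneg (primal_weight_nonneg (hs.τ_pos K) hν0) (u - x K ω)
  simp only
  linarith

lemma Run.primal_bound [NeZero m] (hI : UniformBlocks P I)
    (hr : Run f Φ h φ U τ σ θ I x0 y0 x y z)
    (hp : Problem f Φ h φ U μ Lxx Lyx Lyy) (hν : ∀ i, ν i ≤ μ i)
    (hs : StepSeq ν Lxx Lyx Lyy τ σ θ t α β)
    {u : Primal n} {w : Y} (hS : IsSaddleR f Φ h u w) {K : ℕ} (hK : 1 ≤ K) (hy0 : y0 ∈ U)
    (hx0 : ∀ i, f i (x0 i) ≠ ⊤) :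
    t K * ∫ ω, 1 / 2 * wsq (fun i => m / τ K i + (m - 1) * ν i) (u - x K ω) ∂P
      ≤ m * Delta f Φ h φ ν Lyy (τ 0) (σ 0) u w x0 y0 := by
  have hd : Determined I K fun ω =>
      1 / 2 * wsq (fun i => m / τ K i + (m - 1) * ν i) (u - x K ω) :=
    (hr.x_det K).comp fun b => 1 / 2 * wsq (fun i => m / τ K i + (m - 1) * ν i) (u - b)
  refine le_trans ?_ (hr.potAt_le hI hp hν hs hS hK hy0 hx0)
  refine mul_le_mul_of_nonneg_left ?_ (hs.step K).t_pos.le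
  refine integral_mono (hd.integrable hI.meas)
    ((hr.potAt_det ν α β u w K).integrable hI.meas) fun ω => ?_
  have := hr.potAt_lower_saddle hp hs hS K ω
  have h2 := mul_nonneg (hs.step K).dual_coeff_nonneg (hp.breg_nonneg (hr.y_mem K ω) w)
  simp only
  linarith

lemma wsq_neg (d : Fin m → ℝ) (u v : Primal n) : wsq d (u - v) = wsq d (v - u) := by
  unfold wsq
  refine Finset.sum_congr rfl fun i _ => ?_
  rw [Pi.sub_apply, Pi.sub_apply, norm_sub_rev]

lemma Problem.Delta_nonneg [NeZero m] (hp : Problem f Φ h φ U μ Lxx Lyx Lyy)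
    (hν0 : ∀ i, 0 ≤ ν i) {τ : Fin m → ℝ} {σ : ℝ} (hτ : ∀ i, 0 < τ i) (hσ : 0 < σ)
    {u : Primal n} {w : Y} (hS : IsSaddleR f Φ h u w) (hy0 : y0 ∈ U)
    (hx0 : ∀ i, f i (x0 i) ≠ ⊤) : 0 ≤ Delta f Φ h φ ν Lyy τ σ u w x0 y0 := by
  have hm : (1 : ℝ) ≤ m := by exact_mod_cast NeZero.one_le
  have hm1 : (0 : ℝ) ≤ 1 - 1 / m := by rw [sub_nonneg, div_le_one (by linarith)]; exact hm
  have h4 : (lagr f Φ h x0 w - lagr f Φ h u w).toReal = lagrR f Φ h x0 w - lagrR f Φ h u w := by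
    rw [hp.lagr_eq hx0 hS.dom_y, hp.lagr_eq hS.dom_x hS.dom_y, ← EReal.coe_sub, EReal.toReal_coe]
  have h5 := hS.le_right x0 hx0
  have h6 := hp.breg_nonneg hy0 w
  have h7 := hp.Lyy_nonneg
  have h8 : 0 ≤ wsq (fun i => 1 / τ i + (1 - 1 / (m : ℝ)) * ν i) (u - x0) :=
    wsq_nonneg (fun i => by have := hτ i; have := hν0 i; positivity) _
  unfold Delta
  rw [h4]
  have h9 : 0 ≤ (1 - 1 / (m : ℝ)) * (lagrR f Φ h x0 w - lagrR f Φ h u w) :=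
    mul_nonneg hm1 (by linarith)
  positivity

/-- The bound on the primal iterates in terms of the weights of the previous step. -/
theorem Run.primal_rate [NeZero m] (hI : UniformBlocks P I)
    (hr : Run f Φ h φ U τ σ θ I x0 y0 x y z)
    (hp : Problem f Φ h φ U μ Lxx Lyx Lyy) (hν : ∀ i, ν i ≤ μ i) (hν0 : ∀ i, 0 ≤ ν i)
    (hs : StepSeq ν Lxx Lyx Lyy τ σ θ t α β)
    {u : Primal n} {w : Y} (hS : IsSaddleR f Φ h u w) {K : ℕ} (hK : 1 ≤ K) (hy0 : y0 ∈ U)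
    (hx0 : ∀ i, f i (x0 i) ≠ ⊤) :
    Integrable (fun ω => 1 / 2 *
      wsq (fun i => 1 / τ K i + (1 - 1 / (m : ℝ)) * ν i) (x (K + 1) ω - u)) P ∧
    ∫ ω, 1 / 2 * wsq (fun i => 1 / τ K i + (1 - 1 / (m : ℝ)) * ν i) (x (K + 1) ω - u) ∂P
      ≤ (m : ℝ) / t K * Delta f Φ h φ ν Lyy (τ 0) (σ 0) u w x0 y0 := by
  have hm : (1 : ℝ) ≤ m := by exact_mod_cast NeZero.one_le
  have hm1 : (1 : ℝ) / m ≤ 1 := by rw [div_le_one (by linarith)]; exact hm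
  have hd : Determined I (K + 1) fun ω =>
      1 / 2 * wsq (fun i => 1 / τ K i + (1 - 1 / (m : ℝ)) * ν i) (x (K + 1) ω - u) :=
    (hr.x_det (K + 1)).comp fun b =>
      1 / 2 * wsq (fun i => 1 / τ K i + (1 - 1 / (m : ℝ)) * ν i) (b - u)
  refine ⟨hd.integrable hI.meas, ?_⟩
  have hst := hs.step K
  have htK := hst.t_pos
  -- An artificial last step that freezes the parameters of step K and takes θ' = 1. It puts the
  -- weights of step K, rather than those of step K + 1, on the iterate `x (K + 1)`.
  have hlast : StepOK ν Lxx Lyx Lyy (τ K) (σ K) (θ K) (t K) (α K) (β K)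
      (τ K) (σ K) 1 (t K) (α (K + 1)) (β (K + 1)) :=
    ⟨hst.σ_pos, hst.θ_ge, hst.θ_nonneg, htK, hst.α'_pos, hst.β'_nonneg, hst.primal, hst.dual,
      mul_one _, fun i => by
        have h1 := hν0 i
        refine mul_le_mul_of_nonneg_left ?_ htK.le
        have : (1 - 1 / (m : ℝ)) * ν i ≤ 1 * ν i :=
          mul_le_mul_of_nonneg_right (by linarith [show (0 : ℝ) < 1 / m by positivity]) h1
        linarith, le_rfl⟩
  have h1 := hr.expected_decrease hI hp hν hs.α_pos hs.β_nonneg hs.β_zero hlast hS.dom_x hS.dom_y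
    (A := fun _ => 1) (Determined.const 1) fun _ => zero_le_one
  simp only [one_mul] at h1
  have h2 := hr.potAt_le hI hp hν hs hS hK hy0 hx0
  rw [← integral_const_mul] at h2
  have h3 := h1.trans h2
  -- For the frozen parameters the dual coefficient times t K dominates the one of step K + 1 times
  -- `t (K + 1)`, by monotonicity of t/σ and `t (K + 1) * θ (K + 1) = t K`.
  have hco : 0 ≤ 1 / σ K - m * 1 * (α (K + 1) + β (K + 1)) := by
    have h4 := (hs.step (K + 1)).dual_coeff_nonneg
    have h5 := mul_nonneg (hs.step (K + 1)).t_pos.le h4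
    have h6 := hst.t_dual
    rw [div_eq_mul_one_div, div_eq_mul_one_div (t K)] at h6
    have h7 : 0 ≤ t K * (1 / σ K - m * 1 * (α (K + 1) + β (K + 1))) := by
      have h8 : t (K + 1) * (m * θ (K + 1) * (α (K + 1) + β (K + 1)))
          = t K * (m * 1 * (α (K + 1) + β (K + 1))) := by rw [← hst.t_mul]; ring
      rw [mul_sub] at h5 ⊢
      linarith
    exact (mul_nonneg_iff_of_pos_left htK).1 h7
  have h4 : ∀ ω, t K * m
      * (1 / 2 * wsq (fun i => 1 / τ K i + (1 - 1 / (m : ℝ)) * ν i) (x (K + 1) ω - u))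
      ≤ t K * pot f Φ h φ ν Lyx Lyy (τ K) (σ K) 1 (α (K + 1)) (β (K + 1))
        (x (K + 1) ω) (x K ω) (y (K + 1) ω) (y K ω) u w
      + (t K * m - t K * (m - 1)) * (lagrR f Φ h (x (K + 1) ω) w - lagrR f Φ h u w)
      + t K * dissip f Φ h Lxx Lyx Lyy τ σ θ α β x y z u w K ω := by
    intro ω
    have h5 := hp.pot_lower (ν := ν) (τ := τ K) (σ := σ K) (u := u) (w := w)
      (hr.y_mem (K + 1) ω) zero_le_one
      (add_nonneg (hs.α_pos (K + 1)).le (hs.β_nonneg (K + 1)))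
      (hr.momentum_bound hp hs.α_pos hs.β_nonneg hs.β_zero (K + 1) ω)
    rw [Nat.add_sub_cancel] at h5
    have h6 := mul_nonneg hco (hp.breg_nonneg (hr.y_mem (K + 1) ω) w)
    have h7 : 0 ≤ m * 1 * defect Φ (x (K + 1) ω) (y (K + 1) ω) w :=
      mul_nonneg (by linarith) (hp.defect_nonneg _ _ _)
    have h8 := hS.lagr_sub_nonneg hr (K + 1) ω
    have h9 := mul_nonneg (show (0 : ℝ) ≤ m - 1 by linarith) h8
    have h10 := mul_nonneg htK.le (hr.dissip_ge hp hs hS K ω).2.2.2.2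
    have h11 : 0 ≤ (t K * m - t K * (m - 1)) * (lagrR f Φ h (x (K + 1) ω) w - lagrR f Φ h u w) :=
      mul_nonneg (by linarith) h8
    have h12 : m * (1 / 2 * wsq (fun i => 1 / τ K i + (1 - 1 / (m : ℝ)) * ν i) (x (K + 1) ω - u))
        = 1 / 2 * wsq (fun i => m / τ K i + (m - 1) * ν i) (u - x (K + 1) ω) := by
      rw [wsq_neg]
      unfold wsq
      rw [Finset.mul_sum, Finset.mul_sum, Finset.mul_sum]
      refine Finset.sum_congr rfl fun i _ => ?_
      field_simp
    rw [mul_assoc, h12]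
    have h13 := mul_le_mul_of_nonneg_left (h5.trans' (le_add_of_nonneg_right h9)) htK.le
    have h14 := mul_nonneg htK.le (add_nonneg h6 h7)
    linarith
  have hpd := hr.pot_det (Lyx := Lyx) (Lyy := Lyy) ν (τ K) (σ K) 1 (α (K + 1)) (β (K + 1)) u w
    (K + 1)
  rw [Nat.add_sub_cancel] at hpd
  have h5 := integral_mono ((hd.comp fun a => t K * m * a).integrable hI.meas (P := P))
    (Determined.integrable (k := K + 1) hI.meas (by
      intro ω ω' hω
      have e1 := hpd ω ω' hω
      simp only at e1 ⊢
      rw [e1, hr.x_det (K + 1) ω ω' hω, (hr.dissip_det α β u w K).mono (Nat.le_succ K) ω ω' hω])) h4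
  rw [integral_const_mul] at h5
  have h6 := h5.trans h3
  have hDel := hp.Delta_nonneg (τ := τ 0) (σ := σ 0) hν0 (hs.τ_pos 0) (hs.step 0).σ_pos hS hy0 hx0
  -- At this point the bound holds without the factor m; the stated one follows from m ≥ 1.
  have h7 : ∫ ω, 1 / 2 * wsq (fun i => 1 / τ K i + (1 - 1 / (m : ℝ)) * ν i) (x (K + 1) ω - u) ∂P
      ≤ Delta f Φ h φ ν Lyy (τ 0) (σ 0) u w x0 y0 / t K := by
    rw [le_div_iff₀ htK]
    have : (m : ℝ) * ((∫ ω, 1 / 2 * wsq (fun i => 1 / τ K i + (1 - 1 / (m : ℝ)) * ν i)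
      (x (K + 1) ω - u) ∂P) * t K) ≤ m * Delta f Φ h φ ν Lyy (τ 0) (σ 0) u w x0 y0 := by
      linarith
    exact le_of_mul_le_mul_left this (by linarith)
  refine h7.trans ?_
  rw [div_mul_eq_mul_div]
  refine div_le_div_of_nonneg_right ?_ htK.le
  nlinarith

end Summation

/-! ### Constant and adaptive step sizes -/

section Steps

variable {m : ℕ} {ν μ Lxx Lyx : Fin m → ℝ} {Lyy : ℝ}
  {τ : ℕ → Fin m → ℝ} {σ θ t r : ℕ → ℝ} {α cτ cσ : ℝ}

lemma ConstSteps.inv_τ (hs : ConstSteps Lxx Lyx Lyy α cτ cσ τ σ) (k : ℕ) (i : Fin m) :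
    1 / τ k i = (Lxx i + Lyx i ^ 2 / α) / cτ := by
  rw [hs.1, one_div, mul_inv, inv_inv, ← div_eq_inv_mul]

lemma ConstSteps.inv_σ (hs : ConstSteps Lxx Lyx Lyy α cτ cσ τ σ) (k : ℕ) :
    1 / σ k = m * (α + 2 * Lyy) / cσ := by
  rw [hs.2, one_div, mul_inv, inv_inv, ← div_eq_inv_mul]

lemma le_div_of_mem_Ioc {a c : ℝ} (hc : c ∈ Ioc (0 : ℝ) 1) (ha : 0 ≤ a) : a ≤ a / c := by
  rw [le_div_iff₀ hc.1]
  exact mul_le_of_le_one_right ha hc.2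

/-- The choice β = `Lyy` minimizes β + `Lyy`²/β, with value 2 `Lyy`. For `Lyy = 0` the quotient is 0
by the default value of division. -/
lemma ConstSteps.stepSeq [NeZero m] (hs : ConstSteps Lxx Lyx Lyy α cτ cσ τ σ) (hα : 0 < α)
    (hcτ : cτ ∈ Ioc (0 : ℝ) 1) (hcσ : cσ ∈ Ioc (0 : ℝ) 1) (hLxx : ∀ i, 0 ≤ Lxx i)
    (hLyx : ∀ i, 0 < Lyx i) (hLyy : 0 ≤ Lyy) :
    StepSeq 0 Lxx Lyx Lyy τ σ (fun _ => 1) (fun _ => 1) (fun _ => α) (fun _ => Lyy) := by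
  have hm : (1 : ℝ) ≤ m := by exact_mod_cast NeZero.one_le
  have hl : ∀ i, 0 < Lxx i + Lyx i ^ 2 / α := fun i => by
    have := hLxx i; have := hLyx i; positivity
  have hl2 : 0 < (m : ℝ) * (α + 2 * Lyy) := by positivity
  refine ⟨fun k i => ?_, fun _ => hα, fun _ => hLyy, fun _ h => h, rfl, rfl, fun k =>
    ⟨?_, ?_, zero_le_one, one_pos, hα, hLyy, fun i => ?_, ?_, one_mul _, fun i => ?_, ?_⟩⟩
  · rw [hs.1]; exact mul_pos hcτ.1 (inv_pos.2 (hl i))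
  · rw [hs.2]; exact mul_pos hcσ.1 (inv_pos.2 hl2)
  · linarith
  · rw [hs.inv_τ]; exact le_div_of_mem_Ioc hcτ (hl i).le
  · rw [hs.inv_σ]
    refine le_trans ?_ (le_div_of_mem_Ioc hcσ hl2.le)
    have : (m : ℝ) * Lyy ^ 2 / Lyy = m * Lyy := by
      rcases hLyy.eq_or_lt with h0 | h0
      · rw [← h0]; simp
      · field_simp
    rw [this]
    linarith
  · rw [hs.inv_τ, hs.inv_τ]; simp
  · rw [hs.2, hs.2]

lemma ConstSteps.slackX_pos (hs : ConstSteps Lxx Lyx Lyy α cτ cσ τ σ) (hα : 0 < α)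
    (hcτ : cτ ∈ Ioc (0 : ℝ) 1) (hcτ1 : cτ < 1) (hLxx : ∀ i, 0 ≤ Lxx i)
    (hLyx : ∀ i, 0 < Lyx i) (k : ℕ) (i : Fin m) : 0 < slackX Lxx Lyx (τ k) α i := by
  have hl : 0 < Lxx i + Lyx i ^ 2 / α := by
    have := hLxx i; have := hLyx i; positivity
  have : Lxx i + Lyx i ^ 2 / α < (Lxx i + Lyx i ^ 2 / α) / cτ := by
    rw [lt_div_iff₀ hcτ.1]; exact mul_lt_of_lt_one_right hl hcτ1
  unfold slackX
  rw [hs.inv_τ]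
  linarith

lemma ConstSteps.dual_coeff (hs : ConstSteps Lxx Lyx Lyy α cτ cσ τ σ) (hα : 0 < α)
    (hcσ : cσ ∈ Ioc (0 : ℝ) 1) (hLyy : 0 ≤ Lyy) (k : ℕ) :
    m * ((α + 2 * Lyy) * ((1 - cσ) / cσ)) + m * Lyy ≤ 1 / σ k - m * 1 * (α + Lyy) := by
  rw [hs.inv_σ]
  have h1 := hcσ.1
  have : (m : ℝ) * ((α + 2 * Lyy) * ((1 - cσ) / cσ))
      = m * (α + 2 * Lyy) / cσ - m * (α + 2 * Lyy) := by field_simp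
  rw [this]
  linarith

lemma ConstSteps.slackY_pos [NeZero m] (hs : ConstSteps Lxx Lyx Lyy α cτ cσ τ σ) (hα : 0 < α)
    (hcσ : cσ ∈ Ioc (0 : ℝ) 1) (hcσ1 : cσ < 1) (hLyy : 0 ≤ Lyy) (k : ℕ) :
    0 < slackY m Lyy (σ k) 1 α Lyy Lyy := by
  have hm : (1 : ℝ) ≤ m := by exact_mod_cast NeZero.one_le
  have h1 := hs.dual_coeff hα hcσ hLyy k
  have h2 : 0 < (m : ℝ) * ((α + 2 * Lyy) * ((1 - cσ) / cσ)) := by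
    have h3 : 0 < (1 - cσ) / cσ := div_pos (by linarith) hcσ.1
    positivity
  have h3 : (m : ℝ) * Lyy ^ 2 / Lyy = m * Lyy := by
    rcases hLyy.eq_or_lt with h0 | h0
    · rw [← h0]; simp
    · field_simp
  unfold slackY
  rw [h3]
  linarith

/-! ### The recursion behind the adaptive step sizes -/

section Adaptive

lemma AdaptiveSteps.r_zero_pos (hs : AdaptiveSteps μ Lxx Lyx α cσ r τ σ θ t)
    [NeZero m] (hα : 0 < α) (hμ : ∀ i, 0 < μ i) (hLxx : ∀ i, 0 ≤ Lxx i)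
    (hLyx : ∀ i, 0 < Lyx i) : 0 < r 0 := by
  have hm : (1 : ℝ) ≤ m := by exact_mod_cast NeZero.one_le
  have hm1 : (0 : ℝ) ≤ 1 - 1 / m := by rw [sub_nonneg, div_le_one (by linarith)]; exact hm
  obtain ⟨i, hi⟩ := hs.r_zero.1
  rw [← hi]
  have h1 := hLxx i
  have h2 := hLyx i
  have h3 := hμ i
  have h4 := mul_nonneg hm1 h3.le
  positivity

lemma AdaptiveSteps.r_zero_le (hs : AdaptiveSteps μ Lxx Lyx α cσ r τ σ θ t)
    [NeZero m] (hα : 0 < α) (hμ : ∀ i, 0 < μ i) (hLxx : ∀ i, 0 ≤ Lxx i)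
    (hLyx : ∀ i, 0 < Lyx i) (i : Fin m) :
    Lxx i + Lyx i ^ 2 / α + (1 - 1 / (m : ℝ)) * μ i ≤ μ i / (m * r 0) := by
  have hm : (1 : ℝ) ≤ m := by exact_mod_cast NeZero.one_le
  have hm1 : (0 : ℝ) ≤ 1 - 1 / m := by rw [sub_nonneg, div_le_one (by linarith)]; exact hm
  have h0 := hs.r_zero_pos hα hμ hLxx hLyx
  have h1 := hs.r_zero.2 (mem_range_self i)
  have hD : 0 < Lxx i + Lyx i ^ 2 / α + (1 - 1 / (m : ℝ)) * μ i := by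
    have h1 := hLxx i
    have h2 := hLyx i
    have h4 := mul_nonneg hm1 (hμ i).le
    positivity
  rw [← div_eq_mul_inv, le_div_iff₀ hD] at h1
  rw [← div_div, le_div_iff₀ h0]
  linarith

/-- The product r t is invariant, because r is multiplied by the factor θ by which t is divided. So
t alone describes all the step sizes. -/
lemma AdaptiveSteps.t_facts (hs : AdaptiveSteps μ Lxx Lyx α cσ r τ σ θ t)
    (h0 : 0 < r 0) (k : ℕ) :
    1 ≤ t k ∧ r k * t k = r 0 ∧ t (k + 1) = t k * √(1 + r k) := by
  have key : ∀ k, 1 ≤ t k → r k * t k = r 0 →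
      0 < r k ∧ t (k + 1) = t k * √(1 + r k) := by
    intro k h1 h2
    have hr : 0 < r k := by
      by_contra hcon
      push Not at hcon
      have := mul_nonpos_of_nonpos_of_nonneg hcon (zero_le_one.trans h1)
      linarith
    exact ⟨hr, by rw [hs.t_succ, hs.θ_succ, div_div_eq_mul_div, div_one]⟩
  have main : 1 ≤ t k ∧ r k * t k = r 0 := by
    induction k with
    | zero => rw [hs.t_zero]; exact ⟨le_rfl, mul_one _⟩
    | succ k ih =>
      obtain ⟨hr, ht⟩ := key k ih.1 ih.2
      have hsq : 1 ≤ √(1 + r k) := Real.one_le_sqrt.2 (by linarith)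
      constructor
      · rw [ht]; exact one_le_mul_of_one_le_of_one_le ih.1 hsq
      · rw [hs.r_succ, hs.t_succ, mul_right_comm, mul_div_cancel₀, mul_comm, ih.2]
        rw [hs.θ_succ]
        positivity
  exact ⟨main.1, main.2, (key k main.1 main.2).2⟩

lemma AdaptiveSteps.r_pos (hs : AdaptiveSteps μ Lxx Lyx α cσ r τ σ θ t)
    (h0 : 0 < r 0) (k : ℕ) : 0 < r k := by
  obtain ⟨h1, h2, -⟩ := hs.t_facts h0 k
  by_contra hcon
  push Not at hcon
  have := mul_nonpos_of_nonpos_of_nonneg hcon (zero_le_one.trans h1)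
  linarith

/-- This recursion is the source of the rate 1/K²: it makes t grow linearly. -/
lemma AdaptiveSteps.t_sq (hs : AdaptiveSteps μ Lxx Lyx α cσ r τ σ θ t)
    (h0 : 0 < r 0) (k : ℕ) : t (k + 1) ^ 2 = t k ^ 2 + r 0 * t k := by
  obtain ⟨h1, h2, h3⟩ := hs.t_facts h0 k
  have := hs.r_pos h0 k
  rw [h3, mul_pow, Real.sq_sqrt (by linarith), ← h2]
  ring

lemma AdaptiveSteps.t_mul_θ (hs : AdaptiveSteps μ Lxx Lyx α cσ r τ σ θ t)
    (h0 : 0 < r 0) (k : ℕ) : t (k + 1) * θ (k + 1) = t k := by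
  have := hs.r_pos h0 k
  rw [hs.t_succ, div_mul_cancel₀]
  rw [hs.θ_succ]
  positivity

/-- Written this way, 1/τ + (1 - 1/m)μ is proportional to t, so that the primal weight condition
becomes an instance of the recursion for t². -/
lemma AdaptiveSteps.inv_τ (hs : AdaptiveSteps μ Lxx Lyx α cσ r τ σ θ t)
    (h0 : 0 < r 0) (k : ℕ) (i : Fin m) :
    1 / τ k i = μ i / (m * r 0) * t k - (1 - 1 / (m : ℝ)) * μ i := by
  obtain ⟨h1, h2, -⟩ := hs.t_facts h0 k
  have hr := hs.r_pos h0 k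
  have ht : 0 < t k := by linarith
  rw [hs.τ_eq, one_div, inv_inv, ← h2]
  rcases Nat.eq_zero_or_pos m with hm | hm
  · subst hm; exact i.elim0
  · field_simp
    ring

lemma AdaptiveSteps.inv_τ_ge (hs : AdaptiveSteps μ Lxx Lyx α cσ r τ σ θ t)
    [NeZero m] (hα : 0 < α) (hμ : ∀ i, 0 < μ i) (hLxx : ∀ i, 0 ≤ Lxx i)
    (hLyx : ∀ i, 0 < Lyx i) (k : ℕ) (i : Fin m) :
    (Lxx i + Lyx i ^ 2 / α) * t k ≤ 1 / τ k i := by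
  have hm : (1 : ℝ) ≤ m := by exact_mod_cast NeZero.one_le
  have hm1 : (0 : ℝ) ≤ 1 - 1 / m := by rw [sub_nonneg, div_le_one (by linarith)]; exact hm
  have h0 := hs.r_zero_pos hα hμ hLxx hLyx
  have h1 := (hs.t_facts h0 k).1
  have h2 := mul_le_mul_of_nonneg_right (hs.r_zero_le hα hμ hLxx hLyx i) (zero_le_one.trans h1)
  have h3 := mul_nonneg (mul_nonneg hm1 (hμ i).le) (sub_nonneg.2 h1)
  rw [hs.inv_τ h0]
  linarith

lemma AdaptiveSteps.σ_eq (hs : AdaptiveSteps μ Lxx Lyx α cσ r τ σ θ t)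
    (k : ℕ) : σ k = σ 0 * t k := by
  induction k with
  | zero => rw [hs.t_zero, mul_one]
  | succ k ih => rw [hs.σ_succ, ih, hs.t_succ, mul_div_assoc]

/-- The auxiliary sequence for the adaptive step sizes. -/
lemma AdaptiveSteps.exists_stepSeq (hs : AdaptiveSteps μ Lxx Lyx α cσ r τ σ θ t)
    [NeZero m] (hα : 0 < α) (hcσ : cσ ∈ Ioc (0 : ℝ) 1)
    (hμ : ∀ i, 0 < μ i) (hLxx : ∀ i, 0 ≤ Lxx i) (hLyx : ∀ i, 0 < Lyx i) :
    ∃ a : ℕ → ℝ, StepSeq μ Lxx Lyx 0 τ σ θ t a (fun _ => 0) ∧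
      ∀ k, t k * (1 / σ k - m * θ k * (a k + 0)) = m * (α * ((1 - cσ) / cσ)) := by
  have hm : (1 : ℝ) ≤ m := by exact_mod_cast NeZero.one_le
  have h0 := hs.r_zero_pos hα hμ hLxx hLyx
  have ht : ∀ k, 0 < t k := fun k => zero_lt_one.trans_le (hs.t_facts h0 k).1
  have hc := hcσ.1
  -- With α⁰ = α and αᵏ⁺¹ = α/tᵏ one has θᵏαᵏ = α/tᵏ, of the same order as 1/σᵏ, while Lyx²/αᵏ⁺¹
  -- grows like tᵏ, as 1/τᵏ does.
  set a : ℕ → ℝ := fun k => if k = 0 then α else α / t (k - 1) with ha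
  have hapos : ∀ k, 0 < a k := by
    intro k
    rcases k with _ | k
    · simpa [ha] using hα
    · simpa [ha] using div_pos hα (ht k)
  have hθa : ∀ k, θ k * a k = α / t k := by
    intro k
    rcases k with _ | k
    · simp [ha, hs.θ_zero, hs.t_zero]
    · have h1 := hs.t_mul_θ h0 k
      have h2 := (ht (k + 1)).ne'
      have h3 := (ht k).ne'
      simp only [ha, Nat.add_sub_cancel, if_neg (Nat.succ_ne_zero k)]
      rw [← mul_div_assoc, div_eq_div_iff h3 h2, ← h1]
      ring
  have hσ0 : 0 < σ 0 := by rw [hs.σ_zero]; positivity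
  have hσ : ∀ k, 0 < σ k := fun k => by rw [hs.σ_eq]; exact mul_pos hσ0 (ht k)
  have hinvσ : ∀ k, 1 / σ k = m * α / (cσ * t k) := fun k => by
    rw [hs.σ_eq, hs.σ_zero]
    field_simp
  have hθpos : ∀ k, 0 < θ k := by
    intro k
    rcases k with _ | k
    · rw [hs.θ_zero]; exact one_pos
    · have := hs.r_pos h0 k
      rw [hs.θ_succ]; positivity
  have hθge : ∀ k, (m : ℝ) - 1 ≤ m * θ k := by
    intro k
    rcases k with _ | k
    · rw [hs.θ_zero]; linarith
    · have hr := hs.r_pos h0 k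
      obtain ⟨h1, h2, -⟩ := hs.t_facts h0 k
      have hrle : r k ≤ r 0 := by rw [← h2]; exact le_mul_of_one_le_right hr.le h1
      -- This comes from the summand (1 - 1/m)μ in the choice of r 0 and is what keeps θ above 1 -
      -- 1/m, since r never exceeds r 0.
      have h3 : ((m : ℝ) - 1) * r 0 ≤ 1 := by
        have i : Fin m := 0
        have h4 := hs.r_zero_le hα hμ hLxx hLyx i
        have h5 : (1 - 1 / (m : ℝ)) * μ i ≤ μ i / (m * r 0) := by
          have h6 := hLxx i
          have h7 : 0 ≤ Lyx i ^ 2 / α := by positivity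
          linarith
        have h8 := hμ i
        rw [le_div_iff₀ (by positivity)] at h5
        have h9 : (1 - 1 / (m : ℝ)) * μ i * (m * r 0) = μ i * ((m - 1) * r 0) := by field_simp
        rw [h9] at h5
        exact le_of_mul_le_mul_left (by linarith) h8
      rw [hs.θ_succ, mul_one_div, le_div_iff₀ (by positivity)]
      refine abs_le_of_sq_le_sq' ?_ (by linarith) |>.2
      rw [mul_pow, Real.sq_sqrt (by linarith)]
      nlinarith [mul_le_mul_of_nonneg_left hrle (show (0 : ℝ) ≤ (m - 1) by linarith)]
  refine ⟨a, ⟨fun k i => ?_, hapos, fun _ => le_rfl, fun _ _ => rfl, hs.θ_zero, hs.t_zero,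
    fun k => ⟨hσ k, hθge k, (hθpos k).le, ht k, hapos _, le_rfl, fun i => ?_, ?_,
      hs.t_mul_θ h0 k, fun i => ?_, ?_⟩⟩, fun k => ?_⟩
  · have h1 := hs.inv_τ_ge hα hμ hLxx hLyx k i
    have h2 : 0 < (Lxx i + Lyx i ^ 2 / α) * t k := by
      have := hLxx i; have := hLyx i; have := ht k; positivity
    exact one_div_pos.1 (h2.trans_le h1)
  · have h1 := hs.inv_τ_ge hα hμ hLxx hLyx k i
    have h2 : Lyx i ^ 2 / a (k + 1) = Lyx i ^ 2 / α * t k := by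
      simp only [ha, Nat.add_sub_cancel, if_neg (Nat.succ_ne_zero k)]
      field_simp
    have h3 := le_mul_of_one_le_right (hLxx i) (hs.t_facts h0 k).1
    rw [h2]
    linarith
  · rw [add_zero, mul_assoc, hθa, hinvσ]
    have := ht k
    simp only [ne_eq, OfNat.ofNat_ne_zero, not_false_eq_true, zero_pow, mul_zero, div_zero,
      add_zero]
    rw [← mul_div_assoc]
    refine div_le_div_of_nonneg_left (by positivity) (by positivity) ?_
    exact mul_le_of_le_one_left this.le hcσ.2
  -- The primal weight condition holds with equality: both sides are μ/(m r⁰) times t'² = t² + r⁰t.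
  · have h1 := hs.t_sq h0 k
    rw [hs.inv_τ h0, hs.inv_τ h0]
    have h2 : t (k + 1) * (μ i / (m * r 0) * t (k + 1) - (1 - 1 / (m : ℝ)) * μ i
        + (1 - 1 / (m : ℝ)) * μ i) = μ i / (m * r 0) * t (k + 1) ^ 2 := by ring
    rw [h2, h1]
    apply le_of_eq
    field_simp
    ring
  · rw [hs.σ_eq k, hs.σ_eq (k + 1)]
    apply le_of_eq
    have := (ht k).ne'
    have := (ht (k + 1)).ne'
    field_simp
  · rw [add_zero, mul_assoc, hθa, hinvσ]
    have := (ht k).ne'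
    field_simp

/-- Each increment of t lies between c = r⁰/(2 + r⁰) and r⁰/2, as comparison of squares shows. The
constant c solves c(2 + r⁰) = r⁰, which leaves c² ≤ c r⁰ t to check; this holds because c ≤ r⁰ and t
≥ 1. -/
lemma AdaptiveSteps.t_growth (hs : AdaptiveSteps μ Lxx Lyx α cσ r τ σ θ t)
    (h0 : 0 < r 0) {K : ℕ} (hK : 1 ≤ K) :
    r 0 / (2 + r 0) * K ≤ t K ∧ t K ≤ (1 + r 0 / 2) * K := by
  have hK1 : (1 : ℝ) ≤ K := by exact_mod_cast hK
  have main : ∀ k : ℕ, 1 + r 0 / (2 + r 0) * k ≤ t k ∧ t k ≤ 1 + r 0 / 2 * k := by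
    intro k
    induction k with
    | zero => simp [hs.t_zero]
    | succ k ih =>
      have h1 := hs.t_sq h0 k
      have h2 := (hs.t_facts h0 k).1
      have h3 := (hs.t_facts h0 (k + 1)).1
      set c := r 0 / (2 + r 0) with hc
      have hcpos : 0 < c := by positivity
      have hcr : c * (2 + r 0) = r 0 := by rw [hc]; field_simp
      have hc1 : c ≤ 1 := by rw [hc, div_le_one (by linarith)]; linarith
      have hup : t (k + 1) ≤ t k + r 0 / 2 :=
        (abs_le_of_sq_le_sq' (by rw [h1]; nlinarith [sq_nonneg (r 0)]) (by linarith)).2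
      have hlow : t k + c ≤ t (k + 1) := by
        refine (abs_le_of_sq_le_sq' ?_ (by linarith)).2
        rw [h1]
        have h4 : c ^ 2 ≤ c * r 0 := by
          rw [sq]
          exact mul_le_mul_of_nonneg_left (by nlinarith) hcpos.le
        have h5 : c * r 0 ≤ c * r 0 * t k := le_mul_of_one_le_right (by positivity) h2
        have h6 : r 0 * t k = c * (2 + r 0) * t k := by rw [hcr]
        rw [h6]
        nlinarith
      push_cast
      constructor <;> linarith
  obtain ⟨h1, h2⟩ := main K
  constructor
  · linarith
  · linarith

end Adaptive

end Steps

/-! ### Cluster points are saddle points -/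

section Cluster

variable {m : ℕ} {n : Fin m → ℕ} {Y : Type*} [NormedAddCommGroup Y] [NormedSpace ℝ Y]
  {f : (i : Fin m) → EuclideanSpace ℝ (Fin (n i)) → EReal} {Φ : Primal n → Y → ℝ}
  {h : Y → EReal} {φ : Y → ℝ} {U : Set Y} {μ Lxx Lyx : Fin m → ℝ} {Lyy : ℝ}

lemma lsc_le_of_tendsto {E : Type*} [TopologicalSpace E] {g : E → EReal}
    (hg : LowerSemicontinuous g) {z : ℕ → E} {a : E} (hz : Tendsto z atTop (𝓝 a)) {b : ℕ → ℝ}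
    {c : ℝ} (hb : Tendsto b atTop (𝓝 c)) (hle : ∀ k, g (z k) ≤ (b k : EReal)) :
    g a ≤ (c : EReal) := by
  by_contra hcon
  push Not at hcon
  obtain ⟨d, hd1, hd2⟩ := EReal.lt_iff_exists_real_btwn.1 hcon
  have h1 := hz.eventually (hg a _ hd2)
  have h2 := hb.eventually (gt_mem_nhds (EReal.coe_lt_coe_iff.1 hd1))
  obtain ⟨k, hk1, hk2⟩ := (h1.and h2).exists
  have := hk1.trans_le (hle k)
  exact absurd (EReal.coe_lt_coe_iff.1 this) (not_lt.2 hk2.le)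

lemma Problem.lsc_sum (hp : Problem f Φ h φ U μ Lxx Lyx Lyy) :
    LowerSemicontinuous fun x : Primal n => ∑ i, f i (x i) := by
  classical
  have key : ∀ s : Finset (Fin m), LowerSemicontinuous fun x : Primal n => ∑ i ∈ s, f i (x i) := by
    intro s
    induction s using Finset.induction_on with
    | empty => simpa using lowerSemicontinuous_const
    | insert a s ha ih =>
      simp_rw [Finset.sum_insert ha]
      intro x
      refine LowerSemicontinuousAt.add' ?_ (ih x) ?_
      · exact (hp.f_convex a).closed.comp (continuous_apply a) x
      · exact EReal.continuousAt_add (Or.inr (sum_ne_bot s fun i => (hp.f_convex i).ne_bot _))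
          (Or.inl ((hp.f_convex a).ne_bot _))
  exact key _

/-- The limit is taken in the proximal inequalities, not in optimality conditions. On the primal
side only values of Φ occur, so continuity of ∇ₓΦ plays no role; on the dual side the extrapolation
vanishes and semicontinuity of h suffices. -/
lemma IsSaddleR.of_tendsto [NeZero m] [FiniteDimensional ℝ Y]
    (hp : Problem f Φ h φ U μ Lxx Lyx Lyy)
    {τ : Fin m → ℝ} {σ : ℝ} (hσ : 0 < σ)
    {x x' z : ℕ → Primal n} {y y' yp : ℕ → Y} {a : Primal n} {b : Y}
    (hx : Tendsto x atTop (𝓝 a)) (hzl : Tendsto z atTop (𝓝 a)) (hyl : Tendsto y atTop (𝓝 b))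
    (hypl : Tendsto yp atTop (𝓝 b))
    (hq : Tendsto (fun k => gradY Φ (x k) (y k) - gradY Φ (x' k) (y' k)) atTop (𝓝 0))
    (hz : ∀ k i, IsMinOn (proxObj (f i) (gradX Φ i (x k) (yp k)) (τ i) (x k i)) univ (z k i))
    (hy : ∀ k, IsMinOn (bregObj h φ (momentum Φ 1 (x k) (y k) (x' k) (y' k)) σ (y k)) univ (yp k))
    (hyU : ∀ k, y k ∈ U) {w₀ : Y} (hw₀ : h w₀ ≠ ⊤) {B : ℝ} (hB : ∀ k, breg φ w₀ (y k) ≤ B) :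
    IsSaddleR f Φ h a b := by
  have hstep := fun k => bregman_prox_inequality hp.h_convex (hy k)
    fun hh => hp.φ_diffAt (hp.dom_h _ hh)
  have hypU : ∀ k, yp k ∈ U := fun k => hp.dom_h _ (hstep k).1
  have hs : Tendsto (fun k => momentum Φ 1 (x k) (y k) (x' k) (y' k)) atTop (𝓝 (gradY Φ a b)) := by
    have h1 : Tendsto (fun k => gradY Φ (x k) (y k)) atTop (𝓝 (gradY Φ a b)) :=
      (hp.continuous_gradY.tendsto (a, b)).comp (hx.prodMk_nhds hyl)
    have h2 := h1.add (hq.const_smul ((m : ℝ) * 1))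
    rw [smul_zero, add_zero] at h2
    exact h2
  have hslin : ∀ w, Tendsto (fun k => momentum Φ 1 (x k) (y k) (x' k) (y' k) (w - yp k)) atTop
      (𝓝 (gradY Φ a b (w - b))) := fun w =>
    ((continuous_fst.clm_apply continuous_snd).tendsto (gradY Φ a b, w - b)).comp
      (hs.prodMk_nhds (hypl.const_sub w))
  -- It is not yet known that b lies in U, so Bregman distances need not converge; boundedness at
  -- the single point w₀ is enough to make h finite at b.
  have hb : h b ≠ ⊤ := by
    have h1 : Tendsto (fun k => (h w₀).toReal
        - momentum Φ 1 (x k) (y k) (x' k) (y' k) (w₀ - yp k) + 1 / σ * B) atTop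
        (𝓝 ((h w₀).toReal - gradY Φ a b (w₀ - b) + 1 / σ * B)) :=
      (tendsto_const_nhds.sub (hslin w₀)).add_const _
    have h2 := lsc_le_of_tendsto hp.h_convex.closed hypl h1 (fun k => by
      rw [← hp.h_convex.coe_toReal (hstep k).1]
      refine EReal.coe_le_coe_iff.2 ?_
      have h3 := (hstep k).2 w₀ hw₀
      have h4 := hp.breg_nonneg (hyU k) (yp k)
      have h5 := hp.breg_nonneg (hypU k) w₀
      have h6 := mul_le_mul_of_nonneg_left (show breg φ w₀ (y k) - breg φ (yp k) (y k)
        - breg φ w₀ (yp k) ≤ B by linarith [hB k]) (show 0 ≤ 1 / σ by positivity)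
      linarith)
    exact ne_top_of_le_ne_top (EReal.coe_ne_top _) h2
  have hbU := hp.dom_h b hb
  have hdual : ∀ w, h w ≠ ⊤ → (h b).toReal ≤ (h w).toReal - gradY Φ a b (w - b) := by
    intro w hw
    -- Now b is in U, and D(w, y) and D(w, yp) have the same limit, so the proximal terms cancel.
    have h0 := tendsto_breg hp.φ_convexOn hyl (fun k => hp.φ_diffAt (hyU k)) (hp.φ_diffAt hbU) w
    have h0' := tendsto_breg hp.φ_convexOn hypl (fun k => hp.φ_diffAt (hypU k)) (hp.φ_diffAt hbU) w
    have h1 : Tendsto (fun k => (h w).toReal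
        - momentum Φ 1 (x k) (y k) (x' k) (y' k) (w - yp k)
        + 1 / σ * (breg φ w (y k) - breg φ w (yp k))) atTop
        (𝓝 ((h w).toReal - gradY Φ a b (w - b) + 1 / σ * (breg φ w b - breg φ w b))) :=
      (tendsto_const_nhds.sub (hslin w)).add ((h0.sub h0').const_mul _)
    rw [sub_self, mul_zero, add_zero] at h1
    have h2 := lsc_le_of_tendsto hp.h_convex.closed hypl h1 (fun k => by
      rw [← hp.h_convex.coe_toReal (hstep k).1]
      refine EReal.coe_le_coe_iff.2 ?_
      have h3 := (hstep k).2 w hw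
      have h4 := mul_nonneg (show 0 ≤ 1 / σ by positivity) (hp.breg_nonneg (hyU k) (yp k))
      linarith)
    rw [← hp.h_convex.coe_toReal hb] at h2
    exact EReal.coe_le_coe_iff.1 h2
  have hΦ : ∀ {s : ℕ → Primal n} {v : ℕ → Y} {c : Primal n} {d : Y}, Tendsto s atTop (𝓝 c) →
      Tendsto v atTop (𝓝 d) → Tendsto (fun k => Φ (s k) (v k)) atTop (𝓝 (Φ c d)) :=
    fun h1 h2 => (hp.continuous_coupling.tendsto (_, _)).comp (h1.prodMk_nhds h2)
  have hprimal : ∀ u : Primal n, (∀ i, f i (u i) ≠ ⊤) →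
      ∑ i, f i (a i) ≤ ((∑ i, (f i (u i)).toReal + Φ u b - Φ a b : ℝ) : EReal) := by
    intro u hu
    have hxi : ∀ i, Tendsto (fun k => x k i) atTop (𝓝 (a i)) := fun i => (tendsto_pi_nhds.1 hx) i
    have hzi : ∀ i, Tendsto (fun k => z k i) atTop (𝓝 (a i)) := fun i => (tendsto_pi_nhds.1 hzl) i
    have h1 : Tendsto (fun k => ∑ i, (f i (u i)).toReal + Φ u (yp k)
        + ∑ i, 1 / (2 * τ i) * ‖u i - x k i‖ ^ 2
        - ∑ i, (1 / (2 * τ i) + μ i / 2) * ‖u i - z k i‖ ^ 2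
        - ∑ i, (1 / (2 * τ i) - Lxx i / 2) * ‖z k i - x k i‖ ^ 2
        - Φ (x k) (yp k)
        - ∑ i, (Φ (Function.update (x k) i (z k i)) (yp k) - Φ (x k) (yp k))) atTop
        (𝓝 (∑ i, (f i (u i)).toReal + Φ u b
        + ∑ i, 1 / (2 * τ i) * ‖u i - a i‖ ^ 2
        - ∑ i, (1 / (2 * τ i) + μ i / 2) * ‖u i - a i‖ ^ 2
        - ∑ i, (1 / (2 * τ i) - Lxx i / 2) * ‖a i - a i‖ ^ 2
        - Φ a b
        - ∑ i, (Φ (Function.update a i (a i)) b - Φ a b))) := by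
      refine Tendsto.sub (Tendsto.sub (Tendsto.sub (Tendsto.sub (Tendsto.add (Tendsto.add
        tendsto_const_nhds (hΦ tendsto_const_nhds hypl)) ?_) ?_) ?_) (hΦ hx hypl)) ?_
      · exact tendsto_finsetSum _ fun i _ => ((((hxi i).const_sub _).norm).pow 2).const_mul _
      · exact tendsto_finsetSum _ fun i _ => ((((hzi i).const_sub _).norm).pow 2).const_mul _
      · exact tendsto_finsetSum _ fun i _ => ((((hzi i).sub (hxi i)).norm).pow 2).const_mul _
      · exact tendsto_finsetSum _ fun i _ => (hΦ (hx.update i (hzi i)) hypl).sub (hΦ hx hypl)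
    have h2 := lsc_le_of_tendsto hp.lsc_sum hzl h1 (fun k => by
      have hzd : ∀ i, f i (z k i) ≠ ⊤ := fun i => (prox_inequality (hp.f_convex i) (hz k i)).1
      rw [← coe_sum_toReal _ (fun i => (hp.f_convex i).ne_bot _) hzd]
      refine EReal.coe_le_coe_iff.2 ?_
      have := hp.blockwise_inequality (hz k) hu
      linarith)
    refine h2.trans (EReal.coe_le_coe_iff.2 ?_)
    simp only [Function.update_eq_self, sub_self, norm_zero, Finset.sum_const_zero, ne_eq,
      OfNat.ofNat_ne_zero, not_false_eq_true, zero_pow, mul_zero, sub_zero]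
    have h3 : ∑ i, 1 / (2 * τ i) * ‖u i - a i‖ ^ 2
        ≤ ∑ i, (1 / (2 * τ i) + μ i / 2) * ‖u i - a i‖ ^ 2 := by
      refine Finset.sum_le_sum fun i _ => mul_le_mul_of_nonneg_right ?_ (sq_nonneg _)
      linarith [hp.μ_nonneg i]
    linarith
  have ha : ∀ i, f i (a i) ≠ ⊤ := by
    intro i hi
    choose u hu using fun i => (hp.f_convex i).proper
    have h1 := hprimal u hu
    rw [sum_eq_top _ (fun i => (hp.f_convex i).ne_bot _) (Finset.mem_univ i) hi] at h1
    exact EReal.coe_ne_top _ (top_le_iff.1 h1)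
  refine ⟨ha, hb, fun w hw => ?_, fun u hu => ?_⟩
  · have h1 := hdual w hw
    have h2 := hp.le_add_gradY a b w
    unfold lagrR
    linarith
  · have h1 := hprimal u hu
    rw [← coe_sum_toReal _ (fun i => (hp.f_convex i).ne_bot _) ha] at h1
    have h2 := EReal.coe_le_coe_iff.1 h1
    unfold lagrR
    linarith

end Cluster

/-! ### Almost sure convergence -/

section Convergence

variable {m : ℕ} {n : Fin m → ℕ} {Y : Type*} [NormedAddCommGroup Y] [NormedSpace ℝ Y]
  {f : (i : Fin m) → EuclideanSpace ℝ (Fin (n i)) → EReal} {Φ : Primal n → Y → ℝ}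
  {h : Y → EReal} {φ : Y → ℝ} {U : Set Y} {μ Lxx Lyx : Fin m → ℝ} {Lyy : ℝ}
  {Ω : Type*}
  {τ : ℕ → Fin m → ℝ} {σ : ℕ → ℝ} {α : ℝ} {I : ℕ → Ω → Fin m} {x0 : Primal n} {y0 : Y}
  {x : ℕ → Ω → Primal n} {y : ℕ → Ω → Y} {z : ℕ → Ω → Primal n}

/-- The part of the Lyapunov function that measures the distance to the point `(u, w)`. -/
noncomputable def distPart (φ : Y → ℝ) (τ : Fin m → ℝ) (σ : ℝ) (u : Primal n) (w : Y)
    (x : Primal n) (y : Y) : ℝ :=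
  1 / 2 * wsq (fun i => m / τ i) (u - x) + 1 / σ * breg φ w y

lemma wsq_le_two (d : Fin m → ℝ) (hd : ∀ i, 0 ≤ d i) (a b c : Primal n) :
    wsq d (a - b) ≤ 2 * wsq d (c - a) + 2 * wsq d (c - b) := by
  unfold wsq
  rw [Finset.mul_sum, Finset.mul_sum, ← Finset.sum_add_distrib]
  refine Finset.sum_le_sum fun i _ => ?_
  have h1 : ‖(a - b) i‖ ≤ ‖(c - a) i‖ + ‖(c - b) i‖ := by
    have : (a - b) i = (c - b) i - (c - a) i := by simp only [Pi.sub_apply]; abel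
    rw [this]
    exact (norm_sub_le _ _).trans (by linarith)
  have h2 : ‖(a - b) i‖ ^ 2 ≤ 2 * ‖(c - a) i‖ ^ 2 + 2 * ‖(c - b) i‖ ^ 2 := by
    nlinarith [norm_nonneg ((a - b) i), sq_nonneg (‖(c - a) i‖ - ‖(c - b) i‖)]
  have := mul_le_mul_of_nonneg_left h2 (hd i)
  linarith

lemma norm_sub_sq_le_two {E : Type*} [NormedAddCommGroup E] (a b c : E) :
    ‖a - b‖ ^ 2 ≤ 2 * ‖c - a‖ ^ 2 + 2 * ‖c - b‖ ^ 2 := by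
  have h1 : ‖a - b‖ ≤ ‖c - a‖ + ‖c - b‖ := by
    have : a - b = (c - b) - (c - a) := by abel
    rw [this]
    exact (norm_sub_le _ _).trans (by linarith)
  nlinarith [norm_nonneg (a - b), sq_nonneg (‖c - a‖ - ‖c - b‖)]

lemma single_le_wsq {d : Fin m → ℝ} (hd : ∀ i, 0 ≤ d i) (v : Primal n) (i : Fin m) :
    d i * ‖v i‖ ^ 2 ≤ wsq d v :=
  Finset.single_le_sum (f := fun i => d i * ‖v i‖ ^ 2)
    (fun i _ => mul_nonneg (hd i) (sq_nonneg _)) (Finset.mem_univ i)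

lemma tendsto_of_norm_sq {E : Type*} [NormedAddCommGroup E] {g : ℕ → E}
    (hg : Tendsto (fun k => ‖g k‖ ^ 2) atTop (𝓝 0)) : Tendsto g atTop (𝓝 0) := by
  rw [tendsto_zero_iff_norm_tendsto_zero]
  have := (Real.continuous_sqrt.tendsto 0).comp hg
  simpa [Function.comp_def, Real.sqrt_sq (norm_nonneg _)] using this

lemma tendsto_of_mul_sq {E : Type*} [NormedAddCommGroup E] {g : ℕ → E} {c : ℝ} (hc : 0 < c)
    {b : ℕ → ℝ} (hb : Tendsto b atTop (𝓝 0)) (hg : ∀ k, c * ‖g k‖ ^ 2 ≤ b k) :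
    Tendsto g atTop (𝓝 0) := by
  refine tendsto_of_norm_sq (squeeze_zero (fun _ => sq_nonneg _) (fun k => ?_)
    (by simpa using hb.const_mul c⁻¹))
  rw [le_inv_mul_iff₀ hc]
  exact hg k

variable [MeasurableSpace Ω] {P : Measure Ω} [IsProbabilityMeasure P]

/-- For a fixed saddle point, the dissipated quantities vanish and the Lyapunov function converges
almost surely. -/
lemma Run.ae_gain_tendsto [NeZero m] (hI : UniformBlocks P I)
    (hr : Run f Φ h φ U τ σ (fun _ => 1) I x0 y0 x y z)
    (hp : Problem f Φ h φ U μ Lxx Lyx Lyy)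
    (hs : StepSeq 0 Lxx Lyx Lyy τ σ (fun _ => 1) (fun _ => 1) (fun _ => α) (fun _ => Lyy))
    {u : Primal n} {w : Y} (hS : IsSaddleR f Φ h u w) :
    ∀ᵐ ω ∂P, Tendsto (fun k => gain f Φ h Lxx Lyx Lyy τ σ (fun _ => 1) (fun _ => 1) (fun _ => α)
        (fun _ => Lyy) x y z u w k ω) atTop (𝓝 0) ∧
      ∃ c, Tendsto (fun k => potAt f Φ h φ 0 Lyx Lyy τ σ (fun _ => 1) (fun _ => α)
        (fun _ => Lyy) x y u w k ω) atTop (𝓝 c) := by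
  have hν : ∀ i, (0 : Fin m → ℝ) i ≤ μ i := hp.μ_nonneg
  have hgd := hr.gain_det (f := f) (Φ := Φ) (h := h) (Lxx := Lxx) (Lyx := Lyx) (Lyy := Lyy)
    (fun _ => 1) (fun _ => α) (fun _ => Lyy) u w
  have hg0 : ∀ k ω, 0 ≤ gain f Φ h Lxx Lyx Lyy τ σ (fun _ => 1) (fun _ => 1) (fun _ => α)
      (fun _ => Lyy) x y z u w k ω := fun k ω => (hr.gain_ge hp hs hS k ω).2.2
  have hp0 : ∀ k ω, 0 ≤ potAt f Φ h φ 0 Lyx Lyy τ σ (fun _ => 1) (fun _ => α)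
      (fun _ => Lyy) x y u w k ω := fun k ω => hr.potAt_nonneg hp (fun _ => le_rfl) hs hS k ω
  have hpd := hr.potAt_det (Lyx := Lyx) (Lyy := Lyy) 0 (fun _ => α) (fun _ => Lyy) u w
  refine (tendsto_zero_of_sum_integral_le
    (C := pot f Φ h φ 0 Lyx Lyy (τ 0) (σ 0) 1 α Lyy x0 x0 y0 y0 u w) hg0
    (fun k => (hgd k).measurable hI.meas) (fun k => (hgd k).integrable hI.meas) fun K => ?_).and
    (exists_tendsto_of_decrease hI.meas hpd hp0 fun k A hA hA0 => ?_)
  · have h1 := hr.sum_decrease hI hp hν hs hS.dom_x hS.dom_y K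
    have h2 : 0 ≤ ∫ ω, potAt f Φ h φ 0 Lyx Lyy τ σ (fun _ => 1) (fun _ => α)
      (fun _ => Lyy) x y u w K ω ∂P := integral_nonneg fun ω => hp0 K ω
    linarith
  · have h1 := hr.weighted_decrease hI hp hν hs hS.dom_x hS.dom_y k hA hA0
    simp only [one_mul] at h1
    refine le_trans ?_ h1
    refine integral_mono (((hA.mono (Nat.le_succ k)).comp₂ (hpd (k + 1))
      fun a b => a * b).integrable hI.meas) (Determined.integrable (k := k + 1) hI.meas ?_)
      fun ω => mul_le_mul_of_nonneg_left (le_add_of_nonneg_right (hg0 k ω)) (hA0 ω)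
    intro ω ω' hω
    simp only
    rw [hA.mono (Nat.le_succ k) ω ω' hω, hpd (k + 1) ω ω' hω, hgd k ω ω' hω]

end Convergence

/-! ### Opial's argument along almost every path -/

section Convergence

variable {m : ℕ} {n : Fin m → ℕ} {Y : Type*} [NormedAddCommGroup Y] [NormedSpace ℝ Y]
  {f : (i : Fin m) → EuclideanSpace ℝ (Fin (n i)) → EReal} {Φ : Primal n → Y → ℝ}
  {h : Y → EReal} {φ : Y → ℝ} {U : Set Y} {μ Lxx Lyx : Fin m → ℝ} {Lyy : ℝ}
  {Ω : Type*}
  {τ : ℕ → Fin m → ℝ} {σ : ℕ → ℝ} {α : ℝ} {I : ℕ → Ω → Fin m} {x0 : Primal n} {y0 : Y}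
  {x : ℕ → Ω → Primal n} {y : ℕ → Ω → Y} {z : ℕ → Ω → Primal n}

/-- Stationary step sizes that satisfy the step-size condition with strict inequalities. -/
structure StrictSteps (Lxx Lyx : Fin m → ℝ) (Lyy : ℝ) (τ : ℕ → Fin m → ℝ) (σ : ℕ → ℝ) (α : ℝ) :
    Prop where
  seq : StepSeq 0 Lxx Lyx Lyy τ σ (fun _ => 1) (fun _ => 1) (fun _ => α) (fun _ => Lyy)
  τ_const : ∀ k, τ k = τ 0
  σ_const : ∀ k, σ k = σ 0
  slackX_pos : ∀ i, 0 < slackX Lxx Lyx (τ 0) α i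
  slackY_pos : 0 < slackY m Lyy (σ 0) 1 α Lyy Lyy
  coeff_pos : 0 < 1 / σ 0 - m * 1 * (α + Lyy)

/-- The dissipated quantities relative to `(u, w)` vanish and the Lyapunov function converges. -/
def GoodPath (f : (i : Fin m) → EuclideanSpace ℝ (Fin (n i)) → EReal)
    (Φ : Primal n → Y → ℝ) (h : Y → EReal) (φ : Y → ℝ) (Lxx Lyx : Fin m → ℝ) (Lyy : ℝ)
    (τ : ℕ → Fin m → ℝ) (σ : ℕ → ℝ) (α : ℝ) (x : ℕ → Ω → Primal n) (y : ℕ → Ω → Y)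
    (z : ℕ → Ω → Primal n) (u : Primal n) (w : Y) (ω : Ω) : Prop :=
  Tendsto (fun k => gain f Φ h Lxx Lyx Lyy τ σ (fun _ => 1) (fun _ => 1) (fun _ => α)
        (fun _ => Lyy) x y z u w k ω) atTop (𝓝 0) ∧
      ∃ c, Tendsto (fun k => potAt f Φ h φ 0 Lyx Lyy τ σ (fun _ => 1) (fun _ => α)
        (fun _ => Lyy) x y u w k ω) atTop (𝓝 c)

lemma GoodPath.dissip_tendsto [NeZero m] (hr : Run f Φ h φ U τ σ (fun _ => 1) I x0 y0 x y z)
    (hp : Problem f Φ h φ U μ Lxx Lyx Lyy) (hs : StrictSteps Lxx Lyx Lyy τ σ α)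
    {u : Primal n} {w : Y} (hS : IsSaddleR f Φ h u w) {ω : Ω}
    (hG : GoodPath f Φ h φ Lxx Lyx Lyy τ σ α x y z u w ω) :
    Tendsto (fun k => dissip f Φ h Lxx Lyx Lyy τ σ (fun _ => 1) (fun _ => α)
      (fun _ => Lyy) x y z u w k ω) atTop (𝓝 0) := by
  refine squeeze_zero (fun k => (hr.dissip_ge hp hs.seq hS k ω).2.2.2.2) (fun k => ?_) hG.1
  have := (hr.gain_ge hp hs.seq hS k ω).1
  simpa using this

/-- Both slacks are bounded away from zero, so vanishing dissipation forces the moves to vanish,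
including the proximal moves of blocks that are not drawn. -/
lemma GoodPath.increments [NeZero m] (hr : Run f Φ h φ U τ σ (fun _ => 1) I x0 y0 x y z)
    (hp : Problem f Φ h φ U μ Lxx Lyx Lyy) (hs : StrictSteps Lxx Lyx Lyy τ σ α)
    {u : Primal n} {w : Y} (hS : IsSaddleR f Φ h u w) {ω : Ω}
    (hG : GoodPath f Φ h φ Lxx Lyx Lyy τ σ α x y z u w ω) :
    Tendsto (fun k => y (k + 1) ω - y k ω) atTop (𝓝 0) ∧
    Tendsto (fun k => z k ω - x k ω) atTop (𝓝 0) ∧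
    Tendsto (fun k => x (k + 1) ω - x k ω) atTop (𝓝 0) := by
  have hd := hG.dissip_tendsto hr hp hs hS
  have hz : Tendsto (fun k => z k ω - x k ω) atTop (𝓝 0) := by
    refine tendsto_pi_nhds.2 fun i => tendsto_of_mul_sq (hs.slackX_pos i) hd fun k => ?_
    refine le_trans ?_ (hr.dissip_ge hp hs.seq hS k ω).2.2.2.1
    rw [hs.τ_const k]
    exact Finset.single_le_sum (f := fun i => slackX Lxx Lyx (τ 0) α i * ‖z k ω i - x k ω i‖ ^ 2)
      (fun i _ => mul_nonneg (hs.slackX_pos i).le (sq_nonneg _)) (Finset.mem_univ i)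
  refine ⟨tendsto_of_mul_sq hs.slackY_pos hd fun k => ?_, hz, ?_⟩
  · have := (hr.dissip_ge hp hs.seq hS k ω).2.1
    rw [hs.σ_const k] at this
    exact this
  · refine tendsto_pi_nhds.2 fun i => ?_
    have hzi := tendsto_zero_iff_norm_tendsto_zero.1 (tendsto_pi_nhds.1 hz i)
    refine tendsto_zero_iff_norm_tendsto_zero.2 (squeeze_zero (fun _ => norm_nonneg _)
      (fun k => ?_) hzi)
    rw [hr.x_succ]
    by_cases hi : i = I k ω
    · subst hi; simp
    · simp [hi]

lemma tendsto_momentum [NeZero m] (hp : Problem f Φ h φ U μ Lxx Lyx Lyy) {ω : Ω}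
    (hy : Tendsto (fun k => y (k + 1) ω - y k ω) atTop (𝓝 0))
    (hx : Tendsto (fun k => x (k + 1) ω - x k ω) atTop (𝓝 0)) :
    Tendsto (fun k => gradY Φ (x k ω) (y k ω) - gradY Φ (x (k - 1) ω) (y (k - 1) ω)) atTop (𝓝 0) ∧
    Tendsto (fun k => inertia Lyx Lyy α Lyy (x k ω) (x (k - 1) ω) (y k ω) (y (k - 1) ω))
      atTop (𝓝 0) := by
  have hy' := tendsto_zero_iff_norm_tendsto_zero.1 hy
  have hx' := fun i => tendsto_zero_iff_norm_tendsto_zero.1 (tendsto_pi_nhds.1 hx i)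
  constructor
  · rw [← tendsto_add_atTop_iff_nat 1]
    simp only [Nat.add_sub_cancel]
    have h1 : Tendsto (fun k => Lyy * ‖y k ω - y (k + 1) ω‖
        + ∑ i, Lyx i * ‖x (k + 1) ω i - x k ω i‖) atTop
        (𝓝 (Lyy * 0 + ∑ i, Lyx i * 0)) := by
      refine Tendsto.add (Tendsto.const_mul _ ?_)
        (tendsto_finsetSum _ fun i _ => (hx' i).const_mul _)
      simpa only [norm_sub_rev] using hy'
    simp only [mul_zero, Finset.sum_const_zero, add_zero] at h1
    exact tendsto_zero_iff_norm_tendsto_zero.2 (squeeze_zero (fun _ => norm_nonneg _)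
      (fun k => hp.gradY_lip _ _ _ _) h1)
  · rw [← tendsto_add_atTop_iff_nat 1]
    simp only [Nat.add_sub_cancel]
    have h1 : Tendsto (fun k => inertia Lyx Lyy α Lyy (x (k + 1) ω) (x k ω) (y (k + 1) ω) (y k ω))
        atTop (𝓝 (∑ i, Lyx i ^ 2 / (2 * α) * 0 ^ 2 + Lyy ^ 2 / (2 * Lyy) * 0 ^ 2)) :=
      (tendsto_finsetSum _ fun i _ => ((hx' i).pow 2).const_mul _).add ((hy'.pow 2).const_mul _)
    simpa using h1

lemma GoodPath.bounded [NeZero m] (hr : Run f Φ h φ U τ σ (fun _ => 1) I x0 y0 x y z)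
    (hp : Problem f Φ h φ U μ Lxx Lyx Lyy) (hs : StrictSteps Lxx Lyx Lyy τ σ α)
    {u : Primal n} {w : Y} (hS : IsSaddleR f Φ h u w) {ω : Ω}
    (hG : GoodPath f Φ h φ Lxx Lyx Lyy τ σ α x y z u w ω) :
    ∃ B, (∀ k, ‖y k ω - w‖ ≤ B) ∧ (∀ k i, ‖x k ω i - u i‖ ≤ B) ∧ ∀ k, breg φ w (y k ω) ≤ B := by
  obtain ⟨c, hc⟩ := hG.2
  obtain ⟨C, hC⟩ := hc.bddAbove_range
  have hC : ∀ k, potAt f Φ h φ 0 Lyx Lyy τ σ (fun _ => 1) (fun _ => α)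
        (fun _ => Lyy) x y u w k ω ≤ C := fun k => hC (mem_range_self k)
  have hτ := hs.seq.τ_pos 0
  have hm : (1 : ℝ) ≤ m := by exact_mod_cast NeZero.one_le
  have hcp := hs.coeff_pos
  have hw0 := primal_weight_nonneg (ν := 0) hτ fun _ => le_rfl
  have key : ∀ k, 1 / 2 * wsq (fun i => m / τ 0 i + (m - 1) * (0 : Fin m → ℝ) i) (u - x k ω)
      + (1 / σ 0 - m * 1 * (α + Lyy)) * breg φ w (y k ω) ≤ C := by
    intro k
    have := hr.potAt_lower_saddle hp hs.seq hS k ω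
    rw [hs.τ_const k, hs.σ_const k] at this
    exact this.trans (hC k)
  have hb : ∀ k, breg φ w (y k ω) ≤ C / (1 / σ 0 - m * 1 * (α + Lyy)) := by
    intro k
    rw [le_div_iff₀ hcp]
    have := wsq_nonneg hw0 (u - x k ω)
    linarith [key k]
  set B1 := C / (1 / σ 0 - m * 1 * (α + Lyy)) with hB1
  have hB1n : 0 ≤ B1 := (hp.breg_nonneg (hr.y_mem 0 ω) w).trans (hb 0)
  have hC0 : 0 ≤ C := by
    have := mul_nonneg hB1n hcp.le
    rwa [hB1, div_mul_cancel₀ _ hcp.ne'] at this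
  have hy : ∀ k, ‖y k ω - w‖ ≤ 1 + 2 * B1 := by
    intro k
    have h1 := (hp.half_sq_le_breg (hr.y_mem k ω) w).trans (hb k)
    rw [norm_sub_rev]
    nlinarith [sq_nonneg (‖w - y k ω‖ - 1)]
  have hx : ∀ k i, ‖x k ω i - u i‖ ≤ 1 + ∑ j, 2 * C * τ 0 j := by
    intro k i
    have h1 := single_le_wsq hw0 (u - x k ω) i
    have h2 := mul_nonneg hcp.le (hp.breg_nonneg (hr.y_mem k ω) w)
    have h3 := key k
    have h4 : m / τ 0 i * ‖(u - x k ω) i‖ ^ 2 ≤ 2 * C := by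
      simp only [Pi.zero_apply, mul_zero, add_zero] at h1 h3
      linarith
    have h5 : ‖(u - x k ω) i‖ ^ 2 ≤ 2 * C * τ 0 i := by
      have h6 : ‖(u - x k ω) i‖ ^ 2 * m ≤ 2 * C * τ 0 i := by
        rw [div_mul_eq_mul_div, div_le_iff₀ (hτ i)] at h4
        linarith
      refine le_trans ?_ h6
      exact le_mul_of_one_le_right (sq_nonneg _) hm
    have h7 : 2 * C * τ 0 i ≤ ∑ j, 2 * C * τ 0 j :=
      Finset.single_le_sum (f := fun j => 2 * C * τ 0 j)
        (fun j _ => by have := hτ j; positivity) (Finset.mem_univ i)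
    rw [norm_sub_rev, ← Pi.sub_apply]
    nlinarith [sq_nonneg (‖(u - x k ω) i‖ - 1)]
  refine ⟨max (max (1 + 2 * B1) (1 + ∑ j, 2 * C * τ 0 j)) B1, fun k => ?_, fun k i => ?_,
    fun k => ?_⟩
  · exact (hy k).trans ((le_max_left _ _).trans (le_max_left _ _))
  · exact (hx k i).trans ((le_max_right _ _).trans (le_max_left _ _))
  · exact (hb k).trans (le_max_right _ _)

/-- Every other part of the potential tends to zero: the defect is dissipated with factor 1, the
primal gap is part of the gain, and the momentum terms vanish with the increments. -/
lemma GoodPath.distPart_tendsto [NeZero m]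
    (hr : Run f Φ h φ U τ σ (fun _ => 1) I x0 y0 x y z)
    (hp : Problem f Φ h φ U μ Lxx Lyx Lyy) (hs : StrictSteps Lxx Lyx Lyy τ σ α)
    {u : Primal n} {w : Y} (hS : IsSaddleR f Φ h u w) {ω : Ω}
    (hG : GoodPath f Φ h φ Lxx Lyx Lyy τ σ α x y z u w ω) :
    ∃ c, Tendsto (fun k => distPart φ (τ 0) (σ 0) u w (x k ω) (y k ω)) atTop (𝓝 c) := by
  obtain ⟨c, hc⟩ := hG.2
  obtain ⟨B, hBy, -, -⟩ := hG.bounded hr hp hs hS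
  obtain ⟨hdy, -, hdx⟩ := hG.increments hr hp hs hS
  obtain ⟨hq, hin⟩ := tendsto_momentum (α := α) hp hdy hdx
  have hdef : Tendsto (fun k => defect Φ (x k ω) (y k ω) w) atTop (𝓝 0) := by
    refine squeeze_zero (fun k => hp.defect_nonneg _ _ _) (fun k => ?_)
      (hG.dissip_tendsto hr hp hs hS)
    have h1 := (hr.dissip_ge hp hs.seq hS k ω).2.2.1
    have h2 := hS.sub_lagr_nonneg hr k ω
    linarith
  have hlag : Tendsto (fun k => lagrR f Φ h (x k ω) w - lagrR f Φ h u w) atTop (𝓝 0) := by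
    rw [← tendsto_add_atTop_iff_nat 1]
    refine squeeze_zero (fun k => hS.lagr_sub_nonneg hr (k + 1) ω) (fun k => ?_) hG.1
    have := (hr.gain_ge hp hs.seq hS k ω).2.1
    linarith
  have hqy : Tendsto (fun k => (gradY Φ (x k ω) (y k ω) - gradY Φ (x (k - 1) ω) (y (k - 1) ω))
      (y k ω - w)) atTop (𝓝 0) := by
    have h1 := (tendsto_zero_iff_norm_tendsto_zero.1 hq).mul_const B
    rw [zero_mul] at h1
    refine squeeze_zero_norm (fun k => ?_) h1
    exact (ContinuousLinearMap.le_opNorm _ _).trans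
      (mul_le_mul_of_nonneg_left (hBy k) (norm_nonneg _))
  refine ⟨c - (m * 1 * (0 + 0 + 0) + (m - 1) * 0), ?_⟩
  have h1 := hc.sub ((((hdef.add hqy).add hin).const_mul ((m : ℝ) * 1)).add
    (hlag.const_mul ((m : ℝ) - 1)))
  refine h1.congr fun k => ?_
  unfold potAt pot distPart
  rw [hs.τ_const k, hs.σ_const k]
  simp only [Pi.zero_apply, mul_zero, add_zero]
  ring

/-- A path that is good relative to a dense set of saddle points converges to a saddle point. -/
lemma tendsto_saddle_of_goodPath [NeZero m] [FiniteDimensional ℝ Y]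
    (hr : Run f Φ h φ U τ σ (fun _ => 1) I x0 y0 x y z)
    (hp : Problem f Φ h φ U μ Lxx Lyx Lyy) (hs : StrictSteps Lxx Lyx Lyy τ σ α)
    {us : Primal n} {ws : Y} (hS : IsSaddleR f Φ h us ws) {ω : Ω}
    (hG : GoodPath f Φ h φ Lxx Lyx Lyy τ σ α x y z us ws ω)
    {p : ℕ → Primal n × Y} (hpS : ∀ j, IsSaddleR f Φ h (p j).1 (p j).2)
    (hpG : ∀ j, GoodPath f Φ h φ Lxx Lyx Lyy τ σ α x y z (p j).1 (p j).2 ω)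
    (hdense : ∀ q : Primal n × Y, IsSaddleR f Φ h q.1 q.2 → ∀ O ∈ 𝓝 q, ∃ j, p j ∈ O) :
    ∃ a b, IsSaddleR f Φ h a b ∧ Tendsto (fun k => x k ω) atTop (𝓝 a) ∧
      Tendsto (fun k => y k ω) atTop (𝓝 b) := by
  have : ProperSpace Y := FiniteDimensional.proper_real Y
  have hτ := hs.seq.τ_pos 0
  have hσ := (hs.seq.step 0).σ_pos
  have hm : (1 : ℝ) ≤ m := by exact_mod_cast NeZero.one_le
  have hmpos : (0 : ℝ) < m := by linarith
  have hw0 : ∀ i, 0 ≤ m / τ 0 i := fun i => by have := hτ i; positivity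
  obtain ⟨B, hBy, hBx, hBb⟩ := hG.bounded hr hp hs hS
  obtain ⟨hdy, hdz, hdx⟩ := hG.increments hr hp hs hS
  obtain ⟨hq, -⟩ := tendsto_momentum (α := α) hp hdy hdx
  have hB0 : 0 ≤ B := (norm_nonneg _).trans (hBy 0)
  have hmem : ∀ k, (x k ω, y k ω) ∈ Metric.closedBall (us, ws) B := by
    intro k
    rw [Metric.mem_closedBall, Prod.dist_eq]
    refine max_le ((dist_pi_le_iff hB0).2 fun i => ?_) ?_
    · rw [dist_eq_norm]; exact hBx k i
    · rw [dist_eq_norm]; exact hBy k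
  obtain ⟨⟨a, b⟩, -, ψ, hψ, hlim⟩ := tendsto_subseq_of_bounded Metric.isBounded_closedBall hmem
  have hxa : Tendsto (fun k => x (ψ k) ω) atTop (𝓝 a) := (continuous_fst.tendsto (a, b)).comp hlim
  have hyb : Tendsto (fun k => y (ψ k) ω) atTop (𝓝 b) := (continuous_snd.tendsto (a, b)).comp hlim
  have hψt := hψ.tendsto_atTop
  have hab : IsSaddleR f Φ h a b := by
    refine IsSaddleR.of_tendsto hp (τ := τ 0) (σ := σ 0) hσ hxa (z := fun k => z (ψ k) ω)
      (x' := fun k => x (ψ k - 1) ω) (y' := fun k => y (ψ k - 1) ω) (yp := fun k => y (ψ k + 1) ω)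
      ?_ hyb ?_ (hq.comp hψt) (fun k i => ?_) (fun k => ?_) (fun k => hr.y_mem _ ω) hS.dom_y
      (fun k => hBb _)
    · simpa using (hdz.comp hψt).add hxa
    · simpa using (hdy.comp hψt).add hyb
    · rw [← hs.τ_const (ψ k)]; exact hr.z_min (ψ k) ω i
    · rw [← hs.σ_const (ψ k)]; exact hr.y_min (ψ k) ω
  have hbU : b ∈ U := hp.dom_h b hab.dom_y
  have hφc : Continuous φ := hp.φ_convexOn.locallyLipschitz.continuous
  have hcont : Continuous fun q : Primal n × Y => distPart φ (τ 0) (σ 0) q.1 q.2 a b := by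
    unfold distPart wsq breg
    fun_prop
  have hself : distPart φ (τ 0) (σ 0) a b a b = 0 := by
    simp [distPart, wsq]
  -- The cluster point depends on the path, so convergence of the distance to it is not available.
  -- With p near (a, b) from the dense sequence, the expression is at most twice `distPart` from p
  -- to (a, b) plus twice `distPart` from p to the iterate. The first is small by continuity; the
  -- second converges, and the subsequence identifies its limit as the same small number.
  have hE : Tendsto (fun k => 1 / 2 * wsq (fun i => m / τ 0 i) (a - x k ω)
      + 1 / (2 * σ 0) * ‖b - y k ω‖ ^ 2) atTop (𝓝 0) := by
    have hEn : ∀ k, 0 ≤ 1 / 2 * wsq (fun i => m / τ 0 i) (a - x k ω)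
      + 1 / (2 * σ 0) * ‖b - y k ω‖ ^ 2 := fun k => by
      have := wsq_nonneg hw0 (a - x k ω)
      positivity
    rw [Metric.tendsto_atTop']
    intro ε hε
    obtain ⟨j, hj⟩ := hdense (a, b) hab _ ((hcont.tendsto (a, b)).eventually
      (gt_mem_nhds (show distPart φ (τ 0) (σ 0) a b a b < ε / 4 by rw [hself]; linarith)))
    have hj : distPart φ (τ 0) (σ 0) (p j).1 (p j).2 a b < ε / 4 := hj
    obtain ⟨c, hc⟩ := (hpG j).distPart_tendsto hr hp hs (hpS j)
    have hc' : Tendsto (fun k => distPart φ (τ 0) (σ 0) (p j).1 (p j).2 (x (ψ k) ω) (y (ψ k) ω))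
        atTop (𝓝 (distPart φ (τ 0) (σ 0) (p j).1 (p j).2 a b)) := by
      unfold distPart
      refine Tendsto.add ?_ ((tendsto_breg hp.φ_convexOn hyb
        (fun k => hp.φ_diffAt (hr.y_mem _ ω)) (hp.φ_diffAt hbU) _).const_mul _)
      have : Continuous fun q : Primal n => 1 / 2 * wsq (fun i => m / τ 0 i) ((p j).1 - q) := by
        unfold wsq
        fun_prop
      exact (this.tendsto a).comp hxa
    have hceq := tendsto_nhds_unique (hc.comp hψt) hc'
    rw [hceq] at hc
    obtain ⟨N, hN⟩ := eventually_atTop.1 (hc.eventually (gt_mem_nhds hj))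
    refine ⟨N, fun k hk => ?_⟩
    rw [Real.dist_eq, sub_zero, abs_of_nonneg (hEn k)]
    have h1 := hN k hk.le
    unfold distPart at h1 hj
    have h2 := wsq_le_two _ hw0 a (x k ω) (p j).1
    have h3 := norm_sub_sq_le_two b (y k ω) (p j).2
    have h4 := hp.half_sq_le_breg hbU (p j).2
    have h5 := hp.half_sq_le_breg (hr.y_mem k ω) (p j).2
    have h6 : 1 / (2 * σ 0) * ‖b - y k ω‖ ^ 2
        ≤ 1 / σ 0 * (2 * breg φ (p j).2 b + 2 * breg φ (p j).2 (y k ω)) := by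
      rw [← one_div_mul_one_div, mul_comm (1 / 2 : ℝ), mul_assoc]
      refine mul_le_mul_of_nonneg_left ?_ (by positivity)
      linarith
    linarith
  refine ⟨a, b, hab, ?_, ?_⟩
  · have : Tendsto (fun k => a - x k ω) atTop (𝓝 0) := by
      refine tendsto_pi_nhds.2 fun i => tendsto_of_mul_sq (c := 1 / 2 * (m / τ 0 i))
        (by have := hτ i; positivity) hE fun k => ?_
      have h1 := single_le_wsq hw0 (a - x k ω) i
      have h2 : 0 ≤ 1 / (2 * σ 0) * ‖b - y k ω‖ ^ 2 := by positivity
      linarith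
    simpa using this.const_sub a
  · have : Tendsto (fun k => b - y k ω) atTop (𝓝 0) := by
      refine tendsto_of_mul_sq (c := 1 / (2 * σ 0)) (by positivity) hE fun k => ?_
      have h1 := wsq_nonneg hw0 (a - x k ω)
      linarith
    simpa using this.const_sub b

variable [MeasurableSpace Ω] {P : Measure Ω} [IsProbabilityMeasure P]

/-- The exceptional null set depends on the saddle point; a countable dense family of saddle points
reduces it to a single null set. -/
theorem Run.exists_limit [NeZero m] [FiniteDimensional ℝ Y] [MeasurableSpace Y] [BorelSpace Y]
    (hI : UniformBlocks P I)
    (hr : Run f Φ h φ U τ σ (fun _ => 1) I x0 y0 x y z)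
    (hp : Problem f Φ h φ U μ Lxx Lyx Lyy) (hs : StrictSteps Lxx Lyx Lyy τ σ α)
    {us : Primal n} {ws : Y} (hS : IsSaddleR f Φ h us ws) :
    ∃ (X : Ω → Primal n) (Z : Ω → Y), Measurable X ∧ Measurable Z ∧
      ∀ᵐ ω ∂P, IsSaddleR f Φ h (X ω) (Z ω) ∧
        Tendsto (fun k => x k ω) atTop (𝓝 (X ω)) ∧ Tendsto (fun k => y k ω) atTop (𝓝 (Z ω)) := by
  have : ProperSpace Y := FiniteDimensional.proper_real Y
  let S : Set (Primal n × Y) := {q | IsSaddleR f Φ h q.1 q.2}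
  have : Nonempty S := ⟨⟨(us, ws), hS⟩⟩
  let p : ℕ → Primal n × Y := fun j => (TopologicalSpace.denseSeq S j : Primal n × Y)
  have hpS : ∀ j, IsSaddleR f Φ h (p j).1 (p j).2 := fun j => (TopologicalSpace.denseSeq S j).2
  have hdense : ∀ q : Primal n × Y, IsSaddleR f Φ h q.1 q.2 → ∀ O ∈ 𝓝 q, ∃ j, p j ∈ O := by
    intro q hq O hO
    have h1 := (TopologicalSpace.denseRange_denseSeq S) ⟨q, hq⟩
    have h2 : (Subtype.val ⁻¹' O : Set S) ∈ 𝓝 (⟨q, hq⟩ : S) :=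
      continuous_subtype_val.continuousAt.preimage_mem_nhds hO
    obtain ⟨_, hs1, j, rfl⟩ := mem_closure_iff_nhds.1 h1 _ h2
    exact ⟨j, hs1⟩
  have hall : ∀ᵐ ω ∂P, ∃ a b, IsSaddleR f Φ h a b ∧ Tendsto (fun k => x k ω) atTop (𝓝 a) ∧
      Tendsto (fun k => y k ω) atTop (𝓝 b) := by
    filter_upwards [hr.ae_gain_tendsto hI hp hs.seq hS,
      ae_all_iff.2 fun j => hr.ae_gain_tendsto hI hp hs.seq (hpS j)] with ω h1 h2
    exact tendsto_saddle_of_goodPath hr hp hs hS h1 hpS h2 hdense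
  obtain ⟨X, hX, hXl⟩ := measurable_limit_of_tendsto_metrizable_ae (μ := P) (L := atTop)
    (fun k => ((hr.x_det k).measurable hI.meas).aemeasurable)
    (hall.mono fun ω ⟨a, _, _, h, _⟩ => ⟨a, h⟩)
  obtain ⟨Z, hZ, hZl⟩ := measurable_limit_of_tendsto_metrizable_ae (μ := P) (L := atTop)
    (fun k => ((hr.y_det k).measurable hI.meas).aemeasurable)
    (hall.mono fun ω ⟨_, b, _, _, h⟩ => ⟨b, h⟩)
  refine ⟨X, Z, hX, hZ, ?_⟩
  filter_upwards [hall, hXl, hZl] with ω ⟨a, b, hab, ha, hb⟩ h1 h2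
  rw [tendsto_nhds_unique h1 ha, tendsto_nhds_unique h2 hb]
  exact ⟨hab, ha, hb⟩

end Convergence

/-! ### Moments of the limit -/

section RandomSaddle

variable {m : ℕ} {n : Fin m → ℕ} {Y : Type*} [NormedAddCommGroup Y] [NormedSpace ℝ Y]
  {f : (i : Fin m) → EuclideanSpace ℝ (Fin (n i)) → EReal} {Φ : Primal n → Y → ℝ}
  {h : Y → EReal} {φ : Y → ℝ} {U : Set Y} {μ Lxx Lyx : Fin m → ℝ} {Lyy : ℝ}
  {Ω : Type*}
  {τ : ℕ → Fin m → ℝ} {σ : ℕ → ℝ} {α : ℝ} {I : ℕ → Ω → Fin m} {x0 : Primal n} {y0 : Y}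
  {x : ℕ → Ω → Primal n} {y : ℕ → Ω → Y} {z : ℕ → Ω → Primal n}
variable [MeasurableSpace Ω] {P : Measure Ω} [IsProbabilityMeasure P]

/-- The mean square distance to the solution is bounded by the ratio of `τ` and `t`. -/
lemma Run.mean_square_bound [NeZero m] {ν : Fin m → ℝ} {σ θ t α β : ℕ → ℝ}
    (hI : UniformBlocks P I)
    (hr : Run f Φ h φ U τ σ θ I x0 y0 x y z)
    (hp : Problem f Φ h φ U μ Lxx Lyx Lyy)
    (hν : ∀ i, ν i ≤ μ i) (hν0 : ∀ i, 0 ≤ ν i) (hs : StepSeq ν Lxx Lyx Lyy τ σ θ t α β)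
    {u : Primal n} {w : Y} (hS : IsSaddleR f Φ h u w) {K : ℕ} (hK : 1 ≤ K) (hy0 : y0 ∈ U)
    (hx0 : ∀ i, f i (x0 i) ≠ ⊤) {b : ℝ} (hb : ∀ i, 2 * (τ K i / t K) ≤ b) :
    Integrable (fun ω => wsq 1 (x K ω - u)) P ∧
    ∫ ω, wsq 1 (x K ω - u) ∂P ≤ b * m * Delta f Φ h φ ν Lyy (τ 0) (σ 0) u w x0 y0 := by
  have hm : (1 : ℝ) ≤ m := by exact_mod_cast NeZero.one_le
  have hd : Determined I K fun ω => wsq 1 (x K ω - u) := (hr.x_det K).comp fun a => wsq 1 (a - u)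
  refine ⟨hd.integrable hI.meas, ?_⟩
  have htK := (hs.step K).t_pos
  have i0 : Fin m := ⟨0, NeZero.pos m⟩
  have hb0 : 0 < b := lt_of_lt_of_le (by have := hs.τ_pos K i0; positivity) (hb i0)
  have h1 := hr.primal_bound hI hp hν hs hS hK hy0 hx0
  have hd' : Determined I K fun ω =>
      1 / 2 * wsq (fun i => m / τ K i + (m - 1) * ν i) (u - x K ω) :=
    (hr.x_det K).comp fun a => 1 / 2 * wsq (fun i => m / τ K i + (m - 1) * ν i) (u - a)
  have h2 : ∫ ω, wsq 1 (x K ω - u) ∂P ≤ ∫ ω, b * t K *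
      (1 / 2 * wsq (fun i => m / τ K i + (m - 1) * ν i) (u - x K ω)) ∂P := by
    refine integral_mono (hd.integrable hI.meas)
      ((hd'.comp fun a => b * t K * a).integrable hI.meas) fun ω => ?_
    simp only
    rw [wsq_neg]
    unfold wsq
    rw [Finset.mul_sum, Finset.mul_sum]
    refine Finset.sum_le_sum fun i _ => ?_
    rw [← mul_assoc, ← mul_assoc]
    refine mul_le_mul_of_nonneg_right ?_ (sq_nonneg _)
    have h3 := hs.τ_pos K i
    have h4 := hb i
    have h5 := mul_nonneg (show (0 : ℝ) ≤ m - 1 by linarith) (hν0 i)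
    have h6 : 1 ≤ b * t K * (1 / 2) * (1 / τ K i) := by
      rw [mul_div_assoc', div_le_iff₀ htK] at h4
      rw [mul_one_div, le_div_iff₀ h3]
      linarith
    have h7 : 1 / τ K i ≤ m / τ K i + (m - 1) * ν i := by
      have : 1 / τ K i ≤ m / τ K i := div_le_div_of_nonneg_right hm h3.le
      linarith
    rw [Pi.one_apply]
    exact h6.trans (mul_le_mul_of_nonneg_left h7 (by positivity))
  rw [integral_const_mul] at h2
  have h3 := mul_le_mul_of_nonneg_left h1 hb0.le
  linarith

lemma norm_sq_le_wsq (v : Primal n) : ‖v‖ ^ 2 ≤ wsq 1 v := by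
  have h0 : 0 ≤ wsq 1 v := wsq_nonneg (fun _ => zero_le_one) v
  have h1 : ‖v‖ ≤ √(wsq 1 v) := by
    refine (pi_norm_le_iff_of_nonneg (Real.sqrt_nonneg _)).2 fun i => Real.le_sqrt_of_sq_le ?_
    have := single_le_wsq (d := 1) (fun _ => zero_le_one) v i
    simpa using this
  calc ‖v‖ ^ 2 ≤ √(wsq 1 v) ^ 2 := pow_le_pow_left₀ (norm_nonneg _) h1 2
    _ = wsq 1 v := Real.sq_sqrt h0

/-- Fatou's lemma for second moments. -/
lemma integrable_norm_sq_of_tendsto {E : Type*} [NormedAddCommGroup E] [MeasurableSpace E]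
    [BorelSpace E] [SecondCountableTopology E] {g : ℕ → Ω → E} {G : Ω → E} (hG : Measurable G)
    {c : E} {B : ℝ}
    (hlim : ∀ᵐ ω ∂P, Tendsto (fun k => g k ω) atTop (𝓝 (G ω))) (hg : ∀ k, Measurable (g k))
    (hint : ∀ k, Integrable (fun ω => ‖g k ω - c‖ ^ 2) P)
    (hB : ∀ k, ∫ ω, ‖g k ω - c‖ ^ 2 ∂P ≤ B) : Integrable (fun ω => ‖G ω‖ ^ 2) P := by
  have h1 : Integrable (fun ω => ‖G ω - c‖ ^ 2) P := by
    refine ⟨((hG.sub_const c).norm.pow_const 2).aestronglyMeasurable, ?_⟩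
    rw [HasFiniteIntegral, lintegral_congr_ae (g := fun ω => liminf (fun k =>
      ‖‖g k ω - c‖ ^ 2‖ₑ) atTop) (hlim.mono fun ω hω =>
        ((hω.sub_const c).norm.pow 2).enorm.liminf_eq.symm)]
    refine (lintegral_liminf_le fun k => (((hg k).sub_const c).norm.pow_const 2).enorm).trans_lt ?_
    refine lt_of_le_of_lt (liminf_le_of_le (a := ENNReal.ofReal B) (by isBoundedDefault)
      fun b hb => ?_) ENNReal.ofReal_lt_top
    obtain ⟨k, hk⟩ := hb.exists
    refine hk.trans ?_
    rw [lintegral_congr (g := fun ω => ENNReal.ofReal (‖g k ω - c‖ ^ 2)) fun ω =>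
      Real.enorm_of_nonneg (sq_nonneg _),
      ← ofReal_integral_eq_lintegral_ofReal (hint k) (Eventually.of_forall fun ω => sq_nonneg _)]
    exact ENNReal.ofReal_le_ofReal (hB k)
  refine Integrable.mono' ((h1.const_mul 2).add (integrable_const (2 * ‖c‖ ^ 2)))
    (hG.norm.pow_const 2).aestronglyMeasurable (Eventually.of_forall fun ω => ?_)
  rw [Real.norm_of_nonneg (sq_nonneg _)]
  have h2 : ‖G ω‖ ≤ ‖G ω - c‖ + ‖c‖ := by simpa using norm_add_le (G ω - c) c
  simp only [Pi.add_apply]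
  nlinarith [norm_nonneg (G ω), sq_nonneg (‖G ω - c‖ - ‖c‖)]

lemma Run.integrable_limit [NeZero m] [FiniteDimensional ℝ Y] [MeasurableSpace Y] [BorelSpace Y]
    (hI : UniformBlocks P I)
    (hr : Run f Φ h φ U τ σ (fun _ => 1) I x0 y0 x y z)
    (hp : Problem f Φ h φ U μ Lxx Lyx Lyy) (hs : StrictSteps Lxx Lyx Lyy τ σ α)
    {us : Primal n} {ws : Y} (hS : IsSaddleR f Φ h us ws) (hy0 : y0 ∈ U)
    (hx0 : ∀ i, f i (x0 i) ≠ ⊤) {X : Ω → Primal n} {Z : Ω → Y} (hX : Measurable X)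
    (hZ : Measurable Z)
    (hlim : ∀ᵐ ω ∂P, Tendsto (fun k => x k ω) atTop (𝓝 (X ω)) ∧
      Tendsto (fun k => y k ω) atTop (𝓝 (Z ω))) :
    Integrable (fun ω => ‖X ω‖ ^ 2) P ∧ Integrable (fun ω => ‖Z ω‖ ^ 2) P := by
  have : ProperSpace Y := FiniteDimensional.proper_real Y
  have hν : ∀ i, (0 : Fin m → ℝ) i ≤ μ i := hp.μ_nonneg
  have hν0 : ∀ i, 0 ≤ (0 : Fin m → ℝ) i := fun _ => le_rfl
  have hm : (1 : ℝ) ≤ m := by exact_mod_cast NeZero.one_le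
  constructor
  · refine integrable_norm_sq_of_tendsto (c := us) (g := fun k => x (k + 1))
      (B := (∑ i, 2 * τ 0 i) * m * Delta f Φ h φ 0 Lyy (τ 0) (σ 0) us ws x0 y0) hX
      (hlim.mono fun ω hω => hω.1.comp (tendsto_add_atTop_nat 1))
      (fun k => (hr.x_det (k + 1)).measurable hI.meas)
      (fun k => ((hr.x_det (k + 1)).comp fun a => ‖a - us‖ ^ 2).integrable hI.meas) fun k => ?_
    obtain ⟨h1, h2⟩ := hr.mean_square_bound hI hp hν hν0 hs.seq hS
      (show 1 ≤ k + 1 by omega) hy0 hx0 (b := ∑ i, 2 * τ 0 i) (fun i => by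
        rw [div_one, hs.τ_const (k + 1)]
        exact Finset.single_le_sum (f := fun i => 2 * τ 0 i)
          (fun j _ => by have := hs.seq.τ_pos 0 j; positivity) (Finset.mem_univ i))
    refine le_trans (integral_mono (((hr.x_det (k + 1)).comp
      fun a => ‖a - us‖ ^ 2).integrable hI.meas) h1 fun ω => norm_sq_le_wsq _) h2
  · refine integrable_norm_sq_of_tendsto (c := ws) (g := fun k => y (k + 1))
      (B := 2 * ((1 / σ 0 - m * 1 * (α + Lyy))⁻¹
        * (m * Delta f Φ h φ 0 Lyy (τ 0) (σ 0) us ws x0 y0))) hZ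
      (hlim.mono fun ω hω => hω.2.comp (tendsto_add_atTop_nat 1))
      (fun k => (hr.y_det (k + 1)).measurable hI.meas)
      (fun k => ((hr.y_det (k + 1)).comp fun a => ‖a - ws‖ ^ 2).integrable hI.meas) fun k => ?_
    obtain ⟨h1, h2⟩ := hr.dual_bound hI hp hν hν0 hs.seq hS (show 1 ≤ k + 1 by omega) hy0 hx0
    rw [hs.σ_const (k + 1), one_mul] at h2
    have h3 := (le_inv_mul_iff₀ hs.coeff_pos).2 h2
    refine le_trans (integral_mono (((hr.y_det (k + 1)).comp
      fun a => ‖a - ws‖ ^ 2).integrable hI.meas) (h1.const_mul 2) fun ω => ?_) ?_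
    · have := hp.half_sq_le_breg (hr.y_mem (k + 1) ω) ws
      rw [norm_sub_rev] at this
      simp only
      linarith
    · rw [integral_const_mul]
      linarith

end RandomSaddle

/-! ### The decrease along a single path -/

section Noise

variable {m : ℕ} {n : Fin m → ℕ} {Y : Type*} [NormedAddCommGroup Y] [NormedSpace ℝ Y]
  {f : (i : Fin m) → EuclideanSpace ℝ (Fin (n i)) → EReal} {Φ : Primal n → Y → ℝ}
  {h : Y → EReal} {φ : Y → ℝ} {U : Set Y} {μ Lxx Lyx : Fin m → ℝ} {Lyy : ℝ}
  {Ω : Type*}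
  {τ : ℕ → Fin m → ℝ} {σ : ℕ → ℝ} {α : ℝ} {I : ℕ → Ω → Fin m} {x0 : Primal n} {y0 : Y}
  {x : ℕ → Ω → Primal n} {y : ℕ → Ω → Y} {z : ℕ → Ω → Primal n}

/-- The Lyapunov function and the primal gap after step `k`, if block `i` were drawn. -/
noncomputable def nextAt (f : (i : Fin m) → EuclideanSpace ℝ (Fin (n i)) → EReal)
    (Φ : Primal n → Y → ℝ) (h : Y → EReal) (φ : Y → ℝ) (Lyx : Fin m → ℝ) (Lyy : ℝ)
    (τ : Fin m → ℝ) (σ α : ℝ) (x : ℕ → Ω → Primal n) (y : ℕ → Ω → Y) (z : ℕ → Ω → Primal n)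
    (u : Primal n) (w : Y) (k : ℕ) (i : Fin m) (ω : Ω) : ℝ :=
  pot f Φ h φ 0 Lyx Lyy τ σ 1 α Lyy (Function.update (x k ω) i (z k ω i)) (x k ω) (y (k + 1) ω)
      (y k ω) u w
    + (lagrR f Φ h (Function.update (x k ω) i (z k ω i)) w - lagrR f Φ h u w)

/-- The deviation of `nextAt` from its conditional mean. -/
noncomputable def noise (f : (i : Fin m) → EuclideanSpace ℝ (Fin (n i)) → EReal)
    (Φ : Primal n → Y → ℝ) (h : Y → EReal) (φ : Y → ℝ) (Lyx : Fin m → ℝ) (Lyy : ℝ)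
    (τ : Fin m → ℝ) (σ α : ℝ) (I : ℕ → Ω → Fin m) (x : ℕ → Ω → Primal n) (y : ℕ → Ω → Y)
    (z : ℕ → Ω → Primal n) (u : Primal n) (w : Y) (k : ℕ) (ω : Ω) : ℝ :=
  nextAt f Φ h φ Lyx Lyy τ σ α x y z u w k (I k ω) ω
    - 1 / m * ∑ i, nextAt f Φ h φ Lyx Lyy τ σ α x y z u w k i ω

/-- The deviation of the `j`-th block of the primal step from its conditional mean. -/
noncomputable def primalNoise (I : ℕ → Ω → Fin m) (x z : ℕ → Ω → Primal n) (j : Fin m) (k : ℕ)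
    (ω : Ω) : EuclideanSpace ℝ (Fin (n j)) :=
  ((if I k ω = j then (1 : ℝ) else 0) - 1 / m) • (z k ω j - x k ω j)

lemma norm_primalNoise_le [NeZero m] (I : ℕ → Ω → Fin m) (x z : ℕ → Ω → Primal n) (j : Fin m)
    (k : ℕ) (ω : Ω) : ‖primalNoise I x z j k ω‖ ≤ ‖z k ω j - x k ω j‖ := by
  have hm : (1 : ℝ) ≤ m := by exact_mod_cast NeZero.one_le
  have h1 : (1 : ℝ) / m ≤ 1 := by rw [div_le_one (by linarith)]; exact hm
  have h2 : (0 : ℝ) < 1 / m := by positivity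
  unfold primalNoise
  rw [norm_smul]
  refine mul_le_of_le_one_left (norm_nonneg _) ?_
  rw [Real.norm_eq_abs, abs_le]
  split_ifs <;> constructor <;> linarith

/-- The additional gap in `nextAt` raises the weight of L from m - 1 to m. Then `defect`, the cross
term and L combine so that the part depending on w no longer depends on the block. Only the squared
distance couples the reference point to the draw, and a difference of two such squares is linear in
the iterate. -/
lemma nextAt_sub [NeZero m] (u u' : Primal n) (w w' : Y) (k : ℕ) (ω : Ω) :
    ∃ d : ℝ, ∀ i, nextAt f Φ h φ Lyx Lyy (τ 0) (σ 0) α x y z u w k i ω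
      - nextAt f Φ h φ Lyx Lyy (τ 0) (σ 0) α x y z u' w' k i ω
      = d - m / τ 0 i * inner ℝ (u i - u' i) (z k ω i - x k ω i) := by
  refine ⟨1 / σ 0 * (breg φ w (y (k + 1) ω) - breg φ w' (y (k + 1) ω))
    - m * gradY Φ (x k ω) (y k ω) (w' - w)
    - m * ((h w).toReal - (h w').toReal) - m * (lagrR f Φ h u w - lagrR f Φ h u' w')
    + ∑ j, m / τ 0 j * (1 / 2 * (‖u j - x k ω j‖ ^ 2 - ‖u' j - x k ω j‖ ^ 2)), fun i => ?_⟩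
  set xi := Function.update (x k ω) i (z k ω i) with hxi
  have h1 : 1 / 2 * wsq (fun j => m / τ 0 j) (u - xi) - 1 / 2 * wsq (fun j => m / τ 0 j) (u' - xi)
      = ∑ j, m / τ 0 j * (1 / 2 * (‖u j - x k ω j‖ ^ 2 - ‖u' j - x k ω j‖ ^ 2))
        - m / τ 0 i * inner ℝ (u i - u' i) (z k ω i - x k ω i) := by
    have h2 := sum_update (x := x k ω) (z := z k ω)
      (fun j v => m / τ 0 j * (1 / 2 * (‖u j - v‖ ^ 2 - ‖u' j - v‖ ^ 2))) i
    have h3 : m / τ 0 i * (1 / 2 * (‖u i - z k ω i‖ ^ 2 - ‖u' i - z k ω i‖ ^ 2))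
        - m / τ 0 i * (1 / 2 * (‖u i - x k ω i‖ ^ 2 - ‖u' i - x k ω i‖ ^ 2))
        = - (m / τ 0 i * inner ℝ (u i - u' i) (z k ω i - x k ω i)) := by
      simp only [norm_sub_sq_real, inner_sub_left, inner_sub_right]
      ring
    rw [h3] at h2
    rw [sub_eq_add_neg _ (m / τ 0 i * _), ← h2]
    unfold wsq
    rw [Finset.mul_sum, Finset.mul_sum, ← Finset.sum_sub_distrib]
    refine Finset.sum_congr rfl fun j _ => ?_
    simp only [Pi.sub_apply, ← hxi]
    ring
  have h4 : (gradY Φ xi (y (k + 1) ω) - gradY Φ (x k ω) (y k ω)) (y (k + 1) ω - w)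
      - (gradY Φ xi (y (k + 1) ω) - gradY Φ (x k ω) (y k ω)) (y (k + 1) ω - w')
      = gradY Φ xi (y (k + 1) ω) (y (k + 1) ω - w) - gradY Φ xi (y (k + 1) ω) (y (k + 1) ω - w')
        - gradY Φ (x k ω) (y k ω) (w' - w) := by
    simp only [sub_apply, map_sub]
    ring
  have h5 : lagrR f Φ h xi w - lagrR f Φ h xi w' = Φ xi w - Φ xi w'
      - ((h w).toReal - (h w').toReal) := by
    unfold lagrR; ring
  unfold nextAt pot defect
  simp only [Pi.zero_apply, mul_zero, add_zero, ← hxi]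
  linear_combination h1 + m * h4 + m * h5

/-- The part d common to all blocks drops out on centering. What remains is linear in u, so even a
random u can be pulled out of the sum over the steps. -/
lemma noise_sub [NeZero m] (u u' : Primal n) (w w' : Y) (k : ℕ) (ω : Ω) :
    noise f Φ h φ Lyx Lyy (τ 0) (σ 0) α I x y z u w k ω
      = noise f Φ h φ Lyx Lyy (τ 0) (σ 0) α I x y z u' w' k ω
        - ∑ j, m / τ 0 j * inner ℝ (u j - u' j) (primalNoise I x z j k ω) := by
  have hm : (m : ℝ) ≠ 0 := by exact_mod_cast NeZero.ne m
  obtain ⟨d, hd⟩ := nextAt_sub (f := f) (Φ := Φ) (h := h) (φ := φ) (Lyx := Lyx) (Lyy := Lyy)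
    (τ := τ) (σ := σ) (α := α) (x := x) (y := y) (z := z) u u' w w' k ω
  have h1 : ∑ i, nextAt f Φ h φ Lyx Lyy (τ 0) (σ 0) α x y z u w k i ω
      - ∑ i, nextAt f Φ h φ Lyx Lyy (τ 0) (σ 0) α x y z u' w' k i ω
      = m * d - ∑ j, m / τ 0 j * inner ℝ (u j - u' j) (z k ω j - x k ω j) := by
    rw [← Finset.sum_sub_distrib, Finset.sum_congr rfl fun i _ => hd i, Finset.sum_sub_distrib]
    simp
  have h2 : ∑ j, m / τ 0 j * inner ℝ (u j - u' j) (primalNoise I x z j k ω)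
      = m / τ 0 (I k ω) * inner ℝ (u (I k ω) - u' (I k ω)) (z k ω (I k ω) - x k ω (I k ω))
        - 1 / m * ∑ j, m / τ 0 j * inner ℝ (u j - u' j) (z k ω j - x k ω j) := by
    have h3 : ∀ j, m / τ 0 j * inner ℝ (u j - u' j) (primalNoise I x z j k ω)
        = (if I k ω = j then m / τ 0 j * inner ℝ (u j - u' j) (z k ω j - x k ω j) else 0)
          - 1 / m * (m / τ 0 j * inner ℝ (u j - u' j) (z k ω j - x k ω j)) := by
      intro j
      unfold primalNoise
      rw [inner_smul_right]
      split_ifs <;> ring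
    rw [Finset.sum_congr rfl fun j _ => h3 j, Finset.sum_sub_distrib, ← Finset.mul_sum,
      Finset.sum_ite_eq, if_pos (Finset.mem_univ _)]
  have h4 := hd (I k ω)
  have h5 : 1 / (m : ℝ) * (m * d) = d := by field_simp
  unfold noise
  rw [h2]
  linear_combination h4 - 1 / m * h1 - h5

/-- The decrease of the Lyapunov function along a single path. -/
lemma Run.pathwise_decrease [NeZero m]
    (hr : Run f Φ h φ U τ σ (fun _ => 1) I x0 y0 x y z)
    (hp : Problem f Φ h φ U μ Lxx Lyx Lyy) (hs : StrictSteps Lxx Lyx Lyy τ σ α)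
    {u : Primal n} {w : Y} (hu : ∀ i, f i (u i) ≠ ⊤) (hw : h w ≠ ⊤) (k : ℕ) (ω : Ω) :
    potAt f Φ h φ 0 Lyx Lyy τ σ (fun _ => 1) (fun _ => α) (fun _ => Lyy) x y u w (k + 1) ω
      + (lagrR f Φ h (x (k + 1) ω) w - lagrR f Φ h u (y (k + 1) ω))
    ≤ potAt f Φ h φ 0 Lyx Lyy τ σ (fun _ => 1) (fun _ => α) (fun _ => Lyy) x y u w k ω
      + noise f Φ h φ Lyx Lyy (τ 0) (σ 0) α I x y z u w k ω := by
  have hmpos : (0 : ℝ) < m := by exact_mod_cast NeZero.pos m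
  have hν : ∀ i, (0 : Fin m → ℝ) i ≤ μ i := hp.μ_nonneg
  have hst := hs.seq.step k
  have h1 := hp.potential_decrease hν hst (hr.y_mem k ω) (hr.z_min k ω) (hr.y_min k ω) hu hw
    (hr.momentum_bound hp hs.seq.α_pos hs.seq.β_nonneg hs.seq.β_zero k ω)
  have h2 : ∀ i, 0 ≤ slackX Lxx Lyx (τ k) α i * ‖z k ω i - x k ω i‖ ^ 2 := fun i =>
    mul_nonneg (hst.slackX_nonneg i) (sq_nonneg _)
  have h3 := mul_nonneg hst.slackY_nonneg (sq_nonneg ‖y (k + 1) ω - y k ω‖)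
  have h4 := hp.defect_nonneg (x k ω) (y k ω) w
  have h5 : ∀ i, nextAt f Φ h φ Lyx Lyy (τ 0) (σ 0) α x y z u w k i ω
      ≤ 1 * pot f Φ h φ 0 Lyx Lyy (τ (k + 1)) (σ (k + 1)) 1 α Lyy
        (Function.update (x k ω) i (z k ω i)) (x k ω) (y (k + 1) ω) (y k ω) u w
        + (1 * m - 1 * (m - 1))
          * (lagrR f Φ h (Function.update (x k ω) i (z k ω i)) w - lagrR f Φ h u w)
        + 1 * m * (slackX Lxx Lyx (τ k) α i * ‖z k ω i - x k ω i‖ ^ 2) := by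
    intro i
    rw [hs.τ_const (k + 1), hs.σ_const (k + 1)]
    have := mul_nonneg hmpos.le (h2 i)
    unfold nextAt
    linarith
  have h6 := Finset.sum_le_sum fun i (_ : i ∈ Finset.univ) => h5 i
  have h7 : ∑ i, nextAt f Φ h φ Lyx Lyy (τ 0) (σ 0) α x y z u w k i ω
      + m * (lagrR f Φ h u w - lagrR f Φ h u (y (k + 1) ω))
      ≤ m * potAt f Φ h φ 0 Lyx Lyy τ σ (fun _ => 1) (fun _ => α) (fun _ => Lyy) x y u w k ω := by
    unfold potAt
    have h8 := mul_nonneg hmpos.le h3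
    have h9 := mul_nonneg hmpos.le h4
    linarith
  have h8 := mul_le_mul_of_nonneg_left h7 (show (0 : ℝ) ≤ 1 / m by positivity)
  have h9 : ∀ a : ℝ, 1 / (m : ℝ) * (m * a) = a := fun a => by field_simp
  rw [mul_add, h9, h9] at h8
  have h10 : potAt f Φ h φ 0 Lyx Lyy τ σ (fun _ => 1) (fun _ => α) (fun _ => Lyy) x y u w (k + 1) ω
      + (lagrR f Φ h (x (k + 1) ω) w - lagrR f Φ h u w)
      = nextAt f Φ h φ Lyx Lyy (τ 0) (σ 0) α x y z u w k (I k ω) ω := by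
    unfold potAt nextAt
    rw [hs.τ_const (k + 1), hs.σ_const (k + 1), hr.x_succ k ω, Nat.add_sub_cancel]
  unfold noise
  linarith

/-- The sum of the gaps at an arbitrary saddle point along a single path. -/
lemma Run.pathwise_sum [NeZero m]
    (hr : Run f Φ h φ U τ σ (fun _ => 1) I x0 y0 x y z)
    (hp : Problem f Φ h φ U μ Lxx Lyx Lyy) (hs : StrictSteps Lxx Lyx Lyy τ σ α)
    {u : Primal n} {w : Y} (hS : IsSaddleR f Φ h u w) (us : Primal n) (ws : Y) (K : ℕ) (ω : Ω) :
    ∑ k ∈ Finset.range K, (lagrR f Φ h (x (k + 1) ω) w - lagrR f Φ h u (y (k + 1) ω))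
    ≤ pot f Φ h φ 0 Lyx Lyy (τ 0) (σ 0) 1 α Lyy x0 x0 y0 y0 u w
      + ∑ k ∈ Finset.range K, noise f Φ h φ Lyx Lyy (τ 0) (σ 0) α I x y z us ws k ω
      + ∑ j, m / (2 * τ 0 j) * (‖u j - us j‖ ^ 2
        + ‖∑ k ∈ Finset.range K, primalNoise I x z j k ω‖ ^ 2) := by
  have h1 : ∀ K, potAt f Φ h φ 0 Lyx Lyy τ σ (fun _ => 1) (fun _ => α) (fun _ => Lyy) x y u w K ω
      + ∑ k ∈ Finset.range K, (lagrR f Φ h (x (k + 1) ω) w - lagrR f Φ h u (y (k + 1) ω))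
    ≤ pot f Φ h φ 0 Lyx Lyy (τ 0) (σ 0) 1 α Lyy x0 x0 y0 y0 u w
      + ∑ k ∈ Finset.range K, noise f Φ h φ Lyx Lyy (τ 0) (σ 0) α I x y z u w k ω := by
    intro K
    induction K with
    | zero => simp [potAt, hr.init_x, hr.init_y]
    | succ K ih =>
      have := hr.pathwise_decrease hp hs hS.dom_x hS.dom_y K ω
      rw [Finset.sum_range_succ, Finset.sum_range_succ]
      linarith
  have hν0 : ∀ i, 0 ≤ (0 : Fin m → ℝ) i := fun _ => le_rfl
  have h2 := hr.potAt_nonneg hp hν0 hs.seq hS K ω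
  have h3 : ∑ k ∈ Finset.range K, noise f Φ h φ Lyx Lyy (τ 0) (σ 0) α I x y z u w k ω
      = ∑ k ∈ Finset.range K, noise f Φ h φ Lyx Lyy (τ 0) (σ 0) α I x y z us ws k ω
        - ∑ j, m / τ 0 j
          * inner ℝ (u j - us j) (∑ k ∈ Finset.range K, primalNoise I x z j k ω) := by
    rw [Finset.sum_congr rfl fun k _ => noise_sub u us w ws k ω, Finset.sum_sub_distrib,
      Finset.sum_comm]
    simp only [inner_sum, Finset.mul_sum]
  -- A random u may be correlated with the accumulated deviations, so the product is not averaged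
  -- but split into two squares.
  have h4 : -∑ j, m / τ 0 j
          * inner ℝ (u j - us j) (∑ k ∈ Finset.range K, primalNoise I x z j k ω)
      ≤ ∑ j, m / (2 * τ 0 j) * (‖u j - us j‖ ^ 2
        + ‖∑ k ∈ Finset.range K, primalNoise I x z j k ω‖ ^ 2) := by
    rw [← Finset.sum_neg_distrib]
    refine Finset.sum_le_sum fun j _ => ?_
    have hτ := hs.seq.τ_pos 0 j
    have h5 : (m : ℝ) / τ 0 j = m / (2 * τ 0 j) * 2 := by field_simp
    rw [h5, mul_assoc, ← mul_neg]
    refine mul_le_mul_of_nonneg_left ?_ (by positivity)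
    have h6 := norm_add_sq_real (u j - us j) (∑ k ∈ Finset.range K, primalNoise I x z j k ω)
    have h7 := sq_nonneg ‖(u j - us j) + ∑ k ∈ Finset.range K, primalNoise I x z j k ω‖
    linarith
  have h5 := h1 K
  linarith

end Noise

/-! ### The rate at a random saddle point -/

section RandomSaddle

variable {m : ℕ} {n : Fin m → ℕ} {Y : Type*} [NormedAddCommGroup Y] [NormedSpace ℝ Y]
  {f : (i : Fin m) → EuclideanSpace ℝ (Fin (n i)) → EReal} {Φ : Primal n → Y → ℝ}
  {h : Y → EReal} {φ : Y → ℝ} {U : Set Y} {μ Lxx Lyx : Fin m → ℝ} {Lyy : ℝ}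
  {Ω : Type*}
  {τ : ℕ → Fin m → ℝ} {σ : ℕ → ℝ} {α : ℝ} {I : ℕ → Ω → Fin m} {x0 : Primal n} {y0 : Y}
  {x : ℕ → Ω → Primal n} {y : ℕ → Ω → Y} {z : ℕ → Ω → Primal n}
variable [MeasurableSpace Ω] {P : Measure Ω} [IsProbabilityMeasure P]

lemma Run.noise_integral [NeZero m] (hI : UniformBlocks P I)
    (hr : Run f Φ h φ U τ σ (fun _ => 1) I x0 y0 x y z) (u : Primal n) (w : Y) (k : ℕ) :
    Integrable (noise f Φ h φ Lyx Lyy (τ 0) (σ 0) α I x y z u w k) P ∧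
      ∫ ω, noise f Φ h φ Lyx Lyy (τ 0) (σ 0) α I x y z u w k ω ∂P = 0 := by
  have hW : ∀ i, Determined I k (nextAt f Φ h φ Lyx Lyy (τ 0) (σ 0) α x y z u w k i) := by
    intro i ω ω' hω
    unfold nextAt
    rw [hr.x_det k ω ω' hω, hr.y_det k ω ω' hω, hr.y_det_succ k ω ω' hω, hr.z_det k ω ω' hω]
  have h1 := (Determined.select hW).integrable hI.meas (P := P)
  have h2 := ((Determined.sum fun i (_ : i ∈ Finset.univ) => hW i).comp
    fun s => 1 / (m : ℝ) * s).integrable hI.meas (P := P)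
  refine ⟨h1.sub h2, ?_⟩
  unfold noise
  rw [integral_sub h1 h2, hI.integral_select hW, integral_const_mul,
    integral_finsetSum _ fun i _ => (hW i).integrable hI.meas, sub_self]

lemma Run.primalNoise_det (hr : Run f Φ h φ U τ σ (fun _ => 1) I x0 y0 x y z) (j : Fin m) (k : ℕ) :
    Determined I (k + 1) (primalNoise I x z j k) := by
  intro ω ω' hω
  have hω' : ∀ l < k, I l ω = I l ω' := fun l hl => hω l (by omega)
  unfold primalNoise
  rw [hω k (Nat.lt_succ_self k), hr.x_det k ω ω' hω', hr.z_det k ω ω' hω']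

lemma Run.primalNoise_sum_det (hr : Run f Φ h φ U τ σ (fun _ => 1) I x0 y0 x y z) (j : Fin m)
    (K : ℕ) : Determined I K fun ω => ∑ k ∈ Finset.range K, primalNoise I x z j k ω :=
  Determined.sum fun k hk => (hr.primalNoise_det j k).mono (Finset.mem_range.1 hk)

/-- The deviations of different steps are uncorrelated. -/
lemma Run.primalNoise_sum_sq [NeZero m] (hI : UniformBlocks P I)
    (hr : Run f Φ h φ U τ σ (fun _ => 1) I x0 y0 x y z) (j : Fin m) (K : ℕ) :
    ∫ ω, ‖∑ k ∈ Finset.range K, primalNoise I x z j k ω‖ ^ 2 ∂P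
      ≤ ∑ k ∈ Finset.range K, ∫ ω, ‖z k ω j - x k ω j‖ ^ 2 ∂P := by
  induction K with
  | zero => simp
  | succ K ih =>
    have hS := hr.primalNoise_sum_det j K
    have hd : Determined I K fun ω => z K ω j - x K ω j :=
      (hr.z_det K).comp₂ (hr.x_det K) fun a b => a j - b j
    have hc : Determined I K fun ω =>
        inner ℝ (∑ k ∈ Finset.range K, primalNoise I x z j k ω) (z K ω j - x K ω j) :=
      hS.comp₂ hd fun a b => inner ℝ a b
    -- The earlier sum and the proximal move of step K are both known before the draw, while the
    -- centered indicator has mean zero.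
    have h1 : ∫ ω, inner ℝ (∑ k ∈ Finset.range K, primalNoise I x z j k ω)
        (primalNoise I x z j K ω) ∂P = 0 := by
      have h2 : ∀ ω, inner ℝ (∑ k ∈ Finset.range K, primalNoise I x z j k ω)
          (primalNoise I x z j K ω)
          = (if I K ω = j then (1 : ℝ) else 0)
            * inner ℝ (∑ k ∈ Finset.range K, primalNoise I x z j k ω) (z K ω j - x K ω j)
            - 1 / m
            * inner ℝ (∑ k ∈ Finset.range K, primalNoise I x z j k ω) (z K ω j - x K ω j) := by
        intro ω
        rw [primalNoise, inner_smul_right]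
        ring
      rw [integral_congr_ae (Eventually.of_forall h2), integral_sub _
        ((hc.comp fun a => 1 / (m : ℝ) * a).integrable hI.meas), hI.integral_indicator hc j,
        integral_const_mul, sub_self]
      refine Determined.integrable (k := K + 1) hI.meas fun ω ω' hω => ?_
      have e := hc.mono (Nat.le_succ K) ω ω' hω
      simp only at e ⊢
      rw [e, hω K (Nat.lt_succ_self K)]
    have hS' := hS.mono (Nat.le_succ K)
    have hN := hr.primalNoise_det j K
    have h2 : ∀ ω, ‖∑ k ∈ Finset.range (K + 1), primalNoise I x z j k ω‖ ^ 2
        = ‖∑ k ∈ Finset.range K, primalNoise I x z j k ω‖ ^ 2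
          + 2 * inner ℝ (∑ k ∈ Finset.range K, primalNoise I x z j k ω) (primalNoise I x z j K ω)
          + ‖primalNoise I x z j K ω‖ ^ 2 := by
      intro ω
      rw [Finset.sum_range_succ, norm_add_sq_real]
    have i1 : Integrable (fun ω => ‖∑ k ∈ Finset.range K, primalNoise I x z j k ω‖ ^ 2) P :=
      (hS.comp fun a => ‖a‖ ^ 2).integrable hI.meas
    have i2 : Integrable (fun ω => 2 * inner ℝ (∑ k ∈ Finset.range K, primalNoise I x z j k ω)
        (primalNoise I x z j K ω)) P :=
      (hS'.comp₂ hN fun a b => 2 * inner ℝ a b).integrable hI.meas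
    have i3 : Integrable (fun ω => ‖primalNoise I x z j K ω‖ ^ 2) P :=
      (hN.comp fun a => ‖a‖ ^ 2).integrable hI.meas
    have h3 : ∫ ω, ‖primalNoise I x z j K ω‖ ^ 2 ∂P ≤ ∫ ω, ‖z K ω j - x K ω j‖ ^ 2 ∂P :=
      integral_mono i3 ((hd.comp fun a => ‖a‖ ^ 2).integrable hI.meas) fun ω =>
        pow_le_pow_left₀ (norm_nonneg _) (norm_primalNoise_le I x z j K ω) 2
    have i12 : Integrable (fun ω => ‖∑ k ∈ Finset.range K, primalNoise I x z j k ω‖ ^ 2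
        + 2 * inner ℝ (∑ k ∈ Finset.range K, primalNoise I x z j k ω) (primalNoise I x z j K ω)) P :=
      i1.add i2
    rw [integral_congr_ae (Eventually.of_forall h2), integral_add i12 i3,
      integral_add i1 i2, integral_const_mul, h1, Finset.sum_range_succ]
    linarith

/-- The expected squared lengths of the primal steps are summable. -/
lemma Run.primalNoise_bound [NeZero m] (hI : UniformBlocks P I)
    (hr : Run f Φ h φ U τ σ (fun _ => 1) I x0 y0 x y z)
    (hp : Problem f Φ h φ U μ Lxx Lyx Lyy) (hs : StrictSteps Lxx Lyx Lyy τ σ α)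
    {us : Primal n} {ws : Y} (hS : IsSaddleR f Φ h us ws) (j : Fin m) :
    ∃ B, ∀ K, ∫ ω, ‖∑ k ∈ Finset.range K, primalNoise I x z j k ω‖ ^ 2 ∂P ≤ B := by
  have hν : ∀ i, (0 : Fin m → ℝ) i ≤ μ i := hp.μ_nonneg
  have hν0 : ∀ i, 0 ≤ (0 : Fin m → ℝ) i := fun _ => le_rfl
  refine ⟨(slackX Lxx Lyx (τ 0) α j)⁻¹
    * pot f Φ h φ 0 Lyx Lyy (τ 0) (σ 0) 1 α Lyy x0 x0 y0 y0 us ws, fun K =>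
    (hr.primalNoise_sum_sq hI j K).trans ?_⟩
  rw [le_inv_mul_iff₀ (hs.slackX_pos j), Finset.mul_sum]
  have h1 := hr.sum_decrease hI hp hν hs.seq hS.dom_x hS.dom_y K
  have h2 : 0 ≤ ∫ ω, potAt f Φ h φ 0 Lyx Lyy τ σ (fun _ => 1) (fun _ => α) (fun _ => Lyy)
      x y us ws K ω ∂P := integral_nonneg fun ω => hr.potAt_nonneg hp hν0 hs.seq hS K ω
  rw [one_mul] at h1
  refine le_trans (Finset.sum_le_sum fun k _ => ?_) ((le_add_of_nonneg_left h2).trans h1)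
  rw [← integral_const_mul]
  refine integral_mono (((hr.z_det k).comp₂ (hr.x_det k)
    fun a b => slackX Lxx Lyx (τ 0) α j * ‖a j - b j‖ ^ 2).integrable hI.meas)
    ((hr.gain_det _ _ _ us ws k).integrable hI.meas) fun ω => ?_
  have h3 := (hr.dissip_ge hp hs.seq hS k ω).2.2.2.1
  have h4 := (hr.gain_ge hp hs.seq hS k ω).1
  rw [hs.τ_const k] at h3
  rw [one_mul] at h4
  exact (Finset.single_le_sum (f := fun i => slackX Lxx Lyx (τ 0) α i * ‖z k ω i - x k ω i‖ ^ 2)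
      (fun i _ => mul_nonneg (hs.slackX_pos i).le (sq_nonneg _)) (Finset.mem_univ j)).trans
      (h3.trans h4)

/-- Growth of the initial value of the Lyapunov function with the saddle point. -/
lemma Problem.pot_init_le [NeZero m] (hp : Problem f Φ h φ U μ Lxx Lyx Lyy) {τ : Fin m → ℝ}
    {σ : ℝ} (hσ : 0 < σ) (hy0 : y0 ∈ U) {us : Primal n} {ws : Y} (hS : IsSaddleR f Φ h us ws) :
    ∃ A B : ℝ, 0 ≤ B ∧ ∀ u w, IsSaddleR f Φ h u w →
      pot f Φ h φ 0 Lyx Lyy τ σ 1 α Lyy x0 x0 y0 y0 u w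
        ≤ A + 1 / 2 * wsq (fun i => m / τ i) (u - x0) + B * breg φ w y0 := by
  have hm : (1 : ℝ) ≤ m := by exact_mod_cast NeZero.one_le
  have hL := hp.Lyy_nonneg
  refine ⟨(m - 1) * (∑ i, (f i (x0 i)).toReal - ∑ i, (f i (us i)).toReal + Φ x0 y0 - Φ us y0
      + 1 / 2 * ‖gradY Φ x0 y0 - gradY Φ us y0‖ ^ 2),
    1 / σ + m * Lyy + (m - 1) * (1 + Lyy), ?_, fun u w hu => ?_⟩
  · have := mul_nonneg (show (0 : ℝ) ≤ m - 1 by linarith) (show 0 ≤ 1 + Lyy by linarith)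
    positivity
  -- This replaces L(u, w) by L(us, w), so the gap depends on w only through Φ and no longer on u;
  -- h(w) cancels.
  · have h1 := (hS.value_eq_left hu).symm.trans (hS.value_eq hu)
    have h2 := hp.le_add_gradY x0 y0 w
    have h3 := hp.sub_quadratic_le us y0 w
    have h4 := ContinuousLinearMap.le_opNorm (gradY Φ x0 y0 - gradY Φ us y0) (w - y0)
    have h5 := (le_abs_self _).trans h4
    rw [sub_apply] at h5
    have h6 := hp.half_sq_le_breg hy0 w
    have h7 := hp.defect_le x0 y0 w
    have h8 : inertia Lyx Lyy α Lyy x0 x0 y0 y0 = 0 := by simp [inertia]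
    have h9 := sq_nonneg (‖gradY Φ x0 y0 - gradY Φ us y0‖ - ‖w - y0‖)
    have h10 := mul_le_mul_of_nonneg_left h6 hL
    have h11 : lagrR f Φ h x0 w - lagrR f Φ h u w
        ≤ ∑ i, (f i (x0 i)).toReal - ∑ i, (f i (us i)).toReal + Φ x0 y0 - Φ us y0
          + 1 / 2 * ‖gradY Φ x0 y0 - gradY Φ us y0‖ ^ 2 + (1 + Lyy) * breg φ w y0 := by
      rw [← h1]
      unfold lagrR
      linarith
    have h12 := mul_le_mul_of_nonneg_left h11 (show (0 : ℝ) ≤ m - 1 by linarith)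
    have h13 := mul_le_mul_of_nonneg_left h7 (show (0 : ℝ) ≤ m by linarith)
    have h14 := mul_le_mul_of_nonneg_left h10 (show (0 : ℝ) ≤ m by linarith)
    unfold pot
    rw [h8, sub_self, zero_apply]
    simp only [Pi.zero_apply, mul_zero, add_zero]
    linarith

/-- Values of f and h at (u, w) are replaced by those at a fixed saddle point. For a random (u, w)
only the continuous function Φ remains, which settles measurability. -/
lemma IsSaddleR.gap_eq {us u a : Primal n} {ws w b : Y} (hS : IsSaddleR f Φ h us ws)
    (hu : IsSaddleR f Φ h u w) :
    lagrR f Φ h a w - lagrR f Φ h u b = (∑ i, (f i (a i)).toReal - ∑ i, (f i (us i)).toReal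
      + (h b).toReal - (h ws).toReal) + (Φ a w - Φ us w) + (Φ u ws - Φ u b) := by
  have h1 := (hS.value_eq_left hu).symm.trans (hS.value_eq hu)
  have h2 := hu.value_eq_left hS
  have h3 : lagrR f Φ h a w - lagrR f Φ h u b
      = (lagrR f Φ h a w - lagrR f Φ h us w) + (lagrR f Φ h u ws - lagrR f Φ h u b) := by linarith
  rw [h3]
  unfold lagrR
  ring

/-- Quadratic growth of the coupling terms of the gap. -/
lemma Problem.coupling_growth [NeZero m] (hp : Problem f Φ h φ U μ Lxx Lyx Lyy) (us : Primal n)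
    (ws y0 : Y) (a u : Primal n) (b w : Y) :
    (Φ a w - Φ us w) + (Φ u ws - Φ u b)
      ≤ (Φ a y0 - Φ us y0 + 1 / 2 * ‖gradY Φ a y0 - gradY Φ us y0‖ ^ 2
          + ‖gradY Φ us b‖ * ‖ws - b‖ + ∑ i, 1 / 2 * (Lyx i * ‖ws - b‖) ^ 2)
        + (1 + Lyy) / 2 * ‖w - y0‖ ^ 2 + ∑ i, 1 / 2 * ‖u i - us i‖ ^ 2 := by
  have h2 := hp.le_add_gradY a y0 w
  have h3 := hp.sub_quadratic_le us y0 w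
  have h5 := (le_abs_self _).trans
    (ContinuousLinearMap.le_opNorm (gradY Φ a y0 - gradY Φ us y0) (w - y0))
  rw [sub_apply] at h5
  have h9 := sq_nonneg (‖gradY Φ a y0 - gradY Φ us y0‖ - ‖w - y0‖)
  have h6 := hp.le_add_gradY u b ws
  have h7 := (le_abs_self _).trans (ContinuousLinearMap.le_opNorm (gradY Φ u b) (ws - b))
  have h8 : ‖gradY Φ u b‖ ≤ ‖gradY Φ us b‖ + ∑ i, Lyx i * ‖u i - us i‖ := by
    have h10 := hp.gradY_lip us u b b
    rw [sub_self, norm_zero, mul_zero, zero_add] at h10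
    have h11 := norm_add_le (gradY Φ us b) (gradY Φ u b - gradY Φ us b)
    rw [add_sub_cancel] at h11
    linarith
  have h10 := mul_le_mul_of_nonneg_right h8 (norm_nonneg (ws - b))
  have h11 : (∑ i, Lyx i * ‖u i - us i‖) * ‖ws - b‖
      ≤ ∑ i, 1 / 2 * (Lyx i * ‖ws - b‖) ^ 2 + ∑ i, 1 / 2 * ‖u i - us i‖ ^ 2 := by
    rw [Finset.sum_mul, ← Finset.sum_add_distrib]
    refine Finset.sum_le_sum fun i _ => ?_
    have := sq_nonneg (Lyx i * ‖ws - b‖ - ‖u i - us i‖)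
    linarith
  linarith

lemma integrable_norm_sub_sq {E : Type*} [NormedAddCommGroup E] [MeasurableSpace E]
    [BorelSpace E] [SecondCountableTopology E] {G : Ω → E} (hG : Measurable G)
    (h2 : Integrable (fun ω => ‖G ω‖ ^ 2) P) (c : E) :
    Integrable (fun ω => ‖G ω - c‖ ^ 2) P := by
  refine Integrable.mono' ((h2.const_mul 2).add (integrable_const (2 * ‖c‖ ^ 2)))
    ((hG.sub_const c).norm.pow_const 2).aestronglyMeasurable (Eventually.of_forall fun ω => ?_)
  rw [Real.norm_of_nonneg (sq_nonneg _)]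
  have h3 := norm_sub_le (G ω) c
  simp only [Pi.add_apply]
  nlinarith [norm_nonneg (G ω - c), sq_nonneg (‖G ω‖ - ‖c‖)]

lemma integrable_block_sub_sq {X : Ω → Primal n} (hX : Measurable X)
    (h2 : Integrable (fun ω => ‖X ω‖ ^ 2) P) (c : Primal n) (i : Fin m) :
    Integrable (fun ω => ‖X ω i - c i‖ ^ 2) P := by
  refine Integrable.mono' (integrable_norm_sub_sq hX h2 c)
    ((((measurable_pi_apply i).comp hX).sub_const (c i)).norm.pow_const 2).aestronglyMeasurable
    (Eventually.of_forall fun ω => ?_)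
  rw [Real.norm_of_nonneg (sq_nonneg _)]
  exact pow_le_pow_left₀ (norm_nonneg _) (norm_le_pi_norm (X ω - c) i) 2

/-- The gap of the ergodic averages at a random saddle point is integrable. -/
lemma Run.gap_integrable [NeZero m] [FiniteDimensional ℝ Y] [MeasurableSpace Y] [BorelSpace Y]
    (hI : UniformBlocks P I)
    (hr : Run f Φ h φ U τ σ (fun _ => 1) I x0 y0 x y z)
    (hp : Problem f Φ h φ U μ Lxx Lyx Lyy)
    {us : Primal n} {ws : Y} (hS : IsSaddleR f Φ h us ws) {X : Ω → Primal n} {Z : Ω → Y}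
    (hX : Measurable X) (hZ : Measurable Z) (hXZ : ∀ᵐ ω ∂P, IsSaddleR f Φ h (X ω) (Z ω))
    (hX2 : Integrable (fun ω => ‖X ω‖ ^ 2) P) (hZ2 : Integrable (fun ω => ‖Z ω‖ ^ 2) P)
    {K : ℕ} (hK : 1 ≤ K) :
    Integrable (fun ω => lagrR f Φ h (ergodic (fun k => x k ω) K) (Z ω)
      - lagrR f Φ h (X ω) (ergodic (fun k => y k ω) K)) P := by
  have : ProperSpace Y := FiniteDimensional.proper_real Y
  obtain ⟨hxd, hyd⟩ := hr.ergodic_det K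
  have hΦm : ∀ {A : Ω → Primal n} {B : Ω → Y}, Measurable A → Measurable B →
      Measurable fun ω => Φ (A ω) (B ω) := fun hA hB =>
    hp.continuous_coupling.measurable.comp (hA.prodMk hB)
  have hxm := hxd.measurable hI.meas
  have hym := hyd.measurable hI.meas
  have hg := fun ω => hp.gap_ergodic hr ω hK
  set a : Ω → Primal n := fun ω => ergodic (fun k => x k ω) K
  set b : Ω → Y := fun ω => ergodic (fun k => y k ω) K
  have hc : Determined I K fun ω => ∑ i, (f i (a ω i)).toReal - ∑ i, (f i (us i)).toReal
      + (h (b ω)).toReal - (h ws).toReal :=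
    hxd.comp₂ hyd fun a b => ∑ i, (f i (a i)).toReal - ∑ i, (f i (us i)).toReal
      + (h b).toReal - (h ws).toReal
  have hd : Determined I K fun ω => Φ (a ω) y0 - Φ us y0
      + 1 / 2 * ‖gradY Φ (a ω) y0 - gradY Φ us y0‖ ^ 2
      + ‖gradY Φ us (b ω)‖ * ‖ws - b ω‖ + ∑ i, 1 / 2 * (Lyx i * ‖ws - b ω‖) ^ 2 :=
    hxd.comp₂ hyd fun a b => Φ a y0 - Φ us y0 + 1 / 2 * ‖gradY Φ a y0 - gradY Φ us y0‖ ^ 2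
          + ‖gradY Φ us b‖ * ‖ws - b‖ + ∑ i, 1 / 2 * (Lyx i * ‖ws - b‖) ^ 2
  have hae : ∀ᵐ ω ∂P, (∑ i, (f i (a ω i)).toReal - ∑ i, (f i (us i)).toReal
      + (h (b ω)).toReal - (h ws).toReal) + (Φ (a ω) (Z ω) - Φ us (Z ω))
        + (Φ (X ω) ws - Φ (X ω) (b ω))
      = lagrR f Φ h (a ω) (Z ω) - lagrR f Φ h (X ω) (b ω) :=
    hXZ.mono fun ω hω => (hS.gap_eq hω).symm
  refine Integrable.congr ?_ hae
  refine Integrable.mono' (((hc.integrable hI.meas).add (hd.integrable hI.meas)).add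
    (((integrable_norm_sub_sq hZ hZ2 y0).const_mul ((1 + Lyy) / 2)).add
      (integrable_finsetSum Finset.univ fun i _ =>
        (integrable_block_sub_sq hX hX2 us i).const_mul (1 / 2))))
    (((hc.measurable hI.meas).add ((hΦm hxm hZ).sub (hΦm measurable_const hZ))).add
      ((hΦm hX measurable_const).sub (hΦm hX hym))).aestronglyMeasurable ?_
  filter_upwards [hXZ, hae] with ω hω hω'
  have h1 := hp.coupling_growth us ws y0 (a ω) (X ω) (b ω) (Z ω)
  have h2 := hω.le_right _ (hg ω).1
  have h3 := hω.le_left _ (hg ω).2.1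
  rw [Real.norm_of_nonneg (by rw [hω']; linarith)]
  simp only [Pi.add_apply]
  linarith

/-- The ergodic rate at a random saddle point. -/
theorem Run.random_saddle_rate [NeZero m] [FiniteDimensional ℝ Y] [MeasurableSpace Y]
    [BorelSpace Y] (hI : UniformBlocks P I)
    (hr : Run f Φ h φ U τ σ (fun _ => 1) I x0 y0 x y z)
    (hp : Problem f Φ h φ U μ Lxx Lyx Lyy) (hs : StrictSteps Lxx Lyx Lyy τ σ α)
    {us : Primal n} {ws : Y} (hS : IsSaddleR f Φ h us ws) (hy0 : y0 ∈ U)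
    {X : Ω → Primal n} {Z : Ω → Y} (hX : Measurable X)
    (hZ : Measurable Z) (hXZ : ∀ᵐ ω ∂P, IsSaddleR f Φ h (X ω) (Z ω))
    (hX2 : Integrable (fun ω => ‖X ω‖ ^ 2) P) (hZ2 : Integrable (fun ω => ‖Z ω‖ ^ 2) P) :
    ∃ C : ℝ, 0 ≤ C ∧ ∀ K : ℕ, 1 ≤ K → ∃ e : ℝ,
          HasExpectation P (fun ω => lagr f Φ h (ergodic (fun k => x k ω) K) (Z ω)
            - lagr f Φ h (X ω) (ergodic (fun k => y k ω) K)) e ∧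
          0 ≤ e ∧
          ENNReal.ofReal e ≤ ENNReal.ofReal (C * ((m : ℝ) / K))
            * (1 + ∫⁻ ω, ENNReal.ofReal (breg φ (Z ω) y0) ∂P) := by
  have : ProperSpace Y := FiniteDimensional.proper_real Y
  have hm : (1 : ℝ) ≤ m := by exact_mod_cast NeZero.one_le
  have hτ := hs.seq.τ_pos 0
  obtain ⟨A, B, hB, hAB⟩ := hp.pot_init_le (x0 := x0) (α := α) (τ := τ 0)
    (hs.seq.step 0).σ_pos hy0 hS
  choose b hb using hr.primalNoise_bound hI hp hs hS
  have hXs := fun i => integrable_block_sub_sq hX hX2 us i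
  have hX0 := fun i => integrable_block_sub_sq hX hX2 x0 i
  have hXw : Integrable (fun ω => 1 / 2 * wsq (fun i => m / τ 0 i) (X ω - x0)) P :=
    (integrable_finsetSum Finset.univ fun i _ => (hX0 i).const_mul (m / τ 0 i)).const_mul (1 / 2)
  set G := |A| + ∫ ω, 1 / 2 * wsq (fun i => m / τ 0 i) (X ω - x0) ∂P
    + ∑ j, m / (2 * τ 0 j) * (∫ ω, ‖X ω j - us j‖ ^ 2 ∂P + |b j|) with hG
  have hG0 : 0 ≤ G := by
    have h1 : 0 ≤ ∫ ω, 1 / 2 * wsq (fun i => m / τ 0 i) (X ω - x0) ∂P :=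
      integral_nonneg fun ω => mul_nonneg (by norm_num)
        (wsq_nonneg (fun i => by have := hτ i; positivity) _)
    have h2 : 0 ≤ ∑ j, m / (2 * τ 0 j) * (∫ ω, ‖X ω j - us j‖ ^ 2 ∂P + |b j|) :=
      Finset.sum_nonneg fun j _ => by
        have := hτ j
        have h3 : 0 ≤ ∫ ω, ‖X ω j - us j‖ ^ 2 ∂P := integral_nonneg fun ω => sq_nonneg _
        positivity
    have := abs_nonneg A
    linarith
  refine ⟨G + B + 1, by linarith, fun K hK => ?_⟩
  have hK0 : (0 : ℝ) < K := by exact_mod_cast hK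
  have hg := fun ω => hp.gap_ergodic hr ω hK
  have hint := hr.gap_integrable hI hp hS hX hZ hXZ hX2 hZ2 hK
  refine ⟨_, ⟨_, hXZ.mono fun ω hω => ?_, hint, rfl⟩, integral_nonneg_of_ae
    (hXZ.mono fun ω hω => ?_), ?_⟩
  · simp only
    rw [hp.lagr_eq (hg ω).1 hω.dom_y, hp.lagr_eq hω.dom_x (hg ω).2.1, ← EReal.coe_sub]
  · have h1 := hω.le_right _ (hg ω).1
    have h2 := hω.le_left _ (hg ω).2.1
    simp only [Pi.zero_apply]
    linarith
  have hCpos : 0 < (G + B + 1) * ((m : ℝ) / K) := mul_pos (by linarith) (by positivity)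
  -- The expectation of D may be infinite; then so is the right-hand side, because the summand 1 in
  -- the constant makes it positive.
  rcases eq_or_ne (∫⁻ ω, ENNReal.ofReal (breg φ (Z ω) y0) ∂P) ⊤ with htop | htop
  · rw [htop, add_top, ENNReal.mul_top (ENNReal.ofReal_pos.2 hCpos).ne']
    exact le_top
  have hφc : Continuous φ := hp.φ_convexOn.locallyLipschitz.continuous
  have hbm : Measurable fun ω => breg φ (Z ω) y0 := by
    have : Continuous fun w => breg φ w y0 := by
      unfold breg
      fun_prop
    exact this.measurable.comp hZ
  have hb0 : ∀ ω, 0 ≤ breg φ (Z ω) y0 := fun ω => hp.breg_nonneg hy0 _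
  have hbi : Integrable (fun ω => breg φ (Z ω) y0) P :=
    ⟨hbm.aestronglyMeasurable, by
      rw [hasFiniteIntegral_iff_ofReal (Eventually.of_forall hb0)]
      exact htop.lt_top⟩
  rw [← ofReal_integral_eq_lintegral_ofReal hbi (Eventually.of_forall hb0), ← ENNReal.ofReal_one,
    ← ENNReal.ofReal_add zero_le_one (integral_nonneg hb0), ← ENNReal.ofReal_mul hCpos.le]
  refine ENNReal.ofReal_le_ofReal ?_
  -- At the fixed saddle point the error has mean zero, so only the quadratic remainder survives
  -- integration.
  have hN := fun k => hr.noise_integral (f := f) (Φ := Φ) (h := h) (φ := φ) (Lyx := Lyx)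
    (Lyy := Lyy) (α := α) hI us ws k
  have hSi : ∀ j, Integrable (fun ω => ‖∑ k ∈ Finset.range K, primalNoise I x z j k ω‖ ^ 2) P :=
    fun j => ((hr.primalNoise_sum_det j K).comp fun a => ‖a‖ ^ 2).integrable hI.meas
  have hj : ∀ j, Integrable (fun ω => m / (2 * τ 0 j) * (‖X ω j - us j‖ ^ 2
      + ‖∑ k ∈ Finset.range K, primalNoise I x z j k ω‖ ^ 2)) P := fun j =>
    ((hXs j).add (hSi j)).const_mul _
  have i1 : Integrable (fun ω => A + 1 / 2 * wsq (fun i => m / τ 0 i) (X ω - x0)) P :=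
    (integrable_const A).add hXw
  have i2 : Integrable (fun ω => A + 1 / 2 * wsq (fun i => m / τ 0 i) (X ω - x0)
      + B * breg φ (Z ω) y0) P := i1.add (hbi.const_mul B)
  have i3 : Integrable (fun ω => ∑ k ∈ Finset.range K,
      noise f Φ h φ Lyx Lyy (τ 0) (σ 0) α I x y z us ws k ω) P :=
    integrable_finsetSum _ fun k _ => (hN k).1
  have i4 : Integrable (fun ω => A + 1 / 2 * wsq (fun i => m / τ 0 i) (X ω - x0)
      + B * breg φ (Z ω) y0 + ∑ k ∈ Finset.range K,
        noise f Φ h φ Lyx Lyy (τ 0) (σ 0) α I x y z us ws k ω) P := i2.add i3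
  have i5 : Integrable (fun ω => ∑ j, m / (2 * τ 0 j) * (‖X ω j - us j‖ ^ 2
      + ‖∑ k ∈ Finset.range K, primalNoise I x z j k ω‖ ^ 2)) P :=
    integrable_finsetSum _ fun j _ => hj j
  have h1 : ∫ ω, (lagrR f Φ h (ergodic (fun k => x k ω) K) (Z ω)
      - lagrR f Φ h (X ω) (ergodic (fun k => y k ω) K)) ∂P
      ≤ ∫ ω, 1 / K * (A + 1 / 2 * wsq (fun i => m / τ 0 i) (X ω - x0)
      + B * breg φ (Z ω) y0 + ∑ k ∈ Finset.range K,
        noise f Φ h φ Lyx Lyy (τ 0) (σ 0) α I x y z us ws k ω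
      + ∑ j, m / (2 * τ 0 j) * (‖X ω j - us j‖ ^ 2
      + ‖∑ k ∈ Finset.range K, primalNoise I x z j k ω‖ ^ 2)) ∂P := by
    refine integral_mono_ae hint ((i4.add i5).const_mul _) (hXZ.mono fun ω hω => ?_)
    refine ((hg ω).2.2 (X ω) (Z ω)).trans (mul_le_mul_of_nonneg_left ?_ (by positivity))
    have h2 := hr.pathwise_sum hp hs hω us ws K ω
    have h3 := hAB _ _ hω
    linarith
  rw [integral_const_mul, integral_add i4 i5, integral_add i2 i3, integral_add i1 (hbi.const_mul B),
    integral_add (integrable_const A) hXw, integral_finsetSum _ fun k _ => (hN k).1,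
    integral_finsetSum _ fun j _ => hj j, Finset.sum_eq_zero fun k _ => (hN k).2, add_zero,
    integral_const_mul B] at h1
  have h2 : ∑ j, ∫ ω, m / (2 * τ 0 j) * (‖X ω j - us j‖ ^ 2
      + ‖∑ k ∈ Finset.range K, primalNoise I x z j k ω‖ ^ 2) ∂P
      ≤ ∑ j, m / (2 * τ 0 j) * (∫ ω, ‖X ω j - us j‖ ^ 2 ∂P + |b j|) := by
    refine Finset.sum_le_sum fun j _ => ?_
    rw [integral_const_mul, integral_add (hXs j) (hSi j)]
    have := hτ j
    refine mul_le_mul_of_nonneg_left ?_ (by positivity)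
    linarith [hb j K, le_abs_self (b j)]
  have h3 : ∫ _ω, A ∂P ≤ |A| := by
    rw [integral_const, probReal_univ, one_smul]
    exact le_abs_self A
  set E := ∫ ω, breg φ (Z ω) y0 ∂P
  have hE : 0 ≤ E := integral_nonneg hb0
  have h4 : ∫ ω, (lagrR f Φ h (ergodic (fun k => x k ω) K) (Z ω)
      - lagrR f Φ h (X ω) (ergodic (fun k => y k ω) K)) ∂P ≤ 1 / K * (G + B * E) :=
    h1.trans (mul_le_mul_of_nonneg_left (by linarith) (by positivity))
  refine h4.trans ?_
  have h5 : G + B * E ≤ m * ((G + B + 1) * (1 + E)) := by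
    have h6 : G + B * E ≤ (G + B + 1) * (1 + E) := by
      have := mul_nonneg hG0 hE
      linarith
    exact h6.trans (le_mul_of_one_le_left (by positivity) hm)
  calc 1 / K * (G + B * E) ≤ 1 / K * (m * ((G + B + 1) * (1 + E))) :=
        mul_le_mul_of_nonneg_left h5 (by positivity)
    _ = _ := by ring

end RandomSaddle

/-! ### Strictness of the constant step sizes -/

lemma ConstSteps.strictSteps {m : ℕ} [NeZero m] {Lxx Lyx : Fin m → ℝ} {Lyy α cτ cσ : ℝ}
    {τ : ℕ → Fin m → ℝ} {σ : ℕ → ℝ}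
    (hs : ConstSteps Lxx Lyx Lyy α cτ cσ τ σ) (hα : 0 < α)
    (hcτ : cτ ∈ Ioc (0 : ℝ) 1) (hcτ1 : cτ < 1) (hcσ : cσ ∈ Ioc (0 : ℝ) 1) (hcσ1 : cσ < 1)
    (hLxx : ∀ i, 0 ≤ Lxx i) (hLyx : ∀ i, 0 < Lyx i) (hLyy : 0 ≤ Lyy) :
    StrictSteps Lxx Lyx Lyy τ σ α where
  seq := hs.stepSeq hα hcτ hcσ hLxx hLyx hLyy
  τ_const k := funext fun i => by rw [hs.1, hs.1]
  σ_const k := by rw [hs.2, hs.2]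
  slackX_pos i := hs.slackX_pos hα hcτ hcτ1 hLxx hLyx 0 i
  slackY_pos := hs.slackY_pos hα hcσ hcσ1 hLyy 0
  coeff_pos := by
    have hm : (0 : ℝ) < m := by exact_mod_cast NeZero.pos m
    refine lt_of_lt_of_le ?_ (hs.dual_coeff hα hcσ hLyy 0)
    have h1 : 0 < (1 - cσ) / cσ := div_pos (by linarith) hcσ.1
    have h2 : 0 < α + 2 * Lyy := by linarith
    have h3 := mul_nonneg hm.le hLyy
    have h4 : 0 < m * ((α + 2 * Lyy) * ((1 - cσ) / cσ)) := by positivity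
    linarith

/-! ### The rate of the adaptive step sizes -/

section Adaptive

variable {m : ℕ} {n : Fin m → ℕ} {Y : Type*} [NormedAddCommGroup Y] [NormedSpace ℝ Y]
  {f : (i : Fin m) → EuclideanSpace ℝ (Fin (n i)) → EReal} {Φ : Primal n → Y → ℝ}
  {h : Y → EReal} {φ : Y → ℝ} {U : Set Y} {μ Lxx Lyx : Fin m → ℝ} {α cσ : ℝ}
  {r : ℕ → ℝ} {τ : ℕ → Fin m → ℝ} {σ θ t : ℕ → ℝ}

/-- The order of decay of the adaptive step sizes. -/
lemma AdaptiveSteps.ratio_bounds [NeZero m] (hs : AdaptiveSteps μ Lxx Lyx α cσ r τ σ θ t)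
    (hα : 0 < α) (hμ : ∀ i, 0 < μ i) (hLxx : ∀ i, 0 ≤ Lxx i) (hLyx : ∀ i, 0 < Lyx i) :
    ∃ c C : ℝ, 0 < c ∧ 0 < C ∧ ∀ (i : Fin m) (K : ℕ), 1 ≤ K →
      c / (K : ℝ) ^ 2 ≤ τ K i / t K ∧ 2 * (τ K i / t K) ≤ C / (K : ℝ) ^ 2 := by
  have hm : (1 : ℝ) ≤ m := by exact_mod_cast NeZero.one_le
  have hm1 : (0 : ℝ) ≤ 1 - 1 / m := by rw [sub_nonneg, div_le_one (by linarith)]; exact hm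
  have h0 := hs.r_zero_pos hα hμ hLxx hLyx
  have i0 : Fin m := ⟨0, NeZero.pos m⟩
  have hA : ∀ i, 0 < α / Lyx i ^ 2 := fun i => by have := hLyx i; positivity
  have hB : ∀ i, 0 < μ i / (m * r 0) := fun i => by have := hμ i; positivity
  have hAs : ∀ i, α / Lyx i ^ 2 ≤ ∑ j, α / Lyx j ^ 2 := fun i =>
    Finset.single_le_sum (f := fun j => α / Lyx j ^ 2) (fun j _ => (hA j).le) (Finset.mem_univ i)
  have hBs : ∀ i, μ i / (m * r 0) ≤ ∑ j, μ j / (m * r 0) := fun i =>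
    Finset.single_le_sum (f := fun j => μ j / (m * r 0)) (fun j _ => (hB j).le) (Finset.mem_univ i)
  -- The sums over the blocks serve as uniform bounds in t/A ≤ 1/τ ≤ B t, so τ/t is of order 1/t²,
  -- that is, of order 1/K².
  set A := ∑ j, α / Lyx j ^ 2
  set B := ∑ j, μ j / (m * r 0)
  have hA0 : 0 < A := (hA i0).trans_le (hAs i0)
  have hB0 : 0 < B := (hB i0).trans_le (hBs i0)
  refine ⟨1 / (B * (1 + r 0 / 2) ^ 2), 2 * (A / (r 0 / (2 + r 0)) ^ 2), by positivity,
    by positivity, fun i K hK => ?_⟩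
  have hK0 : (0 : ℝ) < K := by exact_mod_cast hK
  obtain ⟨ht1, ht2⟩ := hs.t_growth h0 hK
  have htp : 0 < t K := lt_of_lt_of_le (by positivity) ht1
  have h1 : 1 / τ K i ≤ B * t K := by
    rw [hs.inv_τ h0 K i]
    have := mul_le_mul_of_nonneg_right (hBs i) htp.le
    have := mul_nonneg hm1 (hμ i).le
    linarith
  have h2 : t K / A ≤ 1 / τ K i := by
    refine le_trans ?_ (hs.inv_τ_ge hα hμ hLxx hLyx K i)
    rw [div_eq_mul_inv, mul_comm]
    refine mul_le_mul_of_nonneg_right ?_ htp.le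
    have h3 : A⁻¹ ≤ (α / Lyx i ^ 2)⁻¹ := inv_anti₀ (hA i) (hAs i)
    rw [inv_div] at h3
    linarith [hLxx i]
  have hinv : 0 < 1 / τ K i := lt_of_lt_of_le (by positivity) h2
  have hτ : 0 < τ K i := one_div_pos.1 hinv
  constructor
  · rw [div_div, div_le_div_iff₀ (by positivity) htp]
    have h3 : 1 ≤ B * t K * τ K i := by
      have := mul_le_mul_of_nonneg_right h1 hτ.le
      rwa [one_div_mul_cancel hτ.ne'] at this
    have h4 : t K ^ 2 ≤ ((1 + r 0 / 2) * K) ^ 2 := pow_le_pow_left₀ htp.le ht2 2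
    calc 1 * t K ≤ B * t K * τ K i * t K := by
          exact mul_le_mul_of_nonneg_right h3 htp.le
      _ = B * τ K i * t K ^ 2 := by ring
      _ ≤ B * τ K i * ((1 + r 0 / 2) * K) ^ 2 := mul_le_mul_of_nonneg_left h4 (by positivity)
      _ = _ := by ring
  · have h3 : τ K i * t K ≤ A := by
      rw [div_le_div_iff₀ hA0 hτ] at h2
      linarith
    have h4 : (r 0 / (2 + r 0) * K) ^ 2 ≤ t K ^ 2 := pow_le_pow_left₀ (by positivity) ht1 2
    rw [mul_div_assoc]
    refine mul_le_mul_of_nonneg_left ?_ zero_le_two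
    rw [div_div, ← mul_pow, div_le_div_iff₀ htp (by positivity)]
    calc τ K i * (r 0 / (2 + r 0) * K) ^ 2 ≤ τ K i * t K ^ 2 :=
          mul_le_mul_of_nonneg_left h4 hτ.le
      _ = (τ K i * t K) * t K := by ring
      _ ≤ A * t K := mul_le_mul_of_nonneg_right h3 htp.le

end Adaptive

lemma le_scaled_of_coeff {m c q E D κ : ℝ} (hm : 0 < m) (hc : c ∈ Ioc (0 : ℝ) 1) (hc1 : c < 1)
    (hq : 0 < q) (hE : 0 ≤ E) (hκ : m * (q * ((1 - c) / c)) ≤ κ) (h : κ * E ≤ m * D) :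
    E ≤ c / (1 - c) * (D / q) := by
  have hc0 := hc.1
  have h1 : 0 < 1 - c := by linarith
  have h2 := (mul_le_mul_of_nonneg_right hκ hE).trans h
  rw [mul_assoc] at h2
  have h3 := le_of_mul_le_mul_left h2 hm
  rw [div_mul_div_comm, le_div_iff₀ (by positivity)]
  have h4 := mul_le_mul_of_nonneg_left h3 hc0.le
  refine le_trans (le_of_eq ?_) h4
  field_simp

end RAPD

/-! ### Assembly of the theorem -/

theorem theorem1 {m : ℕ} {n : Fin m → ℕ}
    {Y : Type*} [NormedAddCommGroup Y] [NormedSpace ℝ Y] [FiniteDimensional ℝ Y]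
    [MeasurableSpace Y] [BorelSpace Y]
    (f : (i : Fin m) → EuclideanSpace ℝ (Fin (n i)) → EReal) (Φ : Primal n → Y → ℝ)
    (h : Y → EReal) (φ : Y → ℝ) (U : Set Y) (μ Lxx Lyx : Fin m → ℝ) (Lyy : ℝ)
    (hprob : Problem f Φ h φ U μ Lxx Lyx Lyy)
    {Ω : Type*} [MeasurableSpace Ω] (P : Measure Ω) [IsProbabilityMeasure P]
    (I : ℕ → Ω → Fin m) (hI : UniformBlocks P I)
    (xs : Primal n) (ys : Y) (hsaddle : IsSaddle f Φ h xs ys) :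
    -- Part I, step sizes satisfying the step-size condition with `t^k = θ^k = 1`
    (∀ (ν : Fin m → ℝ), (∀ i, 0 ≤ ν i ∧ ν i ≤ μ i) →
      ∀ (τ : ℕ → Fin m → ℝ) (σ : ℕ → ℝ),
      StepCond ν Lxx Lyx Lyy τ σ (fun _ => 1) (fun _ => 1) →
      ∀ (x0 : Primal n) (y0 : Y), (∀ i, f i (x0 i) ≠ ⊤) → y0 ∈ U →
      ∀ (x : ℕ → Ω → Primal n) (y : ℕ → Ω → Y),
      Generated f Φ h φ τ σ (fun _ => 1) I x0 y0 x y →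
      ∀ K : ℕ, 1 ≤ K → ∃ e : ℝ,
        HasExpectation P (fun ω => lagr f Φ h (ergodic (fun k => x k ω) K) ys
          - lagr f Φ h xs (ergodic (fun k => y k ω) K)) e ∧
        0 ≤ e ∧ e ≤ (m : ℝ) / K * Delta f Φ h φ ν Lyy (τ 0) (σ 0) xs ys x0 y0) ∧
    -- Part I, constant step sizes
    (∀ α cτ cσ : ℝ, 0 < α → cτ ∈ Ioc (0 : ℝ) 1 → cσ ∈ Ioc (0 : ℝ) 1 →
      ∀ (τ : ℕ → Fin m → ℝ) (σ : ℕ → ℝ), ConstSteps Lxx Lyx Lyy α cτ cσ τ σ →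
      ∀ (x0 : Primal n) (y0 : Y), (∀ i, f i (x0 i) ≠ ⊤) → y0 ∈ U →
      ∀ (x : ℕ → Ω → Primal n) (y : ℕ → Ω → Y),
      Generated f Φ h φ τ σ (fun _ => 1) I x0 y0 x y →
      -- the rate
      (∀ K : ℕ, 1 ≤ K → ∃ e : ℝ,
        HasExpectation P (fun ω => lagr f Φ h (ergodic (fun k => x k ω) K) ys
          - lagr f Φ h xs (ergodic (fun k => y k ω) K)) e ∧
        0 ≤ e ∧ e ≤ (m : ℝ) / K * Delta f Φ h φ 0 Lyy (τ 0) (σ 0) xs ys x0 y0) ∧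
      -- almost sure convergence to a random saddle point, and the rate at that point
      (cτ < 1 → cσ < 1 → ∃ (X : Ω → Primal n) (Z : Ω → Y), Measurable X ∧ Measurable Z ∧
        (∀ᵐ ω ∂P, IsSaddle f Φ h (X ω) (Z ω) ∧
          Tendsto (fun k => x k ω) atTop (𝓝 (X ω)) ∧
          Tendsto (fun k => y k ω) atTop (𝓝 (Z ω))) ∧
        Integrable (fun ω => ‖X ω‖ ^ 2) P ∧ Integrable (fun ω => ‖Z ω‖ ^ 2) P ∧
        ∃ C : ℝ, 0 ≤ C ∧ ∀ K : ℕ, 1 ≤ K → ∃ e : ℝ,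
          HasExpectation P (fun ω => lagr f Φ h (ergodic (fun k => x k ω) K) (Z ω)
            - lagr f Φ h (X ω) (ergodic (fun k => y k ω) K)) e ∧
          0 ≤ e ∧
          ENNReal.ofReal e ≤ ENNReal.ofReal (C * ((m : ℝ) / K))
            * (1 + ∫⁻ ω, ENNReal.ofReal (breg φ (Z ω) y0) ∂P)) ∧
      -- the dual iterates
      (cσ < 1 → ∀ K : ℕ, 1 ≤ K →
        Integrable (fun ω => breg φ ys (y K ω)) P ∧
        ∫ ω, breg φ ys (y K ω) ∂P ≤ cσ / (1 - cσ) *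
          (Delta f Φ h φ 0 Lyy (τ 0) (σ 0) xs ys x0 y0 / (α + 2 * Lyy)))) ∧
    -- Part II
    ((∀ i, 0 < μ i) → Lyy = 0 →
      -- step sizes satisfying the step-size condition
      (∀ (τ : ℕ → Fin m → ℝ) (σ θ t : ℕ → ℝ), StepCond μ Lxx Lyx Lyy τ σ θ t →
        ∀ (x0 : Primal n) (y0 : Y), (∀ i, f i (x0 i) ≠ ⊤) → y0 ∈ U →
        ∀ (x : ℕ → Ω → Primal n) (y : ℕ → Ω → Y), Generated f Φ h φ τ σ θ I x0 y0 x y →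
        ∀ K : ℕ, 1 ≤ K →
          Integrable (fun ω => 1 / 2 *
            wsq (fun i => 1 / τ K i + (1 - 1 / (m : ℝ)) * μ i) (x (K + 1) ω - xs)) P ∧
          ∫ ω, 1 / 2 *
            wsq (fun i => 1 / τ K i + (1 - 1 / (m : ℝ)) * μ i) (x (K + 1) ω - xs) ∂P
            ≤ (m : ℝ) / t K * Delta f Φ h φ μ 0 (τ 0) (σ 0) xs ys x0 y0) ∧
      -- the adaptive step sizes
      (∀ α cσ : ℝ, 0 < α → cσ ∈ Ioc (0 : ℝ) 1 →
        ∀ (r : ℕ → ℝ) (τ : ℕ → Fin m → ℝ) (σ θ t : ℕ → ℝ),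
        AdaptiveSteps μ Lxx Lyx α cσ r τ σ θ t →
        ∃ c C : ℝ, 0 < c ∧ 0 < C ∧
          (∀ (i : Fin m) (K : ℕ), 1 ≤ K →
            c / (K : ℝ) ^ 2 ≤ τ K i / t K ∧ τ K i / t K ≤ C / (K : ℝ) ^ 2) ∧
          ∀ (x0 : Primal n) (y0 : Y), (∀ i, f i (x0 i) ≠ ⊤) → y0 ∈ U →
          ∀ (x : ℕ → Ω → Primal n) (y : ℕ → Ω → Y), Generated f Φ h φ τ σ θ I x0 y0 x y →
          ∀ K : ℕ, 1 ≤ K →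
            (Integrable (fun ω => 1 / 2 *
              wsq (fun i => 1 / τ K i + (1 - 1 / (m : ℝ)) * μ i) (x (K + 1) ω - xs)) P ∧
            ∫ ω, 1 / 2 *
              wsq (fun i => 1 / τ K i + (1 - 1 / (m : ℝ)) * μ i) (x (K + 1) ω - xs) ∂P
              ≤ (m : ℝ) / t K * Delta f Φ h φ μ 0 (τ 0) (σ 0) xs ys x0 y0) ∧
            (Integrable (fun ω => wsq 1 (x K ω - xs)) P ∧
            ∫ ω, wsq 1 (x K ω - xs) ∂P
              ≤ C * ((m : ℝ) / (K : ℝ) ^ 2) * Delta f Φ h φ μ 0 (τ 0) (σ 0) xs ys x0 y0) ∧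
            (cσ < 1 →
              Integrable (fun ω => breg φ ys (y K ω)) P ∧
              ∫ ω, breg φ ys (y K ω) ∂P ≤ cσ / (1 - cσ) *
                (Delta f Φ h φ μ 0 (τ 0) (σ 0) xs ys x0 y0 / α)))) := by
  obtain ⟨ω₀⟩ : Nonempty Ω := nonempty_of_isProbabilityMeasure P
  -- An outcome exists and draws a block, so m ≥ 1 need not be assumed.
  have : NeZero m := ⟨(Fin.pos (I 0 ω₀)).ne'⟩
  have hmpos : (0 : ℝ) < m := by exact_mod_cast NeZero.pos m
  have hS := hprob.isSaddleR_of_isSaddle hsaddle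
  have hν : ∀ i, (0 : Fin m → ℝ) i ≤ μ i := hprob.μ_nonneg
  have hν0 : ∀ i, 0 ≤ (0 : Fin m → ℝ) i := fun _ => le_rfl
  refine ⟨?_, ?_, ?_⟩
  · intro ν hνμ τ σ hst x0 y0 hx0 hy0 x y hg K hK
    obtain ⟨a, b, hs⟩ := hst.exists_stepSeq
    obtain ⟨z, hr⟩ := hg.exists_run hI hprob hst.1 hst.2.1 hx0 hy0
    exact hr.ergodic_rate hI hprob (fun i => (hνμ i).2) (fun i => (hνμ i).1) hs hS hK hy0 hx0
  · intro α cτ cσ hα hcτ hcσ τ σ hcs x0 y0 hx0 hy0 x y hg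
    have hs := hcs.stepSeq hα hcτ hcσ hprob.Lxx_nonneg hprob.Lyx_pos hprob.Lyy_nonneg
    obtain ⟨z, hr⟩ := hg.exists_run hI hprob hs.τ_pos (fun k => (hs.step k).σ_pos) hx0 hy0
    refine ⟨fun K hK => hr.ergodic_rate hI hprob hν hν0 hs hS hK hy0 hx0, ?_, ?_⟩
    · intro hcτ1 hcσ1
      have hstrict : StrictSteps Lxx Lyx Lyy τ σ α :=
        hcs.strictSteps hα hcτ hcτ1 hcσ hcσ1 hprob.Lxx_nonneg hprob.Lyx_pos hprob.Lyy_nonneg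
      obtain ⟨X, Z, hX, hZ, hlim⟩ := hr.exists_limit hI hprob hstrict hS
      obtain ⟨hX2, hZ2⟩ := hr.integrable_limit hI hprob hstrict hS hy0 hx0 hX hZ
        (hlim.mono fun ω hω => hω.2)
      exact ⟨X, Z, hX, hZ, hlim.mono fun ω hω => ⟨hprob.isSaddle_of_isSaddleR hω.1, hω.2⟩, hX2, hZ2,
        hr.random_saddle_rate hI hprob hstrict hS hy0 hX hZ (hlim.mono fun ω hω => hω.1) hX2 hZ2⟩
    · intro hcσ1 K hK
      obtain ⟨h1, h2⟩ := hr.dual_bound hI hprob hν hν0 hs hS hK hy0 hx0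
      refine ⟨h1, ?_⟩
      rw [one_mul] at h2
      have h3 := hcs.dual_coeff hα hcσ hprob.Lyy_nonneg K
      have h4 := mul_nonneg hmpos.le hprob.Lyy_nonneg
      have hLyy := hprob.Lyy_nonneg
      exact le_scaled_of_coeff hmpos hcσ hcσ1 (by linarith)
        (integral_nonneg fun ω => hprob.breg_nonneg (hr.y_mem K ω) ys) (by linarith) h2
  · intro hμ hLyy
    subst hLyy
    refine ⟨?_, ?_⟩
    · intro τ σ θ t hst x0 y0 hx0 hy0 x y hg K hK
      obtain ⟨a, b, hs⟩ := hst.exists_stepSeq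
      obtain ⟨z, hr⟩ := hg.exists_run hI hprob hst.1 hst.2.1 hx0 hy0
      exact hr.primal_rate hI hprob (fun i => le_rfl) hprob.μ_nonneg hs hS hK hy0 hx0
    · intro α cσ hα hcσ r τ σ θ t hst
      obtain ⟨a, hs, hcoeff⟩ := hst.exists_stepSeq hα hcσ hμ hprob.Lxx_nonneg hprob.Lyx_pos
      obtain ⟨c, C, hc, hC, hcC⟩ := hst.ratio_bounds hα hμ hprob.Lxx_nonneg hprob.Lyx_pos
      have htp : ∀ k, 0 < t k := fun k => (hs.step k).t_pos
      refine ⟨c, C, hc, hC, fun i K hK => ⟨(hcC i K hK).1, ?_⟩, ?_⟩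
      · have h1 : 0 < τ K i / t K := div_pos (hs.τ_pos K i) (htp K)
        linarith [(hcC i K hK).2]
      · intro x0 y0 hx0 hy0 x y hg K hK
        obtain ⟨z, hr⟩ := hg.exists_run hI hprob hs.τ_pos (fun k => (hs.step k).σ_pos) hx0 hy0
        refine ⟨hr.primal_rate hI hprob (fun i => le_rfl) hprob.μ_nonneg hs hS hK hy0 hx0, ?_, ?_⟩
        · obtain ⟨h1, h2⟩ := hr.mean_square_bound hI hprob (fun i => le_rfl) hprob.μ_nonneg hs hS
            hK hy0 hx0 fun i => (hcC i K hK).2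
          refine ⟨h1, h2.trans (le_of_eq ?_)⟩
          rw [div_mul_eq_mul_div, mul_div_assoc]
        · intro hcσ1
          obtain ⟨h1, h2⟩ := hr.dual_bound hI hprob (fun i => le_rfl) hprob.μ_nonneg hs hS hK
            hy0 hx0
          rw [hcoeff K] at h2
          exact ⟨h1, le_scaled_of_coeff hmpos hcσ hcσ1 hα
            (integral_nonneg fun ω => hprob.breg_nonneg (hr.y_mem K ω) ys) le_rfl h2⟩
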